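/- **Isometric model.** Let $$P=\begin{pmatrix}3&3&5&4\\1&2&3&3\\1&1&2&1\\2&3&5&5\end{pmatrix},\qquad Q=\begin{pmatrix}1&0&0&0\\0&1&1&0\\0&0&1&1\\0&1&0&0\end{pmatrix},$$ let $\nu$ be the eigenvector of $P$ with positive entries of sum $1$ (it belongs to the Perron–Frobenius eigenvalue), let $\lambda=(\lambda_1,\lambda_2,\lambda_3,\lambda_4)=Q\nu$ and $|\lambda|=\lambda_1+\lambda_2+\lambda_3+\lambda_4$. Put $I_1=[0,\lambda_1)$, $I_2=[\lambda_1,\lambda_1+\lambda_2)$, $I_3=[\lambda_1+\lambda_2,\lambda_1+\lambda_2+\lambda_3)$, $I_4=[\lambda_1+\lambda_2+\lambda_3,|\lambda|]$, and let $T:[0,|\lambda|]\to[0,|\lambda|]$ be the $4$-interval exchange transformation with flips $$T(x)=\begin{cases}-x+\lambda_1+\lambda_3,&x\in I_1\\-x+\lambda_1+|\lambda|,&x\in I_2\\-x+\lambda_1+\lambda_2+\lambda_3,&x\in I_3\\-x+\lambda_1+\lambda_3+|\lambda|,&x\in I_4.\end{cases}$$ **Parameters.** Let $p_1=0$, $p_2=T(\lambda_1+\lambda_2)$,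 $p_3=T(\lambda_1+\lambda_2+\lambda_3)$, $p_4=|\lambda|$, let $c_{ij}=\sum_{k\ge0,\ T^k(p_j)\in I_i}2^{-k}$ for $1\le i,j\le4$, and let $M$ be the $3\times3$ matrix with entries $c_{ij}-c_{i4}$. The linear system $$u=\tfrac12M\begin{pmatrix}-1&-1&-1\\0&1&0\\0&0&1\end{pmatrix}u+\tfrac12M\begin{pmatrix}1\\0\\0\end{pmatrix}+\tfrac12\begin{pmatrix}c_{14}\\c_{24}\\c_{34}\end{pmatrix}$$ has a unique solution $u=(u_1,u_2,u_3)$; it satisfies $u_1,u_2,u_3>0$ and $u_1+u_2+u_3<1$. With $z_1=u_1$, $z_2=u_1+u_2$, $z_3=u_1+u_2+u_3$, the numbers $$d_1=\frac1{3z_1}-1\approx0.213841,\qquad d_2=\frac{2-3z_2}{3z_2-1}\approx4.036935,\qquad d_3=\frac{3-3z_3}{3z_3-2}\approx1.428826$$ are positive (the errors are less than $10^{-6}$). **Switched server systems.** Let $d_{ij}>0$ ($1\le i,j\le3$, $i\ne j$). The system consists of three tanks with levels $v(t)=(v_1(t),v_2(t),v_3(t))$, $t\ge0$, in $\Delta=\{v: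 v_i\ge0,\ v_1+v_2+v_3=1\}$, and a server with right-continuous position $l(t)\in\{1,2,3\}$, initially at a non-empty tank. Every tank is filled at rate $\frac13$, and tank $l(t)$ is drained at rate $1$. When a tank $i$ is empty, the server goes to the tank $j\ne i$ with the largest $d_{ij}v_j$; a tie is decided by $1\to3$, $2\to1$, $3\to2$. At all other times it stays where it is. The switching times $0\le t_1<t_2<\cdots$ are the times at which some tank is empty, that is, $v(t)\in\partial\Delta$. The Poincaré map $F:\partial\Delta\to\partial\Delta$ sends the state at a switching time to the state at the next one. Let $\varphi:[0,1]\to\partial\Delta$ be the anticlockwise arc-length parametrization (constant speed) running from $\mathbf e_2$ through $\mathbf e_3$ and $\mathbf e_1$ back to $\mathbf e_2$. A map $f:[0,1]\to[0,1]$ is topologically semiconjugate to $T$ if $h\circ f=T\circ h$ for some continuous, surjective, nondecreasing $h:[0,1]\to[0,|\lambda|]$; $F$ is so if there is an $f:[0,1]\to[0,1]$ with $\varphi\circ f=F\circ\varphi$ that is so. **Theorem.** Every switched server system with $$\frac{d_{13}}{d_{12}}=d_1,\qquad\frac{d_{21}}{d_{23}}=d_2,\qquad\frac{d_{32}}{d_{31}}=d_3$$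 has the following properties. (a) It has no periodic orbit. (b) Its Poincaré map $F:\partial\Delta\to\partial\Delta$ is topologically semiconjugate to $T$. (c) For every $v\in\partial\Delta$ the $\omega$-limit set $\omega_F(v)$ is a Cantor set. (d) For every motion of the system, the frequency $\mathrm{freq}(i)=\lim_{n\to\infty}\frac1n\#\{1\le k\le n:\ l(t_k)=i\}$ with which the server is connected to tank $i$ exists, and $$\mathrm{freq}(1)=\frac{\lambda_3}{|\lambda|}\approx34.44\%,\qquad\mathrm{freq}(2)=\frac{\lambda_1+\lambda_4}{|\lambda|}\approx41.82\%,\qquad\mathrm{freq}(3)=\frac{\lambda_2}{|\lambda|}\approx23.72\%$$ (the errors are less than $0.01$ percentage points). -/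

import Mathlib

open Set Filter Topology Matrix

noncomputable section

namespace SwitchedServer

/-! ### The switched server system

Tanks are indexed by `Fin 3` (tank `i + 1` of the text is index `i`).  Every tank is filled at rate
`1/3`, and the server drains the tank to which it is connected at rate `1`. -/

/-- The boundary of the phase space: the states in which some tank is empty. -/
def boundary : Set (Fin 3 → ℝ) := {v | v ∈ stdSimplex ℝ (Fin 3) ∧ ∃ i, v i = 0}

/-- The tank to which the server moves when tank `i` is empty and the levels are `v`: among the two
other tanks, `i + 1` and `i + 2`, the one with the larger scaled volume `d i j * v j`, and
`i + 2` (that is, `1 → 3`, `2 → 1`, `3 → 2`) in case of a tie. -/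
def nextTank (d : Fin 3 → Fin 3 → ℝ) (i : Fin 3) (v : Fin 3 → ℝ) : Fin 3 :=
  if d i (i + 1) * v (i + 1) ≤ d i (i + 2) * v (i + 2) then i + 2 else i + 1

/-- The rate of change of the level of tank `i` while the server is connected to tank `j`. -/
def rate (j i : Fin 3) : ℝ := 1 / 3 - if j = i then 1 else 0

/-- A motion of the switched server system with parameters `d`, for all times `t ≥ 0`. -/
structure Trajectory (d : Fin 3 → Fin 3 → ℝ) where
  /-- The levels `v(t)`. -/
  level : ℝ → Fin 3 → ℝ
  /-- The position `l(t)` of the server. -/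
  server : ℝ → Fin 3
  /-- The switching times, in increasing order; `switch k` is `t_{k+1}`. -/
  switch : ℕ → ℝ
  level_mem : ∀ t, 0 ≤ t → level t ∈ stdSimplex ℝ (Fin 3)
  /-- The server is initially connected to a non-empty tank. -/
  initial : 0 < level 0 (server 0)
  continuousOn_level : ContinuousOn level (Ici 0)
  hasDeriv_level : ∀ t, 0 ≤ t → ∀ i,
    HasDerivWithinAt (fun s => level s i) (rate (server t) i) (Ici t) t
  rightContinuous_server : ∀ t, 0 ≤ t → ContinuousWithinAt server (Ici t) t
  /-- The server does not move as long as no tank is empty. -/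
  server_stays : ∀ t, 0 < t → (∀ i, level t i ≠ 0) → ContinuousAt server t
  /-- When a tank is empty the server is at the tank selected by the switching rule. -/
  server_moves : ∀ t, 0 ≤ t → ∀ i, level t i = 0 → server t = nextTank d i (level t)
  strictMono_switch : StrictMono switch
  range_switch : range switch = {t | 0 ≤ t ∧ ∃ i, level t i = 0}

/-- The system has a periodic orbit. -/
def HasPeriodicOrbit (d : Fin 3 → Fin 3 → ℝ) : Prop :=
  ∃ S : Trajectory d, ∃ τ : ℝ, 0 < τ ∧ ∀ t, 0 ≤ t → S.level (t + τ) = S.level t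

/-- The proportion of the first `n` switching times at which the server is connected to tank `i`. -/
def Trajectory.proportion {d : Fin 3 → Fin 3 → ℝ} (S : Trajectory d) (i : Fin 3) (n : ℕ) : ℝ :=
  (((Finset.range n).filter fun k => S.server (S.switch k) = i).card : ℝ) / n

/-- The frequency with which the server is connected to tank `i` exists and is equal to `p`. -/
def Trajectory.HasFreq {d : Fin 3 → Fin 3 → ℝ} (S : Trajectory d) (i : Fin 3) (p : ℝ) : Prop :=
  Tendsto (S.proportion i) atTop (𝓝 p)

/-- The position of the server at a switching time with boundary state `v`. -/
def serverAt (d : Fin 3 → Fin 3 → ℝ) (v : Fin 3 → ℝ) : Fin 3 :=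
  if v 0 = 0 then nextTank d 0 v else if v 1 = 0 then nextTank d 1 v else nextTank d 2 v

/-- The levels after a time `s` during which the server drains tank `j`. -/
def flow (j : Fin 3) (v : Fin 3 → ℝ) (s : ℝ) : Fin 3 → ℝ := fun i => v i + rate j i * s

/-- The Poincaré map on the boundary: from the state at a switching time to the state at the next
switching time, when the tank being drained (at the net rate `1 - 1/3`) is empty. -/
def poincareMap (d : Fin 3 → Fin 3 → ℝ) (v : Fin 3 → ℝ) : Fin 3 → ℝ :=
  flow (serverAt d v) v (v (serverAt d v) / (1 - 1 / 3))

/-- The anticlockwise arc-length parametrization of the boundary, starting at `(0, 1, 0)`. -/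
def param (t : ℝ) : Fin 3 → ℝ :=
  if t < 1 / 3 then ![0, 1 - 3 * t, 3 * t]
  else if t < 2 / 3 then ![3 * t - 1, 0, 2 - 3 * t]
  else ![3 - 3 * t, 3 * t - 2, 0]

/-- Topological semiconjugacy of `f : [0, 1] → [0, 1]` to `T : [0, a] → [0, a]`. -/
def IsSemiconj (f T : ℝ → ℝ) (a : ℝ) : Prop :=
  ∃ h : ℝ → ℝ, ContinuousOn h (Icc 0 1) ∧ MonotoneOn h (Icc 0 1) ∧ h '' Icc 0 1 = Icc 0 a ∧
    ∀ x ∈ Icc (0 : ℝ) 1, h (f x) = T (h x)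

/-- Topological semiconjugacy of a self-map `F` of the boundary to `T : [0, a] → [0, a]`: the map
`f = φ⁻¹ ∘ F ∘ φ` of `[0, 1]` is semiconjugate to `T`, where `φ` is `param`. -/
def BoundaryIsSemiconj (F : (Fin 3 → ℝ) → Fin 3 → ℝ) (T : ℝ → ℝ) (a : ℝ) : Prop :=
  MapsTo F boundary boundary ∧
    ∃ f : ℝ → ℝ, MapsTo f (Icc 0 1) (Icc 0 1) ∧
      (∀ z ∈ Icc (0 : ℝ) 1, param (f z) = F (param z)) ∧ IsSemiconj f T a

/-- The `ω`-limit set of the orbit of `v` under `F`. -/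
def omegaSet (F : (Fin 3 → ℝ) → Fin 3 → ℝ) (v : Fin 3 → ℝ) : Set (Fin 3 → ℝ) :=
  omegaLimit atTop (fun n : ℕ => F^[n]) {v}

/-- A Cantor set: non-empty, compact, perfect and totally disconnected. -/
def IsCantorSet {X : Type*} [TopologicalSpace X] (K : Set X) : Prop :=
  K.Nonempty ∧ IsCompact K ∧ Perfect K ∧ IsTotallyDisconnected K

/-! ### The isometric model

The vectors and intervals numbered `1, …, 4` in the text are indexed by `Fin 4`. -/

/-- The matrix `P`. -/
def P : Matrix (Fin 4) (Fin 4) ℝ :=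
  !![3, 3, 5, 4;
     1, 2, 3, 3;
     1, 1, 2, 1;
     2, 3, 5, 5]

/-- The matrix `Q`. -/
def Q : Matrix (Fin 4) (Fin 4) ℝ :=
  !![1, 0, 0, 0;
     0, 1, 1, 0;
     0, 0, 1, 1;
     0, 1, 0, 0]

/-- `η` is the Perron-Frobenius eigenvalue of the positive matrix `P`, and `ν` is the
probability eigenvector with positive entries for it.  (The Perron-Frobenius eigenvalue of a
positive matrix is the only one that has an eigenvector with positive entries.) -/
def IsPerronPair (η : ℝ) (ν : Fin 4 → ℝ) : Prop :=
  P *ᵥ ν = η • ν ∧ (∀ i, 0 < ν i) ∧ ∑ i, ν i = 1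

/-- `|lam|`, the sum of the entries. -/
def total (lam : Fin 4 → ℝ) : ℝ := ∑ i, lam i

/-- The partition of `[0, |lam|]` into four intervals. -/
def cell (lam : Fin 4 → ℝ) : Fin 4 → Set ℝ :=
  ![Ico 0 (lam 0),
    Ico (lam 0) (lam 0 + lam 1),
    Ico (lam 0 + lam 1) (lam 0 + lam 1 + lam 2),
    Icc (lam 0 + lam 1 + lam 2) (total lam)]

/-- The map `T` of `[0, |lam|]`: a 4-interval exchange transformation with flips. -/
def iet (lam : Fin 4 → ℝ) (x : ℝ) : ℝ :=
  if x < lam 0 then -x + lam 0 + lam 2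
  else if x < lam 0 + lam 1 then -x + lam 0 + total lam
  else if x < lam 0 + lam 1 + lam 2 then -x + lam 0 + lam 1 + lam 2
  else -x + lam 0 + lam 2 + total lam

/-- The points `p_1, …, p_4`. -/
def pt (lam : Fin 4 → ℝ) : Fin 4 → ℝ :=
  ![0, iet lam (lam 0 + lam 1), iet lam (lam 0 + lam 1 + lam 2), total lam]

open scoped Classical in
/-- `c_{ij}`, the sum of `1 / 2 ^ k` over the `k ≥ 0` with `T^k (p_j) ∈ I_i`. -/
def coef (lam : Fin 4 → ℝ) (i j : Fin 4) : ℝ :=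
  ∑' k : ℕ, if (iet lam)^[k] (pt lam j) ∈ cell lam i then (1 : ℝ) / 2 ^ k else 0

/-- The matrix `M`. -/
def M (lam : Fin 4 → ℝ) : Matrix (Fin 3) (Fin 3) ℝ :=
  Matrix.of fun i j => coef lam i.castSucc j.castSucc - coef lam i.castSucc 3

/-- The linear system for `u = (u_1, u_2, u_3)`. -/
def SolvesSystem (lam : Fin 4 → ℝ) (u : Fin 3 → ℝ) : Prop :=
  u = (1 / 2 : ℝ) • ((M lam * !![-1, -1, -1; 0, 1, 0; 0, 0, 1]) *ᵥ u)
    + (1 / 2 : ℝ) • (M lam *ᵥ ![1, 0, 0])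
    + (1 / 2 : ℝ) • ![coef lam 0 3, coef lam 1 3, coef lam 2 3]

/-- `d_1`. -/
def d₁ (u : Fin 3 → ℝ) : ℝ := 1 / (3 * u 0) - 1

/-- `d_2`. -/
def d₂ (u : Fin 3 → ℝ) : ℝ := (2 - 3 * (u 0 + u 1)) / (3 * (u 0 + u 1) - 1)

/-- `d_3`. -/
def d₃ (u : Fin 3 → ℝ) : ℝ := (3 - 3 * (u 0 + u 1 + u 2)) / (3 * (u 0 + u 1 + u 2) - 2)

/-! ### Consistency: motions exist, and `poincareMap` is the map between switching times -/

theorem nextTank_ne (d : Fin 3 → Fin 3 → ℝ) (i : Fin 3) (v : Fin 3 → ℝ) : nextTank d i v ≠ i := by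
  unfold nextTank; split_ifs <;> fin_cases i <;> decide

theorem sum_three (i : Fin 3) (v : Fin 3 → ℝ) : ∑ k, v k = v i + v (i + 1) + v (i + 2) := by
  rw [Fin.sum_univ_three]; fin_cases i <;> simp <;> ring_nf

theorem exists_le_nextTank {d : Fin 3 → Fin 3 → ℝ} (hd : ∀ i j, i ≠ j → 0 < d i j) :
    ∃ c : ℝ, 0 < c ∧ ∀ v ∈ stdSimplex ℝ (Fin 3), ∀ i, v i = 0 → c ≤ v (nextTank d i v) := by
  have key : ∀ i : Fin 3, ∃ c : ℝ, 0 < c ∧ ∀ v ∈ stdSimplex ℝ (Fin 3), v i = 0 →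
      c ≤ v (nextTank d i v) := by
    intro i
    have ha : 0 < d i (i + 1) := hd _ _ (by fin_cases i <;> decide)
    have hb : 0 < d i (i + 2) := hd _ _ (by fin_cases i <;> decide)
    set a := d i (i + 1) with hae
    set b := d i (i + 2) with hbe
    refine ⟨min (a / (a + b)) (b / (a + b)), by positivity, fun v hv hi => ?_⟩
    have hs := hv.2
    rw [sum_three i, hi] at hs
    unfold nextTank
    rw [← hae, ← hbe]
    split_ifs with h
    · refine (min_le_left _ _).trans ?_
      rw [div_le_iff₀ (by positivity)]
      nlinarith
    · refine (min_le_right _ _).trans ?_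
      rw [div_le_iff₀ (by positivity)]
      push Not at h
      nlinarith
  choose c hc h using key
  refine ⟨min (c 0) (min (c 1) (c 2)), by simp [hc], fun v hv i hi => le_trans ?_ (h i v hv hi)⟩
  fin_cases i <;> simp

theorem nextTank_eq {d : Fin 3 → Fin 3 → ℝ} (hd : ∀ i j, i ≠ j → 0 < d i j) {v : Fin 3 → ℝ}
    (hv : v ∈ stdSimplex ℝ (Fin 3)) {i j : Fin 3} (hi : v i = 0) (hj : v j = 0) :
    nextTank d i v = nextTank d j v := by
  obtain ⟨c, hc, h⟩ := exists_le_nextTank hd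
  by_contra hne
  have h1 := h v hv i hi
  have h2 := h v hv j hj
  have hij : i ≠ j := fun e => hne (by rw [e])
  have n1 : nextTank d i v ≠ j := fun e => by rw [e, hj] at h1; linarith
  have n2 : nextTank d j v ≠ i := fun e => by rw [e, hi] at h2; linarith
  have n3 := nextTank_ne d i v
  have n4 := nextTank_ne d j v
  omega

theorem serverAt_eq {d : Fin 3 → Fin 3 → ℝ} (hd : ∀ i j, i ≠ j → 0 < d i j) {v : Fin 3 → ℝ}
    (hv : v ∈ stdSimplex ℝ (Fin 3)) {i : Fin 3} (hi : v i = 0) :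
    serverAt d v = nextTank d i v := by
  unfold serverAt
  split_ifs with h0 h1
  · exact nextTank_eq hd hv h0 hi
  · exact nextTank_eq hd hv h1 hi
  · have : i = 2 := by
      fin_cases i
      · exact absurd hi h0
      · exact absurd hi h1
      · rfl
    rw [this]

theorem flow_mem {j : Fin 3} {v : Fin 3 → ℝ} (hv : v ∈ stdSimplex ℝ (Fin 3)) {s : ℝ} (hs : 0 ≤ s)
    (hs' : s ≤ v j / (1 - 1 / 3)) : flow j v s ∈ stdSimplex ℝ (Fin 3) := by
  have h2 : s * (1 - 1 / 3) ≤ v j := by rwa [le_div_iff₀ (by norm_num)] at hs'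
  refine ⟨fun i => ?_, ?_⟩
  · have := hv.1 i
    unfold flow rate
    split_ifs with h
    · subst h; linarith
    · linarith
  · have hsum := hv.2
    rw [sum_three j] at hsum ⊢
    have e1 : j ≠ j + 1 := by fin_cases j <;> decide
    have e2 : j ≠ j + 2 := by fin_cases j <;> decide
    simp only [flow, rate, if_true, if_neg e1, if_neg e2]
    linarith

theorem flow_pos {j : Fin 3} {v : Fin 3 → ℝ} (hv : v ∈ stdSimplex ℝ (Fin 3)) {s : ℝ} (hs : 0 < s)
    (i : Fin 3) (hs' : i = j → s < v j / (1 - 1 / 3)) : 0 < flow j v s i := by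
  have := hv.1 i
  unfold flow rate
  split_ifs with h
  · have h2 : s * (1 - 1 / 3) < v j := by
      have := hs' h.symm
      rwa [lt_div_iff₀ (by norm_num)] at this
    subst h; linarith
  · linarith

theorem flow_self (j : Fin 3) (v : Fin 3 → ℝ) : flow j v (v j / (1 - 1 / 3)) j = 0 := by
  simp only [flow, rate, if_true]; ring

/-- Consecutive switching states are related by `poincareMap`. -/
theorem Trajectory.level_switch_succ {d : Fin 3 → Fin 3 → ℝ} (hd : ∀ i j, i ≠ j → 0 < d i j)
    (S : Trajectory d) (n : ℕ) :
    S.level (S.switch (n + 1)) = poincareMap d (S.level (S.switch n)) := by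
  have hsw : ∀ m, 0 ≤ S.switch m ∧ ∃ i, S.level (S.switch m) i = 0 := fun m => by
    have : S.switch m ∈ range S.switch := ⟨m, rfl⟩
    rwa [S.range_switch] at this
  set a := S.switch n with ha
  set b := S.switch (n + 1) with hb
  have hab : a < b := S.strictMono_switch (Nat.lt_succ_self n)
  obtain ⟨ha0, i, hi⟩ := hsw n
  obtain ⟨hb0, i', hi'⟩ := hsw (n + 1)
  have hv := S.level_mem a ha0
  set v := S.level a with hve
  set j := S.server a with hj
  have hjn : j = nextTank d i v := S.server_moves a ha0 i hi
  have hjs : serverAt d v = j := by rw [hjn, serverAt_eq hd hv hi]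
  have hvj : 0 < v j := by
    obtain ⟨c, hc, h⟩ := exists_le_nextTank hd
    rw [hjn]; exact hc.trans_le (h v hv i hi)
  have hne : ∀ t, a < t → t < b → ∀ k, S.level t k ≠ 0 := by
    intro t h1 h2 k hk
    have : t ∈ range S.switch := by rw [S.range_switch]; exact ⟨ha0.trans h1.le, k, hk⟩
    obtain ⟨m, hm⟩ := this
    rw [← hm, ha, S.strictMono_switch.lt_iff_lt] at h1
    rw [← hm, hb, S.strictMono_switch.lt_iff_lt] at h2
    omega
  have hcont : ContinuousOn S.server (Ico a b) := by
    intro t ht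
    rcases ht.1.eq_or_lt with h | h
    · subst h
      exact (S.rightContinuous_server _ ha0).mono Ico_subset_Ici_self
    · exact (S.server_stays t (ha0.trans_lt h) (hne t h ht.2)).continuousWithinAt
  have hconst : ∀ t ∈ Ico a b, S.server t = j := fun t ht =>
    isPreconnected_Ico.constant hcont ht ⟨le_rfl, hab⟩
  have hlev : ∀ t ∈ Icc a b, S.level t = flow j v (t - a) := by
    intro t ht
    funext k
    have hc : ContinuousOn (fun s => S.level s k - rate j k * (s - a)) (Icc a b) := by
      refine ContinuousOn.sub ?_ (by fun_prop)
      exact (continuous_apply k).comp_continuousOn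
        (S.continuousOn_level.mono fun s hs => ha0.trans hs.1)
    have := constant_of_has_deriv_right_zero hc (fun s hs => by
      have h1 := S.hasDeriv_level s (ha0.trans hs.1) k
      rw [hconst s hs] at h1
      have h2 : HasDerivWithinAt (fun s => rate j k * (s - a)) (rate j k) (Ici s) s := by
        simpa using (((hasDerivAt_id s).sub_const a).const_mul (rate j k)).hasDerivWithinAt
      have h3 := h1.sub h2
      rw [sub_self] at h3
      exact h3) t ht
    simp only [sub_self, mul_zero, sub_zero] at this
    simp only [flow]
    linarith
  set c := v j / (1 - 1 / 3) with hc
  have hc0 : 0 < c := by rw [hc]; apply div_pos hvj; norm_num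
  have hbc : b - a = c := by
    have hbv := hlev b ⟨hab.le, le_rfl⟩
    apply le_antisymm
    · by_contra hlt
      push Not at hlt
      refine hne (a + c) (by linarith) (by linarith) j ?_
      rw [hlev (a + c) ⟨by linarith, by linarith⟩, add_sub_cancel_left]
      exact flow_self j v
    · by_contra hlt
      push Not at hlt
      have := flow_pos hv (sub_pos.2 hab) i' (fun _ => hlt)
      rw [← hbv, hi'] at this
      exact lt_irrefl _ this
  rw [hlev b ⟨hab.le, le_rfl⟩, hbc, poincareMap, hjs]

/-- Every admissible initial condition is that of a motion. -/
theorem exists_trajectory {d : Fin 3 → Fin 3 → ℝ} (hd : ∀ i j, i ≠ j → 0 < d i j)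
    {v₀ : Fin 3 → ℝ} (hv₀ : v₀ ∈ stdSimplex ℝ (Fin 3)) {j₀ : Fin 3} (hj₀ : 0 < v₀ j₀)
    (hb : ∀ i, v₀ i = 0 → j₀ = nextTank d i v₀) :
    ∃ S : Trajectory d, S.level 0 = v₀ ∧ S.server 0 = j₀ := by
  obtain ⟨c, hc, hcle⟩ := exists_le_nextTank hd
  let step : (Fin 3 → ℝ) × Fin 3 → (Fin 3 → ℝ) × Fin 3 := fun p =>
    (flow p.2 p.1 (p.1 p.2 / (1 - 1 / 3)), serverAt d (flow p.2 p.1 (p.1 p.2 / (1 - 1 / 3))))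
  let X : ℕ → (Fin 3 → ℝ) × Fin 3 := fun m => step^[m] (v₀, j₀)
  have hX0 : X 0 = (v₀, j₀) := rfl
  have hXs : ∀ m, X (m + 1) = step (X m) := fun m => Function.iterate_succ_apply' step m _
  let w : ℕ → ℝ := fun m => (X m).1 (X m).2 / (1 - 1 / 3)
  have hX : ∀ m, (X m).1 ∈ stdSimplex ℝ (Fin 3) ∧ 0 < (X m).1 (X m).2 ∧
      ∀ i, (X m).1 i = 0 → (X m).2 = nextTank d i (X m).1 := by
    intro m
    induction m with
    | zero => exact ⟨hv₀, hj₀, hb⟩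
    | succ m ih =>
      obtain ⟨h1, h2, h3⟩ := ih
      have hmem : (X (m + 1)).1 ∈ stdSimplex ℝ (Fin 3) := by
        rw [hXs]
        exact flow_mem h1 (div_nonneg h2.le (by norm_num)) le_rfl
      have hs : ∀ i, (X (m + 1)).1 i = 0 → (X (m + 1)).2 = nextTank d i (X (m + 1)).1 := by
        intro i hi
        rw [← serverAt_eq hd hmem hi, hXs]
      have hz : (X (m + 1)).1 (X m).2 = 0 := by rw [hXs]; exact flow_self _ _
      refine ⟨hmem, ?_, hs⟩
      rw [hs _ hz]
      exact hc.trans_le (hcle _ hmem _ hz)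
  have hz : ∀ m, (X (m + 1)).1 (X m).2 = 0 := fun m => by rw [hXs]; exact flow_self _ _
  have hcX : ∀ m, c ≤ (X (m + 1)).1 (X (m + 1)).2 := fun m => by
    rw [(hX (m + 1)).2.2 _ (hz m)]; exact hcle _ (hX (m + 1)).1 _ (hz m)
  have hw : ∀ m, 0 < w m := fun m => div_pos (hX m).2.1 (by norm_num)
  have hwc : ∀ m, c ≤ w (m + 1) := fun m => by
    refine (hcX m).trans ?_
    have := (hX (m + 1)).2.1
    simp only [w]
    rw [le_div_iff₀ (by norm_num)]
    linarith
  let τ : ℕ → ℝ := fun m => ∑ k ∈ Finset.range m, w k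
  have hτ0 : τ 0 = 0 := by simp [τ]
  have hτs : ∀ m, τ (m + 1) = τ m + w m := fun m => Finset.sum_range_succ _ _
  have hτm : StrictMono τ := strictMono_nat_of_lt_succ fun m => by rw [hτs]; linarith [hw m]
  have hτc : ∀ m : ℕ, m * c ≤ τ (m + 1) := by
    intro m
    induction m with
    | zero => rw [hτs, hτ0]; simpa using (hw 0).le
    | succ m ih => rw [hτs]; push_cast; linarith [hwc m]
  have hτnn : ∀ m, 0 ≤ τ m := fun m => hτ0 ▸ hτm.monotone (Nat.zero_le m)
  have hex : ∀ t : ℝ, ∃ m, t < τ (m + 1) := by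
    intro t
    obtain ⟨m, hm⟩ := exists_nat_gt (t / c)
    exact ⟨m, ((div_lt_iff₀ hc).1 hm).trans_le (hτc m)⟩
  classical
  let N : ℝ → ℕ := fun t => Nat.find (hex t)
  have hN : ∀ m t, τ m ≤ t → t < τ (m + 1) → N t = m := by
    intro m t h1 h2
    refine (Nat.find_eq_iff _).2 ⟨h2, fun k hk h => ?_⟩
    have : τ (k + 1) ≤ τ m := hτm.monotone hk
    linarith
  have hNle : ∀ t, 0 ≤ t → τ (N t) ≤ t := by
    intro t ht
    rcases hk : N t with _ | k
    · rw [hτ0]; exact ht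
    · have : ¬ t < τ (k + 1) := Nat.find_min (hex t) (by
        change k < N t
        omega)
      exact not_lt.1 this
  have hNlt : ∀ t, t < τ (N t + 1) := fun t => Nat.find_spec (hex t)
  let L : ℝ → Fin 3 → ℝ := fun t => flow (X (N t)).2 (X (N t)).1 (t - τ (N t))
  have hflow0 : ∀ j v, flow j v 0 = v := fun j v => by funext k; simp [flow]
  have hLIcc : ∀ m, ∀ t ∈ Icc (τ m) (τ (m + 1)), L t = flow (X m).2 (X m).1 (t - τ m) := by
    intro m t ht
    rcases ht.2.eq_or_lt with h | h
    · have hn : N t = m + 1 := hN _ _ h.ge (h ▸ hτm (Nat.lt_succ_self _))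
      simp only [L, hn]
      rw [h, sub_self, hflow0, hXs, hτs, add_sub_cancel_left]
    · simp only [L, hN m t ht.1 h]
  have hflowc : ∀ j v e, Continuous fun t : ℝ => flow j v (t - e) := fun j v e =>
    continuous_pi fun k => by simp only [flow]; fun_prop
  have hτle : ∀ m, τ m ≤ τ (m + 1) := fun m => (hτm (Nat.lt_succ_self m)).le
  have hright : ∀ t, 0 ≤ t → ∀ᶠ s in 𝓝[≥] t, N s = N t := by
    intro t ht
    filter_upwards [Ico_mem_nhdsGE (hNlt t)] with s hs
    exact hN _ _ ((hNle t ht).trans hs.1) hs.2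
  have hLright : ∀ t, 0 ≤ t →
      L =ᶠ[𝓝[≥] t] fun s => flow (X (N t)).2 (X (N t)).1 (s - τ (N t)) := by
    intro t ht
    filter_upwards [hright t ht] with s hs
    simp only [L, hs]
  have hinner : ∀ t, 0 < t → τ (N t) ≠ t → ∀ᶠ s in 𝓝 t, N s = N t := by
    intro t ht hne
    filter_upwards [Ioo_mem_nhds ((hNle t ht.le).lt_of_ne hne) (hNlt t)] with s hs
    exact hN _ _ hs.1.le hs.2
  have hLz : ∀ t, 0 ≤ t → ∀ i, L t i = 0 → t = τ (N t) := by
    intro t ht i hi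
    by_contra hne
    have h1 : 0 < t - τ (N t) := sub_pos.2 ((hNle t ht).lt_of_ne (Ne.symm hne))
    have h2 : t - τ (N t) < w (N t) := by have := hNlt t; rw [hτs] at this; linarith
    exact (flow_pos (hX (N t)).1 h1 i (fun _ => h2)).ne' hi
  have hNτ : ∀ m, N (τ m) = m := fun m => hN m _ le_rfl (hτm (Nat.lt_succ_self m))
  have hLτ : ∀ m, L (τ m) = (X m).1 := fun m => by
    simp only [L, hNτ, sub_self, hflow0]
  have hrange : ∃ σ : ℕ → ℝ, StrictMono σ ∧ range σ = {t | 0 ≤ t ∧ ∃ i, L t i = 0} := by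
    by_cases h0 : ∃ i, v₀ i = 0
    · refine ⟨τ, hτm, Set.ext fun t => ⟨?_, ?_⟩⟩
      · rintro ⟨m, rfl⟩
        refine ⟨hτnn m, ?_⟩
        rw [hLτ]
        cases m with
        | zero => exact h0
        | succ m => exact ⟨_, hz m⟩
      · rintro ⟨ht, i, hi⟩
        exact ⟨_, (hLz t ht i hi).symm⟩
    · refine ⟨fun m => τ (m + 1), fun a b hab => hτm (Nat.succ_lt_succ hab),
        Set.ext fun t => ⟨?_, ?_⟩⟩
      · rintro ⟨m, rfl⟩
        exact ⟨hτnn _, (X m).2, by simp only [hLτ, hz]⟩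
      · rintro ⟨ht, i, hi⟩
        have h1 := hLz t ht i hi
        rcases hk : N t with _ | k
        · exfalso
          rw [h1, hk, hLτ] at hi
          exact h0 ⟨i, hi⟩
        · exact ⟨k, by simp only; rw [← hk]; exact h1.symm⟩
  obtain ⟨σ, hσ, hσr⟩ := hrange
  refine ⟨{
    level := L
    server := fun t => (X (N t)).2
    switch := σ
    level_mem := ?_
    initial := ?_
    continuousOn_level := ?_
    hasDeriv_level := ?_
    rightContinuous_server := ?_
    server_stays := ?_
    server_moves := ?_
    strictMono_switch := hσ
    range_switch := hσr }, ?_, ?_⟩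
  · intro t ht
    refine flow_mem (hX _).1 (sub_nonneg.2 (hNle t ht)) ?_
    have := hNlt t
    rw [hτs] at this
    change t - τ (N t) ≤ w (N t)
    linarith
  · have : N 0 = 0 := by have := hNτ 0; rwa [hτ0] at this
    have h2 := hLτ 0
    rw [hτ0] at h2
    rw [h2, this]
    exact hj₀
  · intro t ht
    have hge : ContinuousWithinAt L (Ici t) t :=
      ((hflowc _ _ _).continuousWithinAt).congr_of_eventuallyEq (hLright t ht) rfl
    rcases (show (0 : ℝ) ≤ t from ht).eq_or_lt with h0 | h0
    · subst h0; exact hge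
    refine ContinuousAt.continuousWithinAt (continuousAt_iff_continuous_left_right.2 ⟨?_, hge⟩)
    by_cases hne : τ (N t) = t
    · rcases hk : N t with _ | k
      · rw [hk, hτ0] at hne; exact absurd hne h0.ne
      · rw [hk] at hne
        have hlt : τ k < t := hne ▸ hτm (Nat.lt_succ_self k)
        refine ((hflowc (X k).2 (X k).1 (τ k)).continuousWithinAt).congr_of_eventuallyEq ?_
          (hLIcc k t ⟨hlt.le, hne.ge⟩)
        filter_upwards [Ioc_mem_nhdsLE hlt] with s hs
        exact hLIcc k s ⟨hs.1.le, hs.2.trans hne.ge⟩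
    · refine ((hflowc (X (N t)).2 (X (N t)).1 (τ (N t))).continuousAt.congr ?_).continuousWithinAt
      filter_upwards [hinner t h0 hne] with s hs
      simp only [L, hs]
  · intro t ht i
    have h1 : HasDerivWithinAt
        (fun s => flow (X (N t)).2 (X (N t)).1 (s - τ (N t)) i) (rate (X (N t)).2 i) (Ici t) t := by
      simp only [flow]
      simpa using ((((hasDerivAt_id t).sub_const (τ (N t))).const_mul
        (rate (X (N t)).2 i)).const_add ((X (N t)).1 i)).hasDerivWithinAt
    refine h1.congr_of_eventuallyEq ?_ rfl
    filter_upwards [hLright t ht] with s hs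
    rw [hs]
  · intro t ht
    refine (continuousWithinAt_const (b := (X (N t)).2)).congr_of_eventuallyEq ?_ rfl
    filter_upwards [hright t ht] with s hs
    rw [hs]
  · intro t ht hne
    refine (continuousAt_const (y := (X (N t)).2)).congr ?_
    by_cases h : τ (N t) = t
    · exfalso
      rcases hk : N t with _ | k
      · rw [hk, hτ0] at h; exact ht.ne h
      · rw [hk] at h
        refine hne (X k).2 ?_
        rw [← h, hLτ, hz]
    · filter_upwards [hinner t ht h] with s hs
      rw [hs]
  · intro t ht i hi
    have h1 := hLz t ht i hi
    have h2 : L t = (X (N t)).1 := by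
      have := hLτ (N t)
      rwa [← h1] at this
    rw [h2] at hi ⊢
    exact (hX _).2.2 i hi
  · have := hLτ 0
    rwa [hτ0] at this
  · have : N 0 = 0 := by have := hNτ 0; rwa [hτ0] at this
    simp only [this, hX0]

/-- The eigenvector in question exists. -/
theorem exists_isPerronPair : ∃ η ν, IsPerronPair η ν := by
  have hc : ContinuousOn (fun t : ℝ => t ^ 3 - 11 * t ^ 2 + 7 * t - 1) (Icc 10.33 10.332) := by
    fun_prop
  obtain ⟨η, ⟨h1, h2⟩, h0⟩ : (0 : ℝ) ∈ (fun t : ℝ => t ^ 3 - 11 * t ^ 2 + 7 * t - 1) ''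
      Icc 10.33 10.332 :=
    intermediate_value_Icc (by norm_num) hc ⟨by norm_num, by norm_num⟩
  simp only at h0
  refine ⟨η, ![(-3 * η ^ 2 + 32 * η - 9) / 4, (5 * η ^ 2 - 54 * η + 25) / 4,
    (η ^ 2 - 10 * η - 3) / 4, (-3 * η ^ 2 + 32 * η - 9) / 4], ?_, ?_, ?_⟩
  · funext i
    fin_cases i <;> simp [P, Matrix.mulVec, dotProduct, Fin.sum_univ_four] <;> nlinarith [h0]
  · intro i
    fin_cases i <;> simp <;> nlinarith
  · simp [Fin.sum_univ_four]; ring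

end SwitchedServer

end

/-! In the arc-length coordinate the Poincaré map is a piecewise contraction `contr w` of `[0, 1]`
with four pieces of slope `-1/2`: a drained tank passes half of its content to each of the other
two, and the three ratios of parameters put the break points at `z₁`, `z₂`, `z₃`. Its image leaves
four gaps, and a semiconjugacy to `T` has to collapse these gaps and their forward images to the
orbits of `p₁, …, p₄`.

This is read backwards. Let `mass` be the atomic probability on `[0, |λ|]` that puts on the orbit of
each `p_j` weights of ratio `1/2`, the first atom being as large as the gap. It equals its first
atoms plus half of its image under `T` (`mass_step`). Its quantile function `semi` is continuous
because orbits of `T` are dense, and it satisfies `semi ∘ contr w = T ∘ semi` as soon as the `i`-th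
piece has length `mass (I_i)` (`semi_contr`). These equations for the lengths are the linear system
for `u` (`Lengths.weighted`).

What remains concerns `T`. With `ν = (a, b, c, a)`, the map induced by `T` on an interval of length
`2a + b + c` is `sMap`, and `sMap` is self-similar: inducing it on the interval scaled by `κ = 1/η`
gives it back, with a substitution whose incidence matrix is `P`. One renormalization multiplies
approximation errors by `κ` (`approx_s`), so every orbit is dense (`exists_iterate_mem`) and none is
periodic (`iterate_ne`). It also multiplies the growth rate of centred Birkhoff sums by `2/7`
(`balanced_s`), so each cell is visited with frequency proportional to its length. These arguments
use orbits that avoid the ends of the cells; every orbit is of this kind from some time on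
(`eventually_reg`).

Transported by `semi`, the absence of periodic points gives (a) and the visit frequencies give (d).
For (c), every `ω`-limit set is the image of the set of points where `semi` is not locally constant
(`omegaSet_eq`); density of orbits makes it perfect, and the atoms of the mass tear it apart.

The combinatorics is decided by exact integer arithmetic in the module spanned by `a`, `b`, `c`,
with 15-digit approximations to settle signs. The numerical values come from 40 binary digits of the
series `c_{ij}`. -/

namespace FlipIET

/-! ### Renormalization of interval maps -/

/-- The first `n` points of the orbit of `x` under `F` lie in the open cells `O i`. -/
def RegUpTo (F : ℝ → ℝ) (O : Fin 4 → Set ℝ) (n : ℕ) (x : ℝ) : Prop :=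
  ∀ m < n, ∃ i, F^[m] x ∈ O i

/-- The whole forward orbit of `x` under `F` lies in the open cells `O i`. -/
def Reg (F : ℝ → ℝ) (O : Fin 4 → Set ℝ) (x : ℝ) : Prop :=
  ∀ n, ∃ i, F^[n] x ∈ O i

theorem Reg.regUpTo {F : ℝ → ℝ} {O : Fin 4 → Set ℝ} {x : ℝ} (h : Reg F O x) (n : ℕ) :
    RegUpTo F O n x := fun m _ => h m

theorem Reg.iterate {F : ℝ → ℝ} {O : Fin 4 → Set ℝ} {x : ℝ} (h : Reg F O x) (k : ℕ) :
    Reg F O (F^[k] x) := fun n => by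
  rw [← Function.iterate_add_apply]; exact h _

theorem RegUpTo.append {F : ℝ → ℝ} {O : Fin 4 → Set ℝ} {x : ℝ} {k n : ℕ} (h : RegUpTo F O k x)
    (h' : RegUpTo F O n (F^[k] x)) : RegUpTo F O (k + n) x := by
  intro m hm
  rcases lt_or_ge m k with hk | hk
  · exact h m hk
  · have := h' (m - k) (by omega)
    rwa [← Function.iterate_add_apply, Nat.sub_add_cancel hk] at this

theorem RegUpTo.reg {F : ℝ → ℝ} {O : Fin 4 → Set ℝ} {x : ℝ} {k : ℕ} (h : RegUpTo F O k x)
    (h' : Reg F O (F^[k] x)) : Reg F O x := fun n =>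
  (h.append (h'.regUpTo (n + 1))) n (by omega)

/-- The map `G` with cells `O'`, scaled by `κ`, is a map induced by `F` (with cells `O`) on an
interval; the orbit segment of a point of the `j`-th cell up to its return has itinerary `σ j`. -/
structure Renorm (F G : ℝ → ℝ) (O O' : Fin 4 → Set ℝ) (D D' : Set ℝ) (κ : ℝ)
    (σ : Fin 4 → List (Fin 4)) (E : Set ℝ) : Prop where
  path : ∀ j, ∀ y ∈ O' j, ∀ i (h : i < (σ j).length), F^[i] (κ * y) ∈ O ((σ j)[i])
  isom : ∀ j, ∀ y ∈ O' j, ∀ y' ∈ O' j, ∀ i < (σ j).length,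
    |F^[i] (κ * y) - F^[i] (κ * y')| = κ * |y - y'|
  ret : ∀ j, ∀ y ∈ O' j, F^[(σ j).length] (κ * y) = κ * G y
  -- The set `E` is to contain the end points of the floors; it only has to be countable, since
  -- density can be tested off a countable set.
  cover : ∀ x ∈ D, x ∉ E → ∃ j, ∃ y ∈ O' j, ∃ i < (σ j).length, F^[i] (κ * y) = x
  enter : ∀ x, Reg F O x → ∃ k, ∃ y ∈ D', F^[k] x = κ * y
  back : ∀ y ∈ D', Reg F O (κ * y) → ∃ j, y ∈ O' j
  inner : ∀ j, ∀ y ∈ O' j, G y ∈ D'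

namespace Renorm

variable {F G : ℝ → ℝ} {O O' : Fin 4 → Set ℝ} {D D' : Set ℝ} {κ : ℝ}
  {σ : Fin 4 → List (Fin 4)} {E : Set ℝ} {l l' : ℝ → Fin 4}

/-- The time after which the orbit of `κ * y` has made `n` returns. -/
def time (G : ℝ → ℝ) (σ : Fin 4 → List (Fin 4)) (l' : ℝ → Fin 4) (n : ℕ) (y : ℝ) : ℕ :=
  birkhoffSum G (fun z => (σ (l' z)).length) n y

theorem orbit_lift (h : Renorm F G O O' D D' κ σ E) (hl' : ∀ j, ∀ y ∈ O' j, l' y = j) {y : ℝ} :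
    ∀ {n : ℕ}, RegUpTo G O' n y → F^[time G σ l' n y] (κ * y) = κ * G^[n] y ∧
      RegUpTo F O (time G σ l' n y) (κ * y) := by
  intro n
  induction n with
  | zero => intro _; exact ⟨by simp [time], fun m hm => by simp [time] at hm⟩
  | succ n ih =>
    intro hy
    obtain ⟨h1, h2⟩ := ih fun m hm => hy m (by omega)
    obtain ⟨j, hj⟩ := hy n (Nat.lt_succ_self n)
    have e : time G σ l' (n + 1) y = time G σ l' n y + (σ j).length := by
      simp only [time, birkhoffSum_succ, hl' j _ hj]
    rw [e]
    constructor
    · rw [add_comm, Function.iterate_add_apply, h1, h.ret j _ hj, Function.iterate_succ_apply']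
    · refine h2.append fun m hm => ?_
      rw [h1]
      exact ⟨_, h.path j _ hj m hm⟩

theorem mul_le_time {m : ℕ} (hm : ∀ j, m ≤ (σ j).length) (n : ℕ) (y : ℝ) :
    n * m ≤ time G σ l' n y := by
  simp only [time, birkhoffSum]
  calc n * m = ∑ _k ∈ Finset.range n, m := by simp
    _ ≤ _ := Finset.sum_le_sum fun _ _ => hm _

theorem reg_lift (h : Renorm F G O O' D D' κ σ E) (hl' : ∀ j, ∀ y ∈ O' j, l' y = j)
    (hm : ∀ j, 1 ≤ (σ j).length) {y : ℝ} (hy : Reg G O' y) : Reg F O (κ * y) := fun n =>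
  (h.orbit_lift hl' (hy.regUpTo (n + 1))).2 n
    (lt_of_lt_of_le (by omega) (mul_le_time hm (n + 1) y))

/-- By `back`, an orbit of `G` can leave the open cells only at points whose scaled copies are
singular for `F`; `inner` keeps it in `D'`. -/
theorem reg_of_reg (h : Renorm F G O O' D D' κ σ E) {y : ℝ} (hy : y ∈ D')
    (hr : Reg F O (κ * y)) : Reg G O' y := by
  have key : ∀ n, G^[n] y ∈ D' ∧ Reg F O (κ * G^[n] y) := by
    intro n
    induction n with
    | zero => exact ⟨hy, hr⟩
    | succ n ih =>
      obtain ⟨j, hj⟩ := h.back _ ih.1 ih.2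
      rw [Function.iterate_succ_apply']
      exact ⟨h.inner j _ hj, by rw [← h.ret j _ hj]; exact ih.2.iterate _⟩
  exact fun n => h.back _ (key n).1 (key n).2

theorem enter_reg (h : Renorm F G O O' D D' κ σ E) {x : ℝ} (hx : Reg F O x) :
    ∃ k y, Reg G O' y ∧ F^[k] x = κ * y := by
  obtain ⟨k, y, hy, e⟩ := h.enter x hx
  exact ⟨k, y, h.reg_of_reg hy (e ▸ hx.iterate k), e⟩

/-- Approximation by orbits passes from the induced map to the map. -/
theorem dense_step (h : Renorm F G O O' D D' κ σ E) (hl' : ∀ j, ∀ y ∈ O' j, l' y = j)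
    (hκ : 0 < κ) {E' : Set ℝ} {δ : ℝ}
    (hG : ∀ x, Reg G O' x → ∀ j, ∀ z ∈ O' j, z ∉ E' → ∃ k, G^[k] x ∈ O' j ∧ |G^[k] x - z| ≤ δ)
    {x : ℝ} (hx : Reg F O x) {z : ℝ} (hz : z ∈ D)
    (hzE : z ∉ E ∪ ⋃ i : ℕ, (fun y => F^[i] (κ * y)) '' E') :
    ∃ k j, F^[k] x ∈ O j ∧ z ∈ O j ∧ |F^[k] x - z| ≤ κ * δ := by
  simp only [mem_union, mem_iUnion, mem_image, not_or, not_exists, not_and] at hzE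
  obtain ⟨j, y, hy, i, hi, rfl⟩ := h.cover z hz hzE.1
  obtain ⟨k, w, hw, e⟩ := h.enter_reg hx
  obtain ⟨m, hm, hd⟩ := hG w hw j y hy fun hE => hzE.2 i y hE rfl
  have hp := (h.orbit_lift hl' (hw.regUpTo m)).1
  -- Enter the small interval, make `m` returns to come close to `y`, then climb `i` floors; the
  -- climb is an isometry, so the error is only scaled by `κ`.
  refine ⟨i + (time G σ l' m w + k), _, ?_, h.path j y hy i hi, ?_⟩ <;>
    rw [Function.iterate_add_apply, Function.iterate_add_apply, e, hp]
  · exact h.path j _ hm i hi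
  · rw [h.isom j _ hm _ hy i hi]
    exact mul_le_mul_of_nonneg_left hd hκ.le

theorem birkhoffSum_word (h : Renorm F G O O' D D' κ σ E) (hl : ∀ j, ∀ x ∈ O j, l x = j)
    (ψ : Fin 4 → ℝ) {j : Fin 4} {y : ℝ} (hy : y ∈ O' j) :
    birkhoffSum F (fun x => ψ (l x)) (σ j).length (κ * y) = ((σ j).map ψ).sum := by
  rw [birkhoffSum, ← Fin.sum_univ_fun_getElem, Finset.sum_range]
  exact Finset.sum_congr rfl fun i _ => by rw [hl _ _ (h.path j y hy i i.2)]

theorem birkhoffSum_time (h : Renorm F G O O' D D' κ σ E) (hl : ∀ j, ∀ x ∈ O j, l x = j)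
    (hl' : ∀ j, ∀ y ∈ O' j, l' y = j) (ψ : Fin 4 → ℝ) {y : ℝ} (hy : Reg G O' y) (n : ℕ) :
    birkhoffSum F (fun x => ψ (l x)) (time G σ l' n y) (κ * y) =
      birkhoffSum G (fun z => ((σ (l' z)).map ψ).sum) n y := by
  induction n with
  | zero => simp [time]
  | succ n ih =>
    obtain ⟨j, hj⟩ := hy n
    have e : time G σ l' (n + 1) y = time G σ l' n y + (σ j).length := by
      simp only [time, birkhoffSum_succ, hl' j _ hj]
    rw [e, birkhoffSum_add, ih, (h.orbit_lift hl' (hy.regUpTo n)).1,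
      h.birkhoffSum_word hl ψ hj, birkhoffSum_succ, hl' j _ hj]

end Renorm

theorem abs_birkhoffSum_le {F : ℝ → ℝ} {l : ℝ → Fin 4} {ψ : Fin 4 → ℝ} {C : ℝ}
    (hψ : ∀ i, |ψ i| ≤ C) (n : ℕ) (x : ℝ) : |birkhoffSum F (fun x => ψ (l x)) n x| ≤ C * n := by
  rw [birkhoffSum]
  refine (Finset.abs_sum_le_sum_abs _ _).trans ?_
  calc _ ≤ ∑ _k ∈ Finset.range n, C := Finset.sum_le_sum fun _ _ => hψ _
    _ = C * n := by simp [mul_comm]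

/-- Along every regular orbit, the Birkhoff sums of a function of the cell with
vanishing mean (with respect to the weights `w`) are bounded by `ε n + C`. -/
def Balanced (F : ℝ → ℝ) (O : Fin 4 → Set ℝ) (l : ℝ → Fin 4) (w : Fin 4 → ℝ) (ε : ℝ) : Prop :=
  ∀ ψ : Fin 4 → ℝ, ∑ i, ψ i * w i = 0 → (∀ i, |ψ i| ≤ 1) → ∀ x, Reg F O x →
    ∃ C, ∀ n : ℕ, |birkhoffSum F (fun x => ψ (l x)) n x| ≤ ε * n + C

/-- A return replaces the values of `ψ` by their sum over a word, which is again centred and at most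
`2`, while it takes at least `m` steps. Hence the rate gains the factor `2 / m`. The time before the
entrance and the incomplete last return go into the constant. -/
theorem Renorm.balanced {F G : ℝ → ℝ} {O O' : Fin 4 → Set ℝ} {D D' : Set ℝ} {κ : ℝ}
    {σ : Fin 4 → List (Fin 4)} {E : Set ℝ} {l l' : ℝ → Fin 4} {w w' : Fin 4 → ℝ} {ε : ℝ}
    (h : Renorm F G O O' D D' κ σ E) (hl : ∀ j, ∀ x ∈ O j, l x = j)
    (hl' : ∀ j, ∀ y ∈ O' j, l' y = j) {m : ℕ} (hm0 : 0 < m) (hm : ∀ j, m ≤ (σ j).length)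
    (hσ : ∀ ψ : Fin 4 → ℝ, ∑ i, ψ i * w i = 0 → (∀ i, |ψ i| ≤ 1) →
      ∑ j, ((σ j).map ψ).sum * w' j = 0 ∧ ∀ j, |((σ j).map ψ).sum| ≤ 2)
    (hε : 0 ≤ ε) (hG : Balanced G O' l' w' ε) : Balanced F O l w (2 * ε / m) := by
  intro ψ hψ hψ1 x hx
  obtain ⟨k, y, hy, e⟩ := h.enter_reg hx
  obtain ⟨h0, h2⟩ := hσ ψ hψ hψ1
  -- Halving restores the bound `1` required by `Balanced`; the factor returns as the `2` in `2 * ε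
  -- / m`.
  obtain ⟨C, hC⟩ := hG (fun j => ((σ j).map ψ).sum / 2)
    (by rw [← mul_zero (1 / 2 : ℝ), ← h0, Finset.mul_sum]
        exact Finset.sum_congr rfl fun _ _ => by ring)
    (fun j => by rw [abs_div, abs_two]; linarith [h2 j]) y hy
  obtain ⟨K, hK⟩ : ∃ K : ℕ, ∀ j, (σ j).length ≤ K :=
    ⟨∑ j, (σ j).length, fun j => Finset.single_le_sum (f := fun j => (σ j).length)
      (fun _ _ => Nat.zero_le _) (Finset.mem_univ j)⟩
  have hmR : (0 : ℝ) < m := by exact_mod_cast hm0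
  have hC0 : 0 ≤ C := by simpa using (hC 0)
  refine ⟨k + K + 2 * C, fun n => ?_⟩
  have hεn : 0 ≤ 2 * ε / m * n := by positivity
  rcases le_total n k with hnk | hnk
  · have := abs_birkhoffSum_le (F := F) (l := l) hψ1 n x
    have h3 : (n : ℝ) ≤ k := by exact_mod_cast hnk
    have h4 : (0 : ℝ) ≤ K := by positivity
    linarith
  · have hex : ∃ q, n - k < Renorm.time G σ l' (q + 1) y :=
      ⟨n, lt_of_lt_of_le (by nlinarith [Nat.sub_le n k]) (Renorm.mul_le_time hm (n + 1) y)⟩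
    classical
    -- `q` is the number of complete returns between the entrance at time `k` and time `n`; the
    -- remainder is shorter than one word, hence at most `K`.
    set q := Nat.find hex with hq
    have hlt : n - k < Renorm.time G σ l' (q + 1) y := Nat.find_spec hex
    have hle : Renorm.time G σ l' q y ≤ n - k := by
      rcases hk : q with _ | r
      · simp [Renorm.time]
      · exact not_lt.1 (Nat.find_min hex (m := r) (by omega))
    set R := Renorm.time G σ l' q y with hR
    have hs : n - k - R ≤ K := by
      have : Renorm.time G σ l' (q + 1) y = R + (σ (l' (G^[q] y))).length := by
        simp only [hR, Renorm.time, birkhoffSum_succ]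
      have := hK (l' (G^[q] y))
      omega
    have hn : n = k + (R + (n - k - R)) := by omega
    have hqm : (q : ℝ) * m ≤ n := by
      have : q * m ≤ n := (Renorm.mul_le_time hm q y).trans (hle.trans (Nat.sub_le _ _))
      exact_mod_cast this
    have b1 := abs_birkhoffSum_le (F := F) (l := l) hψ1 k x
    have b3 := abs_birkhoffSum_le (F := F) (l := l) hψ1 (n - k - R) (F^[R] (κ * y))
    have b2 : |birkhoffSum F (fun x => ψ (l x)) R (κ * y)| ≤ 2 * (ε * q + C) := by
      rw [h.birkhoffSum_time hl hl' ψ hy q]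
      have := hC q
      have e2 : birkhoffSum G (fun z => ((σ (l' z)).map ψ).sum) q y =
          2 * birkhoffSum G (fun z => ((σ (l' z)).map ψ).sum / 2) q y := by
        simp only [birkhoffSum, Finset.mul_sum]
        exact Finset.sum_congr rfl fun _ _ => by ring
      rw [e2, abs_mul, abs_two]
      linarith
    have hsK : ((n - k - R : ℕ) : ℝ) ≤ K := by exact_mod_cast hs
    have h5 : 2 * (ε * q) ≤ 2 * ε / m * n := by
      rw [div_mul_eq_mul_div, le_div_iff₀ hmR]
      nlinarith
    rw [hn, birkhoffSum_add, birkhoffSum_add, e, ← hn]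
    refine (abs_add_le _ _).trans ?_
    refine (add_le_add_right (abs_add_le _ _) _).trans ?_
    linarith

/-! ### Exact computations in the module generated by the lengths -/

/-- Integer coordinates with respect to three real numbers `a`, `b`, `c`. -/
abbrev Vec := ℤ × ℤ × ℤ

/-- The real number with given coordinates. -/
def ev (a b c : ℝ) (v : Vec) : ℝ := v.1 * a + v.2.1 * b + v.2.2 * c

/-- Rational approximations of the three lengths, and the scaling relations between them. -/
structure Lengths (a b c κ : ℝ) : Prop where
  a_ge : (344446091267009 : ℝ) ≤ a * 10 ^ 15
  a_le : a * 10 ^ 15 ≤ 344446091267009 + 1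
  b_ge : (203947945777214 : ℝ) ≤ b * 10 ^ 15
  b_le : b * 10 ^ 15 ≤ 203947945777214 + 1
  c_ge : (107159871688767 : ℝ) ≤ c * 10 ^ 15
  c_le : c * 10 ^ 15 ≤ 107159871688767 + 1
  scale_a : κ * a = a - b - c
  scale_b : κ * b = -2 * a + 4 * b - c
  scale_c : κ * c = 2 * c - b

/-- A lower bound for `10 ^ 15` times the value of a vector. -/
def lower (v : Vec) : ℤ :=
  v.1 * 344446091267009 + v.2.1 * 203947945777214 + v.2.2 * 107159871688767
    + min v.1 0 + min v.2.1 0 + min v.2.2 0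

/-- A sufficient test: `true` certifies positivity, `false` says nothing. -/
def isPos (v : Vec) : Bool := decide (0 < lower v)

def isNonneg (v : Vec) : Bool := decide (v = 0) || isPos v

/-- Multiplication by `κ`. -/
def scale (v : Vec) : Vec :=
  (v.1 - 2 * v.2.1, -v.1 + 4 * v.2.1 - v.2.2, -v.1 - v.2.1 + 2 * v.2.2)

section ev

variable {a b c κ : ℝ}

theorem ev_add (u v : Vec) : ev a b c (u + v) = ev a b c u + ev a b c v := by
  simp only [ev, Prod.fst_add, Prod.snd_add]; push_cast; ring

theorem ev_sub (u v : Vec) : ev a b c (u - v) = ev a b c u - ev a b c v := by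
  simp only [ev, Prod.fst_sub, Prod.snd_sub]; push_cast; ring

theorem ev_smul (k : ℤ) (v : Vec) : ev a b c (k • v) = k * ev a b c v := by
  simp only [ev, Prod.smul_fst, Prod.smul_snd, smul_eq_mul]; push_cast; ring

theorem ev_zero : ev a b c 0 = 0 := by simp [ev]

theorem ev_scale (h : Lengths a b c κ) (v : Vec) : ev a b c (scale v) = κ * ev a b c v := by
  simp only [ev, scale]; push_cast
  linear_combination (-(v.1 : ℝ)) * h.scale_a - (v.2.1 : ℝ) * h.scale_b - (v.2.2 : ℝ) * h.scale_c

/-- Each length lies in an interval of width `1` after multiplication by `10 ^ 15`, so rounding down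
costs something only for a negative coefficient, and then at most its absolute value. This explains
the `min` terms. -/
theorem lower_le (h : Lengths a b c κ) (v : Vec) : (lower v : ℝ) ≤ ev a b c v * 10 ^ 15 := by
  have key : ∀ (k : ℤ) (x X : ℝ), X ≤ x → x ≤ X + 1 → (k : ℝ) * X + min (k : ℝ) 0 ≤ k * x := by
    intro k x X h1 h2
    rcases le_total (k : ℝ) 0 with hk | hk
    · rw [min_eq_left hk]; nlinarith
    · rw [min_eq_right hk]; nlinarith
  have h1 := key v.1 _ _ h.a_ge h.a_le
  have h2 := key v.2.1 _ _ h.b_ge h.b_le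
  have h3 := key v.2.2 _ _ h.c_ge h.c_le
  simp only [lower, ev]
  push_cast
  linarith

theorem ev_pos (h : Lengths a b c κ) {v : Vec} (hv : isPos v = true) : 0 < ev a b c v := by
  have h1 := lower_le h v
  have h2 : (0 : ℝ) < lower v := by exact_mod_cast of_decide_eq_true hv
  by_contra h3
  push Not at h3
  nlinarith

theorem ev_nonneg (h : Lengths a b c κ) {v : Vec} (hv : isNonneg v = true) : 0 ≤ ev a b c v := by
  simp only [isNonneg, Bool.or_eq_true, decide_eq_true_eq] at hv
  rcases hv with rfl | hv
  · exact ev_zero.ge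
  · exact (ev_pos h hv).le

end ev

/-- The combinatorial data of an exchange of four intervals with flips. -/
structure IET where
  bet : Fin 5 → Vec
  sg : Fin 4 → ℤ
  tr : Fin 4 → Vec

namespace IET

variable (I : IET)

/-- The `j`-th open interval. -/
def openCell (a b c : ℝ) (j : Fin 4) : Set ℝ :=
  Ioo (ev a b c (I.bet j.castSucc)) (ev a b c (I.bet j.succ))

/-- The real map `F` is given by the data on the open intervals. -/
def Realizes (a b c : ℝ) (F : ℝ → ℝ) : Prop :=
  ∀ j, ∀ x ∈ I.openCell a b c j, F x = I.sg j * x + ev a b c (I.tr j)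

def inCell (v : Vec) (j : Fin 4) : Bool :=
  isPos (v - I.bet j.castSucc) && isPos (I.bet j.succ - v)

def inClosedCell (v : Vec) (j : Fin 4) : Bool :=
  isNonneg (v - I.bet j.castSucc) && isNonneg (I.bet j.succ - v)

/-- One step of the orbit of a point of an open interval, with the number of the interval. -/
def step (v : Vec) : Option (Fin 4 × Vec) :=
  if I.inCell v 0 then some (0, I.sg 0 • v + I.tr 0)
  else if I.inCell v 1 then some (1, I.sg 1 • v + I.tr 1)
  else if I.inCell v 2 then some (2, I.sg 2 • v + I.tr 2)
  else if I.inCell v 3 then some (3, I.sg 3 • v + I.tr 3)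
  else none

/-- The point lies in no open interval. -/
def isSingular (v : Vec) : Bool :=
  decide (∀ j : Fin 4, (isNonneg (I.bet j.castSucc - v) || isNonneg (v - I.bet j.succ)) = true)

/-- Several steps of the orbit of a point. -/
def orbit : ℕ → Vec → Option (List (Fin 4) × Vec)
  | 0, v => some ([], v)
  | n + 1, v => match I.step v with
    | none => none
    | some (j, v') => match orbit n v' with
      | none => none
      | some (w, u) => some (j :: w, u)

/-- The orbit of the point enters the interval from `0` to `top`, or it is singular. -/
def enters (top : Vec) : ℕ → Vec → Bool
  | 0, _ => false
  | n + 1, v => (isPos v && isPos (top - v)) || I.isSingular v ||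
    match I.step v with
    | none => false
    | some (_, v') => enters top n v'

/-- The orbit of the point is singular. -/
def hits : ℕ → Vec → Bool
  | 0, _ => false
  | n + 1, v => I.isSingular v ||
    match I.step v with
    | none => false
    | some (_, v') => hits n v'

/-- The orbit, along the word, of the interval from `p` to `q`, embedded by `x ↦ s x + u`. -/
def follow (p q : Vec) : List (Fin 4) → ℤ → Vec → Option (ℤ × Vec)
  | [], s, u => some (s, u)
  | j :: w, s, u =>
    if I.inClosedCell (s • p + u) j && I.inClosedCell (s • q + u) j then
      follow p q w (I.sg j * s) (I.sg j • u + I.tr j)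
    else none

variable {I} {a b c κ : ℝ} {F : ℝ → ℝ}

theorem mem_openCell (h : Lengths a b c κ) {v : Vec} {j : Fin 4} (hv : I.inCell v j = true) :
    ev a b c v ∈ I.openCell a b c j := by
  simp only [inCell, Bool.and_eq_true] at hv
  have h1 := ev_pos h hv.1
  have h2 := ev_pos h hv.2
  rw [ev_sub] at h1 h2
  exact ⟨by linarith, by linarith⟩

theorem step_spec (h : Lengths a b c κ) (hF : I.Realizes a b c F) {v v' : Vec} {j : Fin 4}
    (hs : I.step v = some (j, v')) :
    ev a b c v ∈ I.openCell a b c j ∧ F (ev a b c v) = ev a b c v' := by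
  have key : ∀ i, I.inCell v i = true → some (i, I.sg i • v + I.tr i) = some (j, v') →
      ev a b c v ∈ I.openCell a b c j ∧ F (ev a b c v) = ev a b c v' := by
    intro i hi e
    simp only [Option.some.injEq, Prod.mk.injEq] at e
    obtain ⟨rfl, rfl⟩ := e
    have := mem_openCell h hi
    exact ⟨this, by rw [hF _ _ this, ev_add, ev_smul]⟩
  unfold step at hs
  split_ifs at hs with h0 h1 h2 h3
  · exact key _ h0 hs
  · exact key _ h1 hs
  · exact key _ h2 hs
  · exact key _ h3 hs

theorem orbit_spec (h : Lengths a b c κ) (hF : I.Realizes a b c F) {n : ℕ} :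
    ∀ {v v' : Vec} {w : List (Fin 4)}, I.orbit n v = some (w, v') →
      w.length = n ∧ (∀ i (hi : i < w.length), F^[i] (ev a b c v) ∈ I.openCell a b c w[i]) ∧
        F^[n] (ev a b c v) = ev a b c v' := by
  induction n with
  | zero =>
    intro v v' w hw
    simp only [orbit, Option.some.injEq, Prod.mk.injEq] at hw
    obtain ⟨rfl, rfl⟩ := hw
    exact ⟨rfl, fun i hi => absurd hi (Nat.not_lt_zero _), rfl⟩
  | succ n ih =>
    intro v v' w hw
    simp only [orbit] at hw
    split at hw
    · simp at hw
    · rename_i j u hs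
      split at hw
      · simp at hw
      · rename_i w' u' ho
        simp only [Option.some.injEq, Prod.mk.injEq] at hw
        obtain ⟨rfl, rfl⟩ := hw
        obtain ⟨h1, h2, h3⟩ := ih ho
        obtain ⟨h4, h5⟩ := step_spec h hF hs
        refine ⟨by simp [h1], fun i hi => ?_, by rw [Function.iterate_succ_apply, h5, h3]⟩
        cases i with
        | zero => exact h4
        | succ i =>
          rw [Function.iterate_succ_apply, h5]
          exact h2 i (by simpa using hi)

theorem orbit_regUpTo (h : Lengths a b c κ) (hF : I.Realizes a b c F) {n : ℕ} {v v' : Vec}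
    {w : List (Fin 4)} (ho : I.orbit n v = some (w, v')) :
    RegUpTo F (I.openCell a b c) n (ev a b c v) ∧ F^[n] (ev a b c v) = ev a b c v' := by
  obtain ⟨h1, h2, h3⟩ := orbit_spec h hF ho
  exact ⟨fun m hm => ⟨_, h2 m (h1 ▸ hm)⟩, h3⟩

theorem not_mem_of_isSingular (h : Lengths a b c κ) {v : Vec} (hv : I.isSingular v = true)
    (j : Fin 4) : ev a b c v ∉ I.openCell a b c j := by
  simp only [isSingular, decide_eq_true_eq, Bool.or_eq_true] at hv
  rintro ⟨h1, h2⟩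
  rcases hv j with h3 | h3 <;> have := ev_nonneg h h3 <;> rw [ev_sub] at this <;> linarith

theorem enters_spec (h : Lengths a b c κ) (hF : I.Realizes a b c F) {top : Vec} {n : ℕ} :
    ∀ {v : Vec}, I.enters top n v = true → Reg F (I.openCell a b c) (ev a b c v) →
      ∃ k, F^[k] (ev a b c v) ∈ Ioo 0 (ev a b c top) := by
  induction n with
  | zero => intro v hv; simp [enters] at hv
  | succ n ih =>
    intro v hv hr
    simp only [enters, Bool.or_eq_true, Bool.and_eq_true] at hv
    rcases hv with (⟨h1, h2⟩ | h1) | h1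
    · have h3 := ev_pos h h1
      have h4 := ev_pos h h2
      rw [ev_sub] at h4
      exact ⟨0, h3, by simpa using h4⟩
    · obtain ⟨i, hi⟩ := hr 0
      exact absurd hi (not_mem_of_isSingular h h1 i)
    · split at h1
      · simp at h1
      · rename_i j u hs
        have e := (step_spec h hF hs).2
        obtain ⟨k, hk⟩ := ih h1 (e ▸ hr.iterate 1)
        exact ⟨k + 1, by rw [Function.iterate_succ_apply, e]; exact hk⟩

theorem hits_spec (h : Lengths a b c κ) (hF : I.Realizes a b c F) {n : ℕ} :
    ∀ {v : Vec}, I.hits n v = true → ¬ Reg F (I.openCell a b c) (ev a b c v) := by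
  induction n with
  | zero => intro v hv; simp [hits] at hv
  | succ n ih =>
    intro v hv hr
    simp only [hits, Bool.or_eq_true] at hv
    rcases hv with h1 | h1
    · obtain ⟨i, hi⟩ := hr 0
      exact not_mem_of_isSingular h h1 i hi
    · split at h1
      · simp at h1
      · rename_i j u hs
        exact ih h1 ((step_spec h hF hs).2 ▸ hr.iterate 1)

/-- The end points may lie on the boundary of the cell; the open interval between two points of a
closed cell still lies in the open cell. -/
theorem mem_of_inClosedCell (h : Lengths a b c κ) {p q u : Vec} {s : ℤ} {j : Fin 4}
    (hs : s = 1 ∨ s = -1) (hp : I.inClosedCell (s • p + u) j = true)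
    (hq : I.inClosedCell (s • q + u) j = true) {x : ℝ} (hx : x ∈ Ioo (ev a b c p) (ev a b c q)) :
    s * x + ev a b c u ∈ I.openCell a b c j := by
  simp only [inClosedCell, Bool.and_eq_true] at hp hq
  have h1 := ev_nonneg h hp.1
  have h2 := ev_nonneg h hp.2
  have h3 := ev_nonneg h hq.1
  have h4 := ev_nonneg h hq.2
  simp only [ev_sub, ev_add, ev_smul] at h1 h2 h3 h4
  obtain ⟨h5, h6⟩ := hx
  rcases hs with rfl | rfl <;> push_cast at * <;> exact ⟨by linarith, by linarith⟩

/-- The intermediate signs and translations are recorded as well, because the floors of the tower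
and the isometry property are read off from them. -/
theorem follow_spec (h : Lengths a b c κ) (hF : I.Realizes a b c F)
    (hI : ∀ j, I.sg j = 1 ∨ I.sg j = -1) {p q : Vec} :
    ∀ {w : List (Fin 4)} {s s' : ℤ} {u u' : Vec}, (s = 1 ∨ s = -1) →
      I.follow p q w s u = some (s', u') →
      (∀ i (hi : i < w.length), ∃ (r : ℤ) (t : Vec), (r = 1 ∨ r = -1) ∧
        I.follow p q (w.take i) s u = some (r, t) ∧ ∀ x ∈ Ioo (ev a b c p) (ev a b c q),
          F^[i] (s * x + ev a b c u) = r * x + ev a b c t ∧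
          F^[i] (s * x + ev a b c u) ∈ I.openCell a b c w[i]) ∧
      ∀ x ∈ Ioo (ev a b c p) (ev a b c q),
        F^[w.length] (s * x + ev a b c u) = s' * x + ev a b c u' := by
  intro w
  induction w with
  | nil =>
    intro s s' u u' _ hw
    simp only [follow, Option.some.injEq, Prod.mk.injEq] at hw
    obtain ⟨rfl, rfl⟩ := hw
    exact ⟨fun i hi => absurd hi (Nat.not_lt_zero _), fun x _ => rfl⟩
  | cons j w ih =>
    intro s s' u u' hs hw
    simp only [follow] at hw
    split_ifs at hw with hc
    have hs' : I.sg j * s = 1 ∨ I.sg j * s = -1 := by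
      rcases hI j with e | e <;> rcases hs with rfl | rfl <;> simp [e]
    obtain ⟨h1, h2⟩ := ih hs' hw
    have hc' := hc
    rw [Bool.and_eq_true] at hc'
    have hmem : ∀ x ∈ Ioo (ev a b c p) (ev a b c q), s * x + ev a b c u ∈ I.openCell a b c j :=
      fun x hx => mem_of_inClosedCell h hs hc'.1 hc'.2 hx
    have hstep : ∀ x ∈ Ioo (ev a b c p) (ev a b c q),
        F (s * x + ev a b c u) =
          ((I.sg j * s : ℤ) : ℝ) * x + ev a b c (I.sg j • u + I.tr j) := by
      intro x hx
      rw [hF _ _ (hmem x hx), ev_add, ev_smul]; push_cast; ring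
    constructor
    · intro i hi
      cases i with
      | zero => exact ⟨s, u, hs, rfl, fun x hx => ⟨rfl, hmem x hx⟩⟩
      | succ i =>
        obtain ⟨r, t, hr, hf, hx⟩ := h1 i (by simpa using hi)
        refine ⟨r, t, hr, ?_, fun x hxm => ?_⟩
        · simp only [List.take_succ_cons, follow, hc, if_true, hf]
        · rw [Function.iterate_succ_apply, hstep x hxm]
          exact hx x hxm
    · intro x hx
      rw [List.length_cons, Function.iterate_succ_apply, hstep x hx, h2 x hx]

/-! ### Checking a renormalization -/

/-- The end points of the image of an interval after `f.2` steps along the word of `f.1`. -/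
def floorOf (I J : IET) (m : Vec → Vec) (σ : Fin 4 → List (Fin 4)) (f : Fin 4 × ℕ) :
    Option (Vec × Vec) :=
  if f.2 < (σ f.1).length then
    match I.follow (m (J.bet f.1.castSucc)) (m (J.bet f.1.succ)) ((σ f.1).take f.2) 1 0 with
    | none => none
    | some (s, u) =>
      if s = 1 then some (m (J.bet f.1.castSucc) + u, m (J.bet f.1.succ) + u)
      else some (u - m (J.bet f.1.succ), u - m (J.bet f.1.castSucc))
  else none

/-- The intervals are adjacent and fill the interval from `lo` to `top`. -/
def chainOK (fl : Fin 4 × ℕ → Option (Vec × Vec)) (top : Vec) :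
    Vec → List (Fin 4 × ℕ) → Bool
  | lo, [] => decide (lo = top)
  | lo, f :: r => match fl f with
    | none => false
    | some (l, h) => decide (l = lo) && chainOK fl top h r

/-- The conditions for a renormalization that can be checked by computation. -/
structure RenormCheck (I J : IET) (m : Vec → Vec) (σ : Fin 4 → List (Fin 4))
    (fs : List (Fin 4 × ℕ)) (fuel : ℕ) : Prop where
  sgI : ∀ j, I.sg j = 1 ∨ I.sg j = -1
  sgJ : ∀ j, J.sg j = 1 ∨ J.sg j = -1
  zeroI : I.bet 0 = 0
  zeroJ : J.bet 0 = 0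
  subI : ∀ j : Fin 4,
    (isNonneg (I.bet j.castSucc - I.bet 0) && isNonneg (I.bet 4 - I.bet j.succ)) = true
  innerJ : ∀ j : Fin 4, (isNonneg (J.sg j • J.bet j.castSucc + J.tr j) &&
    isNonneg (J.bet 4 - (J.sg j • J.bet j.castSucc + J.tr j)) &&
    isNonneg (J.sg j • J.bet j.succ + J.tr j) &&
    isNonneg (J.bet 4 - (J.sg j • J.bet j.succ + J.tr j))) = true
  words : ∀ j : Fin 4, I.follow (m (J.bet j.castSucc)) (m (J.bet j.succ)) (σ j) 1 0 =
    some (J.sg j, m (J.tr j))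
  chain : chainOK (floorOf I J m σ) (I.bet 4) (I.bet 0) fs = true
  ends : ∀ f ∈ fs, ∀ lh ∈ floorOf I J m σ f,
    (decide (lh.2 = I.bet 4) || I.enters (m (J.bet 4)) fuel lh.2) = true
  back : ∀ i : Fin 3, I.hits fuel (m (J.bet i.succ.castSucc)) = true

theorem chainOK_spec {fl : Fin 4 × ℕ → Option (Vec × Vec)} {top : Vec} :
    ∀ {fs : List (Fin 4 × ℕ)} {lo : Vec}, chainOK fl top lo fs = true →
      ∀ x, ev a b c lo < x → x < ev a b c top → ∃ f ∈ fs, ∃ lh, fl f = some lh ∧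
        (x = ev a b c lh.2 ∨ x ∈ Ioo (ev a b c lh.1) (ev a b c lh.2)) := by
  intro fs
  induction fs with
  | nil =>
    intro lo hc x h1 h2
    simp only [chainOK, decide_eq_true_eq] at hc
    rw [hc] at h1
    exact absurd h1 h2.not_gt
  | cons f r ih =>
    intro lo hc x h1 h2
    simp only [chainOK] at hc
    split at hc
    · simp at hc
    · rename_i l h hf
      simp only [Bool.and_eq_true, decide_eq_true_eq] at hc
      obtain ⟨rfl, hc⟩ := hc
      rcases lt_trichotomy x (ev a b c h) with hx | hx | hx
      · exact ⟨f, by simp, _, hf, Or.inr ⟨h1, hx⟩⟩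
      · exact ⟨f, by simp, _, hf, Or.inl hx⟩
      · obtain ⟨f', hf', hr⟩ := ih hc x hx h2
        exact ⟨f', by simp [hf'], hr⟩

/-- The floors are adjacent and fill the domain, so a point is either interior to a floor or an end
point of one. An interior point returns to the base when its column ends. A regular end point is
traced individually by `enters`. All end points lie in the countable set `range (ev a b c)`. The cut
points of the small interval are singular by `hits`, which gives `back`. -/
theorem renorm_of_check {I J : IET} {m : Vec → Vec} {σ : Fin 4 → List (Fin 4)}
    {fs : List (Fin 4 × ℕ)} {fuel : ℕ} (hc : RenormCheck I J m σ fs fuel) {μ : ℝ} (hμ : 0 < μ)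
    (h : Lengths a b c κ) (hm : ∀ v, ev a b c (m v) = μ * ev a b c v) {F G : ℝ → ℝ}
    (hF : I.Realizes a b c F) (hG : J.Realizes a b c G) :
    Renorm F G (I.openCell a b c) (J.openCell a b c) (Ioo 0 (ev a b c (I.bet 4)))
      (Ioo 0 (ev a b c (J.bet 4))) μ σ (range (ev a b c)) := by
  have hsc : ∀ j, ∀ y ∈ J.openCell a b c j,
      μ * y ∈ Ioo (ev a b c (m (J.bet j.castSucc))) (ev a b c (m (J.bet j.succ))) := by
    rintro j y ⟨h1, h2⟩
    rw [hm, hm]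
    exact ⟨mul_lt_mul_of_pos_left h1 hμ, mul_lt_mul_of_pos_left h2 hμ⟩
  have hone : (1 : ℤ) = 1 ∨ (1 : ℤ) = -1 := Or.inl rfl
  have hfol := fun j => follow_spec h hF hc.sgI hone (hc.words j)
  have hret : ∀ j, ∀ y ∈ J.openCell a b c j, F^[(σ j).length] (μ * y) = μ * G y := by
    intro j y hy
    have := (hfol j).2 _ (hsc j y hy)
    simp only [Int.cast_one, one_mul, ev_zero, add_zero] at this
    rw [this, hG j y hy, hm]; ring
  have hinner : ∀ j, ∀ y ∈ J.openCell a b c j, G y ∈ Ioo 0 (ev a b c (J.bet 4)) := by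
    intro j y hy
    have hcj := hc.innerJ j
    simp only [Bool.and_eq_true] at hcj
    obtain ⟨⟨⟨h1, h2⟩, h3⟩, h4⟩ := hcj
    replace h1 := ev_nonneg h h1
    replace h2 := ev_nonneg h h2
    replace h3 := ev_nonneg h h3
    replace h4 := ev_nonneg h h4
    simp only [ev_sub, ev_add, ev_smul] at h1 h2 h3 h4
    obtain ⟨h5, h6⟩ := hy
    rw [hG j y ⟨h5, h6⟩]
    rcases hc.sgJ j with e | e <;> rw [e] at h1 h2 h3 h4 ⊢ <;>
      push_cast at h1 h2 h3 h4 ⊢ <;> exact ⟨by linarith, by linarith⟩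
  have hfloor : ∀ f lh, floorOf I J m σ f = some lh → ∀ x ∈ Ioo (ev a b c lh.1) (ev a b c lh.2),
      ∃ y ∈ J.openCell a b c f.1, f.2 < (σ f.1).length ∧ F^[f.2] (μ * y) = x := by
    rintro ⟨j, i⟩ ⟨lo, hi⟩ hf x hx
    simp only [floorOf] at hf
    split_ifs at hf with hlt
    obtain ⟨r, t, hr, he, hspec⟩ := (hfol j).1 i hlt
    simp only [he] at hf
    have hback : ∀ z ∈ Ioo (ev a b c (m (J.bet j.castSucc))) (ev a b c (m (J.bet j.succ))),
        z / μ ∈ J.openCell a b c j := by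
      rintro z ⟨h1, h2⟩
      rw [hm] at h1 h2
      exact ⟨by rwa [lt_div_iff₀ hμ, mul_comm], by rwa [div_lt_iff₀ hμ, mul_comm]⟩
    have hmul : ∀ z : ℝ, μ * (z / μ) = z := fun z => mul_div_cancel₀ _ hμ.ne'
    rcases hr with rfl | rfl
    · simp only [if_true, Option.some.injEq, Prod.mk.injEq] at hf
      obtain ⟨rfl, rfl⟩ := hf
      simp only [ev_add, mem_Ioo] at hx
      have hz : x - ev a b c t ∈ Ioo (ev a b c (m (J.bet j.castSucc)))
          (ev a b c (m (J.bet j.succ))) := ⟨by linarith, by linarith⟩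
      refine ⟨_, hback _ hz, hlt, ?_⟩
      have := (hspec _ hz).1
      simp only [Int.cast_one, one_mul, ev_zero, add_zero] at this
      rw [hmul, this]; ring
    · simp only [show ((-1 : ℤ) = 1) = False by decide, if_false, Option.some.injEq,
        Prod.mk.injEq] at hf
      obtain ⟨rfl, rfl⟩ := hf
      simp only [ev_sub, mem_Ioo] at hx
      have hz : ev a b c t - x ∈ Ioo (ev a b c (m (J.bet j.castSucc)))
          (ev a b c (m (J.bet j.succ))) := ⟨by linarith, by linarith⟩
      refine ⟨_, hback _ hz, hlt, ?_⟩
      have := (hspec _ hz).1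
      simp only [Int.cast_one, one_mul, ev_zero, add_zero, Int.cast_neg] at this
      rw [hmul, this]; ring
  constructor
  · intro j y hy i hi
    obtain ⟨r, t, -, -, hspec⟩ := (hfol j).1 i hi
    have := (hspec _ (hsc j y hy)).2
    simpa only [Int.cast_one, one_mul, ev_zero, add_zero] using this
  · intro j y hy y' hy' i hi
    obtain ⟨r, t, hr, -, hspec⟩ := (hfol j).1 i hi
    have h1 := (hspec _ (hsc j y hy)).1
    have h2 := (hspec _ (hsc j y' hy')).1
    simp only [Int.cast_one, one_mul, ev_zero, add_zero] at h1 h2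
    rw [h1, h2]
    have hr' : |(r : ℝ)| = 1 := by rcases hr with rfl | rfl <;> simp
    rw [show r * (μ * y) + ev a b c t - (r * (μ * y') + ev a b c t) = r * (μ * (y - y')) by ring,
      abs_mul, abs_mul, hr', abs_of_pos hμ, one_mul]
  · exact hret
  · intro x hx hxE
    obtain ⟨f, -, lh, hf, hcase⟩ := chainOK_spec (a := a) (b := b) (c := c) hc.chain x
      (by rw [hc.zeroI, ev_zero]; exact hx.1) hx.2
    rcases hcase with e | hmem
    · exact absurd ⟨_, e.symm⟩ hxE
    · obtain ⟨y, hy, hlt, e⟩ := hfloor f lh hf x hmem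
      exact ⟨f.1, y, hy, f.2, hlt, e⟩
  · intro x hx
    obtain ⟨j, hj⟩ := hx 0
    have hsub := hc.subI j
    rw [Bool.and_eq_true] at hsub
    have h1 := ev_nonneg h hsub.1
    have h2 := ev_nonneg h hsub.2
    rw [ev_sub] at h1 h2
    have hx0 : x ∈ Ioo (ev a b c (I.bet 0)) (ev a b c (I.bet 4)) :=
      ⟨by have := hj.1; simp only [Function.iterate_zero, id] at this; linarith,
       by have := hj.2; simp only [Function.iterate_zero, id] at this; linarith⟩
    obtain ⟨f, hfm, lh, hf, hcase⟩ := chainOK_spec hc.chain x hx0.1 hx0.2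
    rcases hcase with e | hmem
    · have := hc.ends f hfm lh hf
      simp only [Bool.or_eq_true, decide_eq_true_eq] at this
      rcases this with h3 | h3
      · rw [h3] at e; exact absurd hx0.2 (by rw [e]; exact lt_irrefl _)
      · subst e
        obtain ⟨k, hk1, hk2⟩ := enters_spec h hF h3 hx
        rw [hm] at hk2
        exact ⟨k, F^[k] (ev a b c lh.2) / μ, ⟨div_pos hk1 hμ, by
          rwa [div_lt_iff₀ hμ, mul_comm]⟩, (mul_div_cancel₀ _ hμ.ne').symm⟩
    · obtain ⟨y, hy, hlt, e⟩ := hfloor f lh hf x hmem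
      refine ⟨(σ f.1).length - f.2, G y, hinner _ y hy, ?_⟩
      rw [← e, ← Function.iterate_add_apply, Nat.sub_add_cancel hlt.le, hret _ y hy]
  · intro y hy hr
    by_contra hne
    push Not at hne
    have key : ∀ i : Fin 3, y ≠ ev a b c (J.bet i.succ.castSucc) := by
      rintro i rfl
      rw [← hm] at hr
      exact hits_spec h hF (hc.back i) hr
    have e0 : ev a b c (J.bet 0) < y := by rw [hc.zeroJ, ev_zero]; exact hy.1
    have step : ∀ j : Fin 4, ev a b c (J.bet j.castSucc) < y → ev a b c (J.bet j.succ) ≤ y :=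
      fun j hj => not_lt.1 fun h' => hne j ⟨hj, h'⟩
    have e1 := (step 0 e0).lt_of_ne (key 0).symm
    have e2 := (step 1 e1).lt_of_ne (key 1).symm
    have e3 := (step 2 e2).lt_of_ne (key 2).symm
    exact absurd hy.2 (not_lt.2 (step 3 e3))
  · exact hinner

end IET

/-! ### The exchange of four intervals with flips and its self-similar induced map -/

/-- The lengths of the intervals of `T`. -/
def lamOf (a b c : ℝ) : Fin 4 → ℝ := ![a, b + c, c + a, b]

/-- The data of `T`. -/
def tIET : IET where
  bet := ![(0, 0, 0), (1, 0, 0), (1, 1, 1), (2, 1, 2), (2, 2, 2)]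
  sg := ![-1, -1, -1, -1]
  tr := ![(2, 0, 1), (3, 2, 2), (2, 1, 2), (4, 2, 3)]

/-- The data of the map induced by `T` on an interval. -/
def sIET : IET where
  bet := ![(0, 0, 0), (1, 0, 0), (1, 1, 0), (1, 1, 1), (2, 1, 1)]
  sg := ![-1, 1, 1, -1]
  tr := ![(2, 0, 1), (1, 0, 1), (-1, -1, 0), (2, 1, 2)]

/-- The map induced by `T` on an interval. -/
noncomputable def sMap (a b c x : ℝ) : ℝ :=
  if x < a then -x + (2 * a + c)
  else if x < a + b then x + (a + c)
  else if x < a + b + c then x - (a + b)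
  else -x + (2 * a + b + 2 * c)

/-- The itineraries under `T` of the intervals of the induced map. -/
def tWord : Fin 4 → List (Fin 4) := ![[0], [1, 3], [1, 2], [2]]

/-- The self-similarity substitution of the induced map. -/
def sWord : Fin 4 → List (Fin 4) :=
  ![[0, 3, 0, 1, 3, 0, 2],
    [0, 3, 1, 3, 0, 1, 3, 0, 2],
    [0, 3, 1, 3, 0, 1, 3, 0, 2, 0, 3, 1, 3, 0, 2],
    [0, 3, 1, 3, 0, 1, 3, 0, 3, 1, 3, 0, 2]]

/-- The order on the line of the intervals visited before the return to the small interval. -/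
def sFloors : List (Fin 4 × ℕ) :=
  [(0, 0), (1, 0), (2, 0), (3, 0), (2, 9), (3, 7), (2, 7), (1, 7), (0, 5), (3, 11), (2, 13),
    (3, 4), (2, 4), (1, 4), (0, 2), (1, 2), (2, 2), (3, 2), (2, 11), (3, 9), (0, 3), (1, 5),
    (2, 5), (3, 5), (2, 14), (3, 12), (0, 6), (1, 8), (2, 8), (3, 8), (2, 10), (3, 1), (2, 1),
    (1, 1), (0, 1), (1, 3), (2, 3), (3, 3), (2, 12), (3, 10), (0, 4), (1, 6), (2, 6), (3, 6)]

/-- The base has length `2a + b + c`; the return times `1, 2, 2, 1` make six floors, which fill the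
length `2a + 2b + 2c`. -/
theorem check_t : IET.RenormCheck tIET sIET id tWord
    [(0, 0), (1, 0), (2, 0), (3, 0), (2, 1), (1, 1)] 3 where
  sgI := by decide +kernel
  sgJ := by decide +kernel
  zeroI := by decide +kernel
  zeroJ := by decide +kernel
  subI := by decide +kernel
  innerJ := by decide +kernel
  words := by decide +kernel
  chain := by decide +kernel
  ends := by decide +kernel
  back := by decide +kernel

/-- The columns have `7, 9, 15, 13` floors, `44` in all. The numbers of letters in the four words
are the columns of `P`, so the lengths fit together because `P ν = η ν`. -/
theorem check_s : IET.RenormCheck sIET sIET scale sWord sFloors 16 where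
  sgI := by decide +kernel
  sgJ := by decide +kernel
  zeroI := by decide +kernel
  zeroJ := by decide +kernel
  subI := by decide +kernel
  innerJ := by decide +kernel
  words := by decide +kernel
  chain := by decide +kernel
  ends := by decide +kernel
  back := by decide +kernel

/-- The number of the interval that contains a point. -/
noncomputable def IET.letter (I : IET) (a b c x : ℝ) : Fin 4 :=
  if x < ev a b c (I.bet 1) then 0 else if x < ev a b c (I.bet 2) then 1
  else if x < ev a b c (I.bet 3) then 2 else 3

variable {a b c κ : ℝ}

theorem IET.letter_eq {I : IET} (h1 : ev a b c (I.bet 1) ≤ ev a b c (I.bet 2))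
    (h2 : ev a b c (I.bet 2) ≤ ev a b c (I.bet 3)) :
    ∀ j, ∀ x ∈ I.openCell a b c j, I.letter a b c x = j := by
  rintro j x ⟨h3, h4⟩
  unfold IET.letter
  fin_cases j <;> simp at h3 h4
  · rw [if_pos h4]; rfl
  · rw [if_neg h3.not_gt, if_pos h4]; rfl
  · rw [if_neg (h1.trans_lt h3).not_gt, if_neg h3.not_gt, if_pos h4]; rfl
  · rw [if_neg ((h1.trans h2).trans_lt h3).not_gt, if_neg (h2.trans_lt h3).not_gt,
      if_neg h3.not_gt]; rfl

/-! ### Regular orbits, minimality and unique ergodicity of the exchange of intervals. -/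

namespace Lengths

theorem total_eq : SwitchedServer.total (lamOf a b c) = 2 * a + 2 * b + 2 * c := by
  simp [SwitchedServer.total, Fin.sum_univ_four, lamOf]; ring

theorem iet_eq (x : ℝ) : SwitchedServer.iet (lamOf a b c) x =
    if x < a then -x + a + (c + a)
    else if x < a + (b + c) then -x + a + (2 * a + 2 * b + 2 * c)
    else if x < a + (b + c) + (c + a) then -x + a + (b + c) + (c + a)
    else -x + a + (c + a) + (2 * a + 2 * b + 2 * c) := by
  rw [← total_eq]; rfl

variable (h : Lengths a b c κ)
include h

theorem bounds : (0.3444 ≤ a ∧ a ≤ 0.3445) ∧ (0.2039 ≤ b ∧ b ≤ 0.204) ∧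
    (0.1071 ≤ c ∧ c ≤ 0.1072) := by
  obtain ⟨h1, h2, h3, h4, h5, h6, -, -, -⟩ := h
  refine ⟨⟨?_, ?_⟩, ⟨?_, ?_⟩, ?_, ?_⟩ <;> linarith

theorem lengths_pos : 0 < a ∧ 0 < b ∧ 0 < c := by
  obtain ⟨⟨h1, h2⟩, ⟨h3, h4⟩, h5, h6⟩ := h.bounds
  refine ⟨?_, ?_, ?_⟩ <;> linarith

theorem scale_pos : 0 < κ := by
  obtain ⟨⟨h1, h2⟩, ⟨h3, h4⟩, h5, h6⟩ := h.bounds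
  have := h.scale_a
  by_contra hk
  nlinarith

theorem scale_le : κ ≤ 1 / 2 := by
  obtain ⟨⟨h1, h2⟩, ⟨h3, h4⟩, h5, h6⟩ := h.bounds
  have := h.scale_a
  nlinarith

theorem realizes_t : tIET.Realizes a b c (SwitchedServer.iet (lamOf a b c)) := by
  obtain ⟨⟨h1, h2⟩, ⟨h3, h4⟩, h5, h6⟩ := h.bounds
  rintro j x ⟨h7, h8⟩
  rw [iet_eq]
  fin_cases j <;> simp [tIET, ev] at h7 h8 ⊢
  · rw [if_pos h8]; ring
  · rw [if_neg (by linarith), if_pos (by linarith)]; ring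
  · rw [if_neg (by linarith), if_neg (by linarith), if_pos (by linarith)]; ring
  · rw [if_neg (by linarith), if_neg (by linarith), if_neg (by linarith)]; ring

theorem realizes_s : sIET.Realizes a b c (sMap a b c) := by
  obtain ⟨⟨h1, h2⟩, ⟨h3, h4⟩, h5, h6⟩ := h.bounds
  rintro j x ⟨h7, h8⟩
  unfold sMap
  fin_cases j <;> simp [sIET, ev] at h7 h8 ⊢
  · intro h9; linarith
  · rw [if_neg (by linarith), if_pos (by linarith)]
  · rw [if_neg (by linarith), if_neg (by linarith), if_pos (by linarith)]; ring
  · rw [if_neg (by linarith), if_neg (by linarith), if_neg (by linarith)]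

theorem letter_t : ∀ j, ∀ x ∈ tIET.openCell a b c j, tIET.letter a b c x = j := by
  obtain ⟨⟨h1, h2⟩, ⟨h3, h4⟩, h5, h6⟩ := h.bounds
  apply IET.letter_eq <;> simp [tIET, ev] <;> linarith

theorem letter_s : ∀ j, ∀ x ∈ sIET.openCell a b c j, sIET.letter a b c x = j := by
  obtain ⟨⟨h1, h2⟩, ⟨h3, h4⟩, h5, h6⟩ := h.bounds
  apply IET.letter_eq <;> simp [sIET, ev] <;> linarith

theorem renorm_t : Renorm (SwitchedServer.iet (lamOf a b c)) (sMap a b c)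
    (tIET.openCell a b c) (sIET.openCell a b c) (Ioo 0 (ev a b c (tIET.bet 4)))
    (Ioo 0 (ev a b c (sIET.bet 4))) 1 tWord (range (ev a b c)) :=
  IET.renorm_of_check check_t one_pos h (fun v => by simp) h.realizes_t h.realizes_s

theorem renorm_s : Renorm (sMap a b c) (sMap a b c)
    (sIET.openCell a b c) (sIET.openCell a b c) (Ioo 0 (ev a b c (sIET.bet 4)))
    (Ioo 0 (ev a b c (sIET.bet 4))) κ sWord (range (ev a b c)) :=
  IET.renorm_of_check check_s h.scale_pos h (ev_scale h) h.realizes_s h.realizes_s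

/-- A point whose orbit reaches its own scaled copy is regular. -/
theorem reg_of_orbit_scale {v : Vec} {n : ℕ} (hn : 0 < n) {w : List (Fin 4)}
    (ho : sIET.orbit n v = some (w, scale v)) :
    Reg (sMap a b c) (sIET.openCell a b c) (ev a b c v) := by
  obtain ⟨h1, h2⟩ := IET.orbit_regUpTo h h.realizes_s ho
  -- Bootstrapping: `k` regular steps of the point give at least `k` regular steps of its scaled
  -- copy, and the `n > 0` steps that lead to this copy come in addition.
  have key : ∀ k, RegUpTo (sMap a b c) (sIET.openCell a b c) k (ev a b c v) := by
    intro k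
    induction k with
    | zero => exact fun m hm => absurd hm (Nat.not_lt_zero _)
    | succ k ih =>
      have h3 := (h.renorm_s.orbit_lift h.letter_s ih).2
      rw [← ev_scale h, ← h2] at h3
      have h4 : k * 1 ≤ Renorm.time (sMap a b c) sWord (sIET.letter a b c) k (ev a b c v) :=
        Renorm.mul_le_time (by decide) _ _
      exact fun m hm => h1.append h3 m (by omega)
  exact fun k => key (k + 1) k (Nat.lt_succ_self k)

theorem reg_t_of_reg_s {x : ℝ} (hx : Reg (sMap a b c) (sIET.openCell a b c) x) :
    Reg (SwitchedServer.iet (lamOf a b c)) (tIET.openCell a b c) x := by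
  simpa using h.renorm_t.reg_lift h.letter_s (by decide) hx

/-- This point is `T(0) = T(|λ|) = T²(λ₁)`. Together with `p₂` and `p₃` it lies on the forward orbit
of every end point of a cell. -/
theorem reg_q : Reg (SwitchedServer.iet (lamOf a b c)) (tIET.openCell a b c)
    (ev a b c (2, 0, 1)) :=
  h.reg_t_of_reg_s (h.reg_of_orbit_scale (n := 6) (w := [3, 0, 1, 3, 0, 2]) (by norm_num)
    (by decide +kernel))

theorem reg_p₂ : Reg (SwitchedServer.iet (lamOf a b c)) (tIET.openCell a b c)
    (ev a b c (1, 0, 1)) :=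
  h.reg_t_of_reg_s (h.reg_of_orbit_scale (n := 4) (w := [1, 3, 0, 2]) (by norm_num)
    (by decide +kernel))

/-- `p₃` is the right end of the base of `sMap`, hence outside its open cells. One step of `T` moves
it to `c`, where the self-similarity argument applies. -/
theorem reg_p₃ : Reg (SwitchedServer.iet (lamOf a b c)) (tIET.openCell a b c)
    (ev a b c (2, 1, 1)) := by
  obtain ⟨h1, h2⟩ := IET.orbit_regUpTo h h.realizes_t (n := 1) (v := (2, 1, 1)) (v' := (0, 0, 1))
    (w := [2]) (by decide +kernel)
  refine h1.reg ?_
  rw [h2]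
  exact h.reg_t_of_reg_s (h.reg_of_orbit_scale (n := 6) (w := [0, 3, 1, 3, 0, 2]) (by norm_num)
    (by decide +kernel))

omit h in
theorem ev_top : ev a b c (tIET.bet 4) = SwitchedServer.total (lamOf a b c) := by
  rw [total_eq]; simp [ev, tIET]

theorem mapsTo_t : MapsTo (SwitchedServer.iet (lamOf a b c))
    (Icc 0 (SwitchedServer.total (lamOf a b c))) (Icc 0 (SwitchedServer.total (lamOf a b c))) := by
  obtain ⟨⟨h1, h2⟩, ⟨h3, h4⟩, h5, h6⟩ := h.bounds
  rintro x ⟨h7, h8⟩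
  rw [total_eq] at h8 ⊢
  rw [iet_eq]
  split_ifs <;> constructor <;> linarith

theorem iterate_mem {x : ℝ} (hx : x ∈ Icc 0 (SwitchedServer.total (lamOf a b c))) (n : ℕ) :
    (SwitchedServer.iet (lamOf a b c))^[n] x ∈ Icc 0 (SwitchedServer.total (lamOf a b c)) :=
  h.mapsTo_t.iterate n hx

/-- Every orbit is eventually regular. -/
theorem eventually_reg {x : ℝ} (hx : x ∈ Icc 0 (SwitchedServer.total (lamOf a b c))) :
    ∃ k, Reg (SwitchedServer.iet (lamOf a b c)) (tIET.openCell a b c)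
      ((SwitchedServer.iet (lamOf a b c))^[k] x) := by
  by_cases hr : Reg (SwitchedServer.iet (lamOf a b c)) (tIET.openCell a b c) x
  · exact ⟨0, hr⟩
  obtain ⟨⟨h1, h2⟩, ⟨h3, h4⟩, h5, h6⟩ := h.bounds
  simp only [Reg, not_forall, not_exists] at hr
  obtain ⟨n, hn⟩ := hr
  have hm := h.iterate_mem hx n
  set y := (SwitchedServer.iet (lamOf a b c))^[n] x with hy
  have hq := h.reg_q
  have hp2 := h.reg_p₂
  have hp3 := h.reg_p₃
  simp only [ev, Int.cast_zero, Int.cast_one, Int.cast_ofNat, one_mul, zero_mul, add_zero]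
    at hq hp2 hp3
  have c0 := hn 0
  have c1 := hn 1
  have c2 := hn 2
  have c3 := hn 3
  simp only [IET.openCell, tIET, ev, mem_Ioo, not_and, not_lt] at c0 c1 c2 c3
  simp at c0 c1 c2 c3
  rw [total_eq] at hm
  obtain ⟨hm0, hm1⟩ := hm
  have htop : SwitchedServer.iet (lamOf a b c) (2 * a + 2 * b + 2 * c) = 2 * a + c := by
    rw [iet_eq]; split_ifs <;> linarith
  have e0 : y = 0 ∨ y = a ∨ y = a + b + c ∨ y = 2 * a + b + 2 * c ∨ y = 2 * a + 2 * b + 2 * c := by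
    rcases hm0.eq_or_lt with h0 | h0
    · exact Or.inl h0.symm
    rcases (c0 h0).eq_or_lt with h0 | h0
    · exact Or.inr (Or.inl h0.symm)
    rcases (c1 h0).eq_or_lt with h0 | h0
    · exact Or.inr (Or.inr (Or.inl h0.symm))
    rcases (c2 h0).eq_or_lt with h0 | h0
    · exact Or.inr (Or.inr (Or.inr (Or.inl h0.symm)))
    · exact Or.inr (Or.inr (Or.inr (Or.inr (le_antisymm hm1 (c3 h0)))))
  rcases e0 with e | e | e | e | e
  · refine ⟨n + 1, ?_⟩
    rw [Function.iterate_succ_apply', ← hy, e, iet_eq, if_pos (by linarith)]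
    convert hq using 1; ring
  -- The end point `λ₁` needs two steps, since `T(λ₁) = |λ|` is itself an end point.
  · refine ⟨n + 2, ?_⟩
    rw [Function.iterate_succ_apply', Function.iterate_succ_apply', ← hy, e, iet_eq a,
      if_neg (lt_irrefl _), if_pos (by linarith)]
    rw [show -a + a + (2 * a + 2 * b + 2 * c) = 2 * a + 2 * b + 2 * c by ring, htop]
    exact hq
  · refine ⟨n + 1, ?_⟩
    rw [Function.iterate_succ_apply', ← hy, e, iet_eq, if_neg (by linarith), if_neg (by linarith),
      if_pos (by linarith)]
    convert hp2 using 1; ring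
  · refine ⟨n + 1, ?_⟩
    rw [Function.iterate_succ_apply', ← hy, e, iet_eq, if_neg (by linarith), if_neg (by linarith),
      if_neg (by linarith)]
    convert hp3 using 1; ring
  · refine ⟨n + 1, ?_⟩
    rw [Function.iterate_succ_apply', ← hy, e, htop]
    exact hq

/-- Every cell of the induced map is visited by every regular orbit. -/
theorem exists_visit {x : ℝ} (hx : Reg (sMap a b c) (sIET.openCell a b c) x) (j : Fin 4) :
    ∃ k, (sMap a b c)^[k] x ∈ sIET.openCell a b c j := by
  obtain ⟨k, y, hy, e⟩ := h.renorm_s.enter_reg hx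
  obtain ⟨i, hi⟩ := hy 0
  -- Every letter occurs in every word of the substitution, so one passage through any column visits
  -- all cells.
  have hall : ∀ i j : Fin 4, ∃ m, ∃ hm : m < (sWord i).length, (sWord i)[m] = j := by
    intro i j
    have : j ∈ sWord i := by revert i j; decide
    exact List.mem_iff_getElem.1 this
  obtain ⟨m, hm, hj⟩ := hall i j
  refine ⟨m + k, ?_⟩
  rw [Function.iterate_add_apply, e, ← hj]
  exact h.renorm_s.path i y hi m hm

/-- The induction starts with the fact that each cell is visited and shorter than `1 = κ ^ 0`. Each
use of `dense_step` with `renorm_s` gains a factor `κ` and enlarges the exceptional set by countably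
many points. -/
theorem approx_s (n : ℕ) : ∃ E : Set ℝ, E.Countable ∧
    ∀ x, Reg (sMap a b c) (sIET.openCell a b c) x → ∀ j, ∀ z ∈ sIET.openCell a b c j, z ∉ E →
      ∃ k, (sMap a b c)^[k] x ∈ sIET.openCell a b c j ∧ |(sMap a b c)^[k] x - z| ≤ κ ^ n := by
  obtain ⟨⟨h1, h2⟩, ⟨h3, h4⟩, h5, h6⟩ := h.bounds
  have hsub : ∀ j, sIET.openCell a b c j ⊆ Ioo 0 (ev a b c (sIET.bet 4)) := by
    rintro j x ⟨h7, h8⟩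
    fin_cases j <;> simp [sIET, ev] at h7 h8 ⊢ <;> constructor <;> linarith
  induction n with
  | zero =>
    refine ⟨∅, countable_empty, fun x hx j z hz _ => ?_⟩
    obtain ⟨k, hk⟩ := h.exists_visit hx j
    refine ⟨k, hk, ?_⟩
    have h7 := hsub j hz
    have h8 := hsub j hk
    have : ev a b c (sIET.bet 4) ≤ 1.1 := by simp [sIET, ev]; linarith
    obtain ⟨h9, h10⟩ := hz
    obtain ⟨h11, h12⟩ := hk
    rw [pow_zero, abs_le]
    fin_cases j <;> simp [sIET, ev] at h9 h10 h11 h12 <;> constructor <;> linarith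
  | succ n ih =>
    obtain ⟨E, hE, hG⟩ := ih
    refine ⟨range (ev a b c) ∪ ⋃ i : ℕ, (fun y => (sMap a b c)^[i] (κ * y)) '' E,
      (countable_range _).union (countable_iUnion fun i => hE.image _), fun x hx j z hz hzE => ?_⟩
    obtain ⟨k, j', hk, hz', hd⟩ :=
      h.renorm_s.dense_step h.letter_s h.scale_pos hG hx (hsub j hz) hzE
    have : j' = j := by rw [← h.letter_s j z hz, ← h.letter_s j' z hz']
    subst this
    exact ⟨k, hk, by rw [pow_succ']; exact hd⟩

/-- Every orbit visits every open interval infinitely often. -/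
theorem exists_iterate_mem {x : ℝ} (hx : x ∈ Icc 0 (SwitchedServer.total (lamOf a b c)))
    {u v : ℝ} (hu : 0 ≤ u) (huv : u < v) (hv : v ≤ SwitchedServer.total (lamOf a b c)) (N : ℕ) :
    ∃ k ≥ N, (SwitchedServer.iet (lamOf a b c))^[k] x ∈ Ioo u v := by
  obtain ⟨K, hK⟩ := h.eventually_reg hx
  obtain ⟨n, hn⟩ := exists_pow_lt_of_lt_one (show 0 < (v - u) / 3 by linarith)
    (lt_of_le_of_lt h.scale_le (by norm_num))
  obtain ⟨E, hE, hG⟩ := h.approx_s n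
  have hc : ((range (ev a b c) ∪ ⋃ i : ℕ,
      (fun y => (SwitchedServer.iet (lamOf a b c))^[i] (1 * y)) '' E)).Countable :=
    (countable_range _).union (countable_iUnion fun i => hE.image _)
  -- The target is taken in the middle third of the interval and off the exceptional set; an error
  -- below a third of the length keeps the orbit inside.
  obtain ⟨z, ⟨hz1, hz2⟩, hzE⟩ := (hc.dense_compl ℝ).inter_open_nonempty
    (Ioo (u + (v - u) / 3) (v - (v - u) / 3)) isOpen_Ioo
    (nonempty_Ioo.2 (by linarith))
  obtain ⟨k, j, -, -, hd⟩ := h.renorm_t.dense_step h.letter_s one_pos hG (hK.iterate N)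
    (z := z) ⟨by linarith, by rw [ev_top]; linarith⟩ hzE
  refine ⟨k + (N + K), by omega, ?_⟩
  rw [Function.iterate_add_apply, Function.iterate_add_apply]
  rw [one_mul] at hd
  obtain ⟨h1, h2⟩ := abs_le.1 hd
  constructor <;> linarith

/-- A periodic orbit is finite and so misses some open interval, whereas every orbit visits all of
them. -/
theorem iterate_ne {x : ℝ} (hx : x ∈ Icc 0 (SwitchedServer.total (lamOf a b c))) {m : ℕ}
    (hm : 0 < m) : (SwitchedServer.iet (lamOf a b c))^[m] x ≠ x := by
  intro e
  have hfin : (range fun k => (SwitchedServer.iet (lamOf a b c))^[k] x).Finite := by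
    refine ((Finset.range m).finite_toSet.image
      fun k => (SwitchedServer.iet (lamOf a b c))^[k] x).subset ?_
    rintro _ ⟨k, rfl⟩
    refine ⟨k % m, by simpa using Nat.mod_lt k hm, ?_⟩
    exact Function.IsPeriodicPt.iterate_mod_apply e k
  have hL : (0 : ℝ) < SwitchedServer.total (lamOf a b c) := by
    obtain ⟨⟨h1, h2⟩, ⟨h3, h4⟩, h5, h6⟩ := h.bounds
    rw [total_eq]; linarith
  obtain ⟨z, hz, hzf⟩ := (hfin.countable.dense_compl ℝ).inter_open_nonempty
    (Ioo 0 (SwitchedServer.total (lamOf a b c))) isOpen_Ioo (nonempty_Ioo.2 hL)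
  obtain ⟨ε, hε, hb⟩ := Metric.isOpen_iff.1 (hfin.isClosed.isOpen_compl.inter isOpen_Ioo) z
    ⟨hzf, hz⟩
  rw [Real.ball_eq_Ioo] at hb
  obtain ⟨k, -, hk⟩ := h.exists_iterate_mem hx (u := max 0 (z - ε)) (v := z) (le_max_left _ _)
    (max_lt hz.1 (by linarith)) hz.2.le 0
  exact (hb ⟨(le_max_right _ _).trans_lt hk.1, by linarith [hk.2]⟩).1 ⟨k, rfl⟩

/-- Two features of the substitution are used: its words have at least `7` letters, and their letter
counts are so close to multiples of `ν = (a, b, c, a)` that centred functions have sums at most `2`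
over each word. Iterating gives the rate `(2/7)^n`. -/
theorem balanced_s (n : ℕ) : Balanced (sMap a b c) (sIET.openCell a b c) (sIET.letter a b c)
    ![a, b, c, a] ((2 / 7) ^ n) := by
  obtain ⟨⟨h1, h2⟩, ⟨h3, h4⟩, h5, h6⟩ := h.bounds
  induction n with
  | zero =>
    intro ψ _ hψ x _
    exact ⟨0, fun n => by simpa using abs_birkhoffSum_le (l := sIET.letter a b c) hψ n x⟩
  | succ n ih =>
    have := h.renorm_s.balanced h.letter_s h.letter_s (m := 7) (w := ![a, b, c, a])
      (by norm_num) (by decide) ?_ (by positivity) ih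
    · rw [pow_succ]
      convert this using 1
      push_cast; ring
    · intro ψ hψ hψ1
      simp only [Fin.sum_univ_four] at hψ
      simp at hψ
      have key : ∀ (t r : ℝ) (i : Fin 4), -r ≤ t → t ≤ r → |t * ψ i| ≤ r := by
        intro t r i h7 h8
        rw [abs_mul]
        have h9 := hψ1 i
        have h10 : |t| ≤ r := abs_le.2 ⟨h7, h8⟩
        nlinarith [abs_nonneg t, abs_nonneg (ψ i)]
      constructor
      -- The mean of the substituted function is `η` times the mean of `ψ`, because the letter
      -- counts form `P` and `P ν = η ν`; multiplication by `κ` expresses this through the scaling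
      -- relations.
      · have hκ := h.scale_pos.ne'
        apply mul_left_cancel₀ hκ
        rw [mul_zero, ← hψ]
        simp only [Fin.sum_univ_four, sWord]
        simp
        linear_combination
          ((3 * ψ 0 + ψ 1 + ψ 2 + 2 * ψ 3) + (4 * ψ 0 + 3 * ψ 1 + ψ 2 + 5 * ψ 3)) * h.scale_a +
          (3 * ψ 0 + 2 * ψ 1 + ψ 2 + 3 * ψ 3) * h.scale_b +
          (5 * ψ 0 + 3 * ψ 1 + 2 * ψ 2 + 5 * ψ 3) * h.scale_c
      · intro j
        -- As `ψ` is orthogonal to `ν`, any multiple `θ ν` may be subtracted from the vector of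
        -- letter counts. Below, `θ` is the length of the word, and the `r`s bound the
        -- discrepancies; their sum has to stay below `2`.
        have bound : ∀ (n₀ n₁ n₂ n₃ θ r₀ r₁ r₂ r₃ : ℝ), -r₀ ≤ n₀ - θ * a → n₀ - θ * a ≤ r₀ →
            -r₁ ≤ n₁ - θ * b → n₁ - θ * b ≤ r₁ → -r₂ ≤ n₂ - θ * c → n₂ - θ * c ≤ r₂ →
            -r₃ ≤ n₃ - θ * a → n₃ - θ * a ≤ r₃ → r₀ + r₁ + r₂ + r₃ ≤ 2 →
            |n₀ * ψ 0 + n₁ * ψ 1 + n₂ * ψ 2 + n₃ * ψ 3| ≤ 2 := by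
          intro n₀ n₁ n₂ n₃ θ r₀ r₁ r₂ r₃ p1 p2 p3 p4 p5 p6 p7 p8 p9
          have q0 := abs_le.1 (key _ _ 0 p1 p2)
          have q1 := abs_le.1 (key _ _ 1 p3 p4)
          have q2 := abs_le.1 (key _ _ 2 p5 p6)
          have q3 := abs_le.1 (key _ _ 3 p7 p8)
          have e : n₀ * ψ 0 + n₁ * ψ 1 + n₂ * ψ 2 + n₃ * ψ 3 = (n₀ - θ * a) * ψ 0 +
              (n₁ - θ * b) * ψ 1 + (n₂ - θ * c) * ψ 2 + (n₃ - θ * a) * ψ 3 := by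
            linear_combination θ * hψ
          rw [e, abs_le]
          constructor <;> linarith
        fin_cases j
        · convert bound 3 1 1 2 7 0.6 0.45 0.3 0.45 (by linarith) (by linarith) (by linarith)
            (by linarith) (by linarith) (by linarith) (by linarith) (by linarith) (by norm_num)
            using 2
          simp [sWord]; ring
        · convert bound 3 2 1 3 9 0.3 0.3 0.3 0.3 (by linarith) (by linarith) (by linarith)
            (by linarith) (by linarith) (by linarith) (by linarith) (by linarith) (by norm_num)
            using 2
          simp [sWord]; ring
        · convert bound 5 3 2 5 15 0.3 0.3 0.5 0.3 (by linarith) (by linarith) (by linarith)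
            (by linarith) (by linarith) (by linarith) (by linarith) (by linarith) (by norm_num)
            using 2
          simp [sWord]; ring
        · convert bound 4 3 1 5 13 0.5 0.4 0.4 0.6 (by linarith) (by linarith) (by linarith)
            (by linarith) (by linarith) (by linarith) (by linarith) (by linarith) (by norm_num)
            using 2
          simp [sWord]; ring

/-- The words leading from `T` to `sMap` have one or two letters, so their sums are at most `2`, and
`m = 1` costs only a fixed factor `2`. -/
theorem balanced_t (n : ℕ) : Balanced (SwitchedServer.iet (lamOf a b c)) (tIET.openCell a b c)
    (tIET.letter a b c) (lamOf a b c) (2 * (2 / 7) ^ n) := by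
  have := h.renorm_t.balanced h.letter_t h.letter_s (m := 1) (w := lamOf a b c)
      (by norm_num) (by decide) ?_ (by positivity) (h.balanced_s n)
  · simpa using this
  · intro ψ hψ hψ1
    have b0 := abs_le.1 (hψ1 0)
    have b1 := abs_le.1 (hψ1 1)
    have b2 := abs_le.1 (hψ1 2)
    have b3 := abs_le.1 (hψ1 3)
    constructor
    · rw [← hψ]
      simp only [Fin.sum_univ_four, tWord, lamOf]
      simp
      ring
    · intro j
      rw [abs_le]
      fin_cases j <;> simp [tWord] <;> constructor <;> linarith

/-- Unique ergodicity, for functions of the interval that contains the point. -/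
theorem tendsto_birkhoffSum {ψ : Fin 4 → ℝ} (hψ : ∑ i, ψ i * lamOf a b c i = 0)
    (hψ1 : ∀ i, |ψ i| ≤ 1) {x : ℝ} (hx : x ∈ Icc 0 (SwitchedServer.total (lamOf a b c))) :
    Tendsto (fun n : ℕ => birkhoffSum (SwitchedServer.iet (lamOf a b c))
      (fun x => ψ (tIET.letter a b c x)) n x / n) atTop (𝓝 0) := by
  obtain ⟨k, hk⟩ := h.eventually_reg hx
  rw [Metric.tendsto_atTop]
  intro ε hε
  obtain ⟨n, hn⟩ := exists_pow_lt_of_lt_one (show 0 < ε / 4 by linarith)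
    (show (2 / 7 : ℝ) < 1 by norm_num)
  obtain ⟨C, hC⟩ := h.balanced_t n ψ hψ hψ1 _ hk
  obtain ⟨N, hN⟩ := exists_nat_gt ((2 * k + |C|) / (ε / 2))
  refine ⟨N + k + 1, fun m hm => ?_⟩
  have hm0 : (0 : ℝ) < m := by exact_mod_cast (by omega : 0 < m)
  have hmN : (N : ℝ) ≤ m := by exact_mod_cast (by omega : N ≤ m)
  obtain ⟨r, rfl⟩ : ∃ r, m = k + r := ⟨m - k, by omega⟩
  rw [dist_zero_right, Real.norm_eq_abs, abs_div, abs_of_pos hm0, div_lt_iff₀ hm0,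
    birkhoffSum_add]
  have b1 := abs_birkhoffSum_le (F := SwitchedServer.iet (lamOf a b c))
    (l := tIET.letter a b c) hψ1 k x
  have b2 := hC r
  have b3 : 2 * k + |C| < (ε / 2) * N := by
    rw [div_lt_iff₀ (by linarith)] at hN; linarith
  have b4 := le_abs_self C
  have hr : (r : ℝ) ≤ ((k + r : ℕ) : ℝ) := by exact_mod_cast (by omega : r ≤ k + r)
  have hk0 : (0 : ℝ) ≤ k := by positivity
  have b5 : 2 * (2 / 7) ^ n * (r : ℝ) ≤ ε / 2 * ((k + r : ℕ) : ℝ) := by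
    apply mul_le_mul (by linarith) hr (by positivity) (by linarith)
  have b6 : (ε / 2) * N ≤ (ε / 2) * ((k + r : ℕ) : ℝ) :=
    mul_le_mul_of_nonneg_left hmN (by linarith)
  refine (abs_add_le _ _).trans_lt ?_
  linarith

end Lengths

/-- The Perron-Frobenius eigenvector provides the lengths. -/
theorem exists_lengths {η : ℝ} {ν lam : Fin 4 → ℝ} (hν : SwitchedServer.IsPerronPair η ν)
    (hlam : lam = SwitchedServer.Q *ᵥ ν) :
    ∃ a b c κ, Lengths a b c κ ∧ lam = lamOf a b c ∧ 2 * a + b + c = 1 := by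
  obtain ⟨he, hp, hs⟩ := hν
  have e0 := congrFun he 0
  have e1 := congrFun he 1
  have e2 := congrFun he 2
  have e3 := congrFun he 3
  simp [SwitchedServer.P, Matrix.mulVec, dotProduct, Fin.sum_univ_four] at e0 e1 e2 e3
  have p0 := hp 0
  have p1 := hp 1
  have p2 := hp 2
  have p3 := hp 3
  rw [Fin.sum_univ_four] at hs
  have hη1 : 1 < η := by
    by_contra hη
    nlinarith
  -- The first and the last row of `P` differ by `(1, 0, 0, -1)`.
  have h03 : ν 3 = ν 0 := by
    have : (η - 1) * (ν 3 - ν 0) = 0 := by linear_combination e0 - e3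
    rcases mul_eq_zero.1 this with h | h <;> linarith
  set a := ν 0 with ha
  set b := ν 1 with hb
  set c := ν 2 with hc
  rw [h03] at e0 e1 e2 hs
  have f0 : η * a = 7 * a + 3 * b + 5 * c := by linear_combination -e0
  have f1 : η * b = 4 * a + 2 * b + 3 * c := by linear_combination -e1
  have f2 : η * c = 2 * a + b + 2 * c := by linear_combination -e2
  have f3 : c * (η - 1) = 1 := by linear_combination f2 + hs
  -- The cubic for `η` has smaller positive roots; this crude bound selects the largest one.
  have hη9 : 9 < η := by
    have : η = 20 * a + 9 * b + 15 * c := by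
      have h1 : η * (2 * a + b + c) = 20 * a + 9 * b + 15 * c := by
        linear_combination 2 * f0 + f1 + f2
      nlinarith
    linarith
  have hcub : η ^ 3 - 11 * η ^ 2 + 7 * η - 1 = 0 := by
    have g : b * (η * (η - 1)) = 2 * η - 1 := by
      linear_combination (η - 1) * f1 + f3 + 2 * (η - 1) * hs
    have g' : 2 * a = 1 - b - c := by linear_combination hs
    linear_combination 2 * η * (η - 1) * f0 - η * (η - 1) * (η - 7) * g' + (η - 1) * g +
      3 * η * f3 + η ^ 2 * f3
  have hlo : (10331851412666623662316211 : ℝ) / 10 ^ 24 ≤ η := by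
    by_contra h
    push Not at h
    nlinarith
  have hhi : η ≤ (10331851412666623662316212 : ℝ) / 10 ^ 24 := by
    by_contra h
    push Not at h
    nlinarith
  have clo : (1071598716887675937076 : ℝ) / 10 ^ 22 ≤ c := by
    by_contra h
    push Not at h
    nlinarith
  -- The bounds on `c` come from `c (η - 1) = 1`, those on `b` from `b η = 2 + c`, and `a` follows
  -- from `2a + b + c = 1`.
  have chi : c ≤ (1071598716887675937079 : ℝ) / 10 ^ 22 := by
    by_contra h
    push Not at h
    nlinarith
  have f4 : b * η = 2 + c := by linear_combination f1 + 2 * hs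
  have blo : (2039479457772143062224 : ℝ) / 10 ^ 22 ≤ b := by
    by_contra h
    push Not at h
    nlinarith
  have bhi : b ≤ (2039479457772143062227 : ℝ) / 10 ^ 22 := by
    by_contra h
    push Not at h
    nlinarith
  have hη0 : η ≠ 0 := by linarith
  refine ⟨a, b, c, η⁻¹, ⟨by linarith, by linarith, by linarith, by linarith, by linarith,
    by linarith, ?_, ?_, ?_⟩, ?_, by linarith⟩
  -- The matrix with rows `(7, 3, 5)`, `(4, 2, 3)`, `(2, 1, 2)`, by which `η` acts on `(a, b, c)`,
  -- has determinant `1`. Hence `κ = η⁻¹` acts with integer coefficients.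
  · rw [inv_mul_eq_iff_eq_mul₀ hη0]; linear_combination -f0 + f1 + f2
  · rw [inv_mul_eq_iff_eq_mul₀ hη0]; linear_combination 2 * f0 - 4 * f1 + f2
  · rw [inv_mul_eq_iff_eq_mul₀ hη0]; linear_combination f1 - 2 * f2
  · rw [hlam]
    funext i
    fin_cases i <;> simp [SwitchedServer.Q, Matrix.mulVec, dotProduct, Fin.sum_univ_four, lamOf,
      h03, ha, hb, hc]

/-! ### Weighted visits of an orbit -/

open scoped Classical in
/-- The sum of `2 ^ (-k)` over the `k` such that `F^k p` lies in `A`. -/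
noncomputable def weight (F : ℝ → ℝ) (p : ℝ) (A : Set ℝ) : ℝ :=
  ∑' k : ℕ, if F^[k] p ∈ A then (1 : ℝ) / 2 ^ k else 0

section weight

variable {F : ℝ → ℝ} {p : ℝ}

theorem summable_two_pow : Summable fun k : ℕ => (1 : ℝ) / 2 ^ k := by
  simpa using summable_geometric_two

theorem tsum_two_pow : ∑' k : ℕ, (1 : ℝ) / 2 ^ k = 2 := by
  simpa using tsum_geometric_two

open scoped Classical in
theorem summable_weight (F : ℝ → ℝ) (p : ℝ) (A : Set ℝ) :
    Summable fun k : ℕ => if F^[k] p ∈ A then (1 : ℝ) / 2 ^ k else 0 := by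
  refine summable_two_pow.of_nonneg_of_le (fun k => ?_) fun k => ?_ <;> split_ifs <;>
    first | positivity | rfl

theorem weight_nonneg (F : ℝ → ℝ) (p : ℝ) (A : Set ℝ) : 0 ≤ weight F p A :=
  tsum_nonneg fun k => by split_ifs <;> positivity

theorem weight_univ (F : ℝ → ℝ) (p : ℝ) : weight F p univ = 2 := by
  simp only [weight, mem_univ, if_true]; exact tsum_two_pow

theorem weight_empty (F : ℝ → ℝ) (p : ℝ) : weight F p ∅ = 0 := by
  simp [weight]

theorem weight_mono {A B : Set ℝ} (h : ∀ k, F^[k] p ∈ A → F^[k] p ∈ B) :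
    weight F p A ≤ weight F p B := by
  refine (summable_weight F p A).tsum_le_tsum (fun k => ?_) (summable_weight F p B)
  have := h k
  split_ifs with h1 h2 h2
  · exact le_rfl
  · exact absurd (this h1) h2
  · positivity
  · exact le_rfl

theorem weight_lt {A B : Set ℝ} (h : ∀ k, F^[k] p ∈ A → F^[k] p ∈ B) {k : ℕ}
    (hA : F^[k] p ∉ A) (hB : F^[k] p ∈ B) : weight F p A < weight F p B := by
  refine (summable_weight F p A).tsum_lt_tsum (i := k) (fun k => ?_) ?_ (summable_weight F p B)
  · have := h k
    split_ifs with h1 h2 h2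
    · exact le_rfl
    · exact absurd (this h1) h2
    · positivity
    · exact le_rfl
  · rw [if_neg hA, if_pos hB]; positivity

open scoped Classical in
theorem weight_step (F : ℝ → ℝ) (p : ℝ) (A : Set ℝ) :
    weight F p A = (if p ∈ A then 1 else 0) + weight F p (F ⁻¹' A) / 2 := by
  rw [weight, (summable_weight F p A).tsum_eq_zero_add, weight, ← tsum_div_const]
  congr 1
  · simp
  · refine tsum_congr fun k => ?_
    simp only [Function.iterate_succ_apply', mem_preimage]
    split_ifs
    · rw [pow_succ, div_div]
    · simp

open scoped Classical in
/-- Linear inequalities between indicators of sets give inequalities between the weights. -/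
theorem weight_le_six {A B C A' B' C' : Set ℝ}
    (h : ∀ k, (if F^[k] p ∈ A then (1 : ℝ) else 0) + (if F^[k] p ∈ B then (1 : ℝ) else 0) +
        (if F^[k] p ∈ C then (1 : ℝ) else 0) ≤
      (if F^[k] p ∈ A' then (1 : ℝ) else 0) + (if F^[k] p ∈ B' then (1 : ℝ) else 0) +
        (if F^[k] p ∈ C' then (1 : ℝ) else 0)) :
    weight F p A + weight F p B + weight F p C ≤
      weight F p A' + weight F p B' + weight F p C' := by
  have s := summable_weight F p
  simp only [weight]
  rw [← (s A).tsum_add (s B), ← ((s A).add (s B)).tsum_add (s C),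
    ← (s A').tsum_add (s B'), ← ((s A').add (s B')).tsum_add (s C')]
  refine (((s A).add (s B)).add (s C)).tsum_le_tsum (fun k => ?_) (((s A').add (s B')).add (s C'))
  have e : ∀ D : Set ℝ, (if F^[k] p ∈ D then (1 : ℝ) / 2 ^ k else 0) =
      (if F^[k] p ∈ D then (1 : ℝ) else 0) / 2 ^ k := fun D => by split_ifs <;> simp
  simp only [e, ← add_div]
  exact div_le_div_of_nonneg_right (h k) (by positivity)

open scoped Classical in
-- Dominated convergence; it yields the one-sided limits of the distribution function of the mass.
theorem tendsto_weight {l : Filter ℝ} [l.IsCountablyGenerated] {A : ℝ → Set ℝ} {B : Set ℝ}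
    (h : ∀ x, ∀ᶠ y in l, (x ∈ A y ↔ x ∈ B)) :
    Tendsto (fun y => weight F p (A y)) l (𝓝 (weight F p B)) := by
  refine tendsto_tsum_of_dominated_convergence summable_two_pow (fun k => ?_)
    (Eventually.of_forall fun y k => ?_)
  · refine tendsto_const_nhds.congr' ?_
    filter_upwards [h (F^[k] p)] with y hy
    simp only [hy]
  · split_ifs
    · rw [Real.norm_of_nonneg (by positivity)]
    · rw [norm_zero]; positivity

theorem eventually_lt_iff_left (x y : ℝ) : ∀ᶠ z in 𝓝[<] y, (x ∈ Iio z ↔ x ∈ Iio y) := by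
  rcases lt_or_ge x y with h | h
  · filter_upwards [Ioo_mem_nhdsLT h] with z hz
    exact ⟨fun _ => h, fun _ => hz.1⟩
  · filter_upwards [self_mem_nhdsWithin] with z hz
    have hz' : z < y := hz
    exact ⟨fun hx => (lt_trans hx hz'), fun hx => absurd h (not_le.2 hx)⟩

theorem eventually_lt_iff_right (x y : ℝ) : ∀ᶠ z in 𝓝[>] y, (x ∈ Iio z ↔ x ∈ Iic y) := by
  rcases le_or_gt x y with h | h
  · filter_upwards [self_mem_nhdsWithin] with z hz
    exact ⟨fun _ => h, fun _ => lt_of_le_of_lt h hz⟩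
  · filter_upwards [Ioo_mem_nhdsGT h] with z hz
    exact ⟨fun hx => absurd hz.2 (not_lt.2 (le_of_lt hx)), fun hx => absurd h (not_lt.2 hx)⟩

end weight

/-! ### The atomic mass and the semiconjugacy as its quantile function. -/

/-- The mass of `A` when the orbits of the points `p_j` carry geometric weights, with total
weights `w 3`, `w 1`, `w 2`, `w 0`. -/
noncomputable def mass (lam w : Fin 4 → ℝ) (A : Set ℝ) : ℝ :=
  w 3 / 2 * weight (SwitchedServer.iet lam) (SwitchedServer.pt lam 0) A +
  w 1 / 2 * weight (SwitchedServer.iet lam) (SwitchedServer.pt lam 1) A +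
  w 2 / 2 * weight (SwitchedServer.iet lam) (SwitchedServer.pt lam 2) A +
  w 0 / 2 * weight (SwitchedServer.iet lam) (SwitchedServer.pt lam 3) A

/-- The piecewise contraction with pieces of lengths `w i`. -/
noncomputable def contr (w : Fin 4 → ℝ) (t : ℝ) : ℝ :=
  if t < w 0 then 1 / 2 - t / 2
  else if t < w 0 + w 1 then 1 - t / 2
  else if t < w 0 + w 1 + w 2 then 1 / 2 - t / 2
  else 1 - t / 2

/-- Lengths, and a probability vector for which every interval carries the mass `w i`. -/
structure Weighted (a b c κ : ℝ) (w : Fin 4 → ℝ) : Prop extends Lengths a b c κ where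
  pos : ∀ i, 0 < w i
  sum : w 0 + w 1 + w 2 + w 3 = 1
  mass_cell : ∀ i, mass (lamOf a b c) w (SwitchedServer.cell (lamOf a b c) i) = w i

namespace Weighted

variable {a b c κ : ℝ} {w : Fin 4 → ℝ}

theorem pt_eq (h : Lengths a b c κ) : SwitchedServer.pt (lamOf a b c) =
    ![0, c + a, 2 * a + b + c, 2 * a + 2 * b + 2 * c] := by
  obtain ⟨⟨h1, h2⟩, ⟨h3, h4⟩, h5, h6⟩ := h.bounds
  simp only [SwitchedServer.pt, Lengths.iet_eq, Lengths.total_eq]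
  funext i
  fin_cases i <;> simp [lamOf]
  · rw [if_neg (by linarith), if_pos (by linarith)]
  · rw [if_neg (by linarith), if_neg (by linarith)]; ring

theorem pt_mem (h : Lengths a b c κ) (i : Fin 4) :
    SwitchedServer.pt (lamOf a b c) i ∈ Icc 0 (SwitchedServer.total (lamOf a b c)) := by
  obtain ⟨⟨h1, h2⟩, ⟨h3, h4⟩, h5, h6⟩ := h.bounds
  rw [pt_eq h, Lengths.total_eq]
  fin_cases i <;> simp <;> (try constructor) <;> linarith

open scoped Classical in
theorem mass_le_six (h : Weighted a b c κ w) {A B C A' B' C' : Set ℝ}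
    (hle : ∀ x ∈ Icc 0 (SwitchedServer.total (lamOf a b c)),
      (if x ∈ A then (1 : ℝ) else 0) + (if x ∈ B then (1 : ℝ) else 0) +
        (if x ∈ C then (1 : ℝ) else 0) ≤
      (if x ∈ A' then (1 : ℝ) else 0) + (if x ∈ B' then (1 : ℝ) else 0) +
        (if x ∈ C' then (1 : ℝ) else 0)) :
    mass (lamOf a b c) w A + mass (lamOf a b c) w B + mass (lamOf a b c) w C ≤
      mass (lamOf a b c) w A' + mass (lamOf a b c) w B' + mass (lamOf a b c) w C' := by
  have key := fun i => weight_le_six (A := A) (B := B) (C := C) (A' := A') (B' := B') (C' := C')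
    (F := SwitchedServer.iet (lamOf a b c)) (p := SwitchedServer.pt (lamOf a b c) i)
    fun k => hle _ (h.iterate_mem (pt_mem h.toLengths i) k)
  have k0 := mul_le_mul_of_nonneg_left (key 0) (h.pos 3).le
  have k1 := mul_le_mul_of_nonneg_left (key 1) (h.pos 1).le
  have k2 := mul_le_mul_of_nonneg_left (key 2) (h.pos 2).le
  have k3 := mul_le_mul_of_nonneg_left (key 3) (h.pos 0).le
  simp only [mass]
  linarith

theorem mass_nonneg (h : Weighted a b c κ w) (A : Set ℝ) : 0 ≤ mass (lamOf a b c) w A := by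
  have h0 := h.pos 0
  have h1 := h.pos 1
  have h2 := h.pos 2
  have h3 := h.pos 3
  have := weight_nonneg (SwitchedServer.iet (lamOf a b c))
  unfold mass
  have p0 := mul_nonneg h3.le (this (SwitchedServer.pt (lamOf a b c) 0) A)
  have p1 := mul_nonneg h1.le (this (SwitchedServer.pt (lamOf a b c) 1) A)
  have p2 := mul_nonneg h2.le (this (SwitchedServer.pt (lamOf a b c) 2) A)
  have p3 := mul_nonneg h0.le (this (SwitchedServer.pt (lamOf a b c) 3) A)
  linarith

theorem mass_univ (h : Weighted a b c κ w) : mass (lamOf a b c) w univ = 1 := by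
  have := h.sum
  simp only [mass, weight_univ]; linarith

theorem mass_empty : mass (lamOf a b c) w ∅ = 0 := by
  simp only [mass, weight_empty]; ring

theorem mass_mono (h : Weighted a b c κ w) {A B : Set ℝ}
    (hAB : ∀ x ∈ Icc 0 (SwitchedServer.total (lamOf a b c)), x ∈ A → x ∈ B) :
    mass (lamOf a b c) w A ≤ mass (lamOf a b c) w B := by
  have := h.mass_le_six (A := A) (B := ∅) (C := ∅) (A' := B) (B' := ∅) (C' := ∅) fun x hx => by
    have := hAB x hx
    split_ifs <;> simp_all
  simp only [mass_empty] at this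
  linarith

theorem mass_Iio_bet (h : Weighted a b c κ w) :
    mass (lamOf a b c) w (Iio a) = w 0 ∧
    mass (lamOf a b c) w (Iio (a + b + c)) = w 0 + w 1 ∧
    mass (lamOf a b c) w (Iio (2 * a + b + 2 * c)) = w 0 + w 1 + w 2 := by
  obtain ⟨⟨h1, h2⟩, ⟨h3, h4⟩, h5, h6⟩ := h.toLengths.bounds
  have m0 := h.mass_cell 0
  have m1 := h.mass_cell 1
  have m2 := h.mass_cell 2
  simp [SwitchedServer.cell, lamOf] at m0 m1 m2
  have e0 : mass (lamOf a b c) w (Iio a) = w 0 := by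
    rw [← m0]
    exact le_antisymm (h.mass_mono fun x hx hxa => ⟨hx.1, hxa⟩) (h.mass_mono fun x hx hxa => hxa.2)
  have e1 : mass (lamOf a b c) w (Iio (a + b + c)) = w 0 + w 1 := by
    rw [← m1, ← e0]
    have p := h.mass_le_six (A := Iio (a + b + c)) (B := ∅) (C := ∅) (A' := Iio a)
      (B' := Ico a (a + (b + c))) (C' := ∅) fun x hx => by
        simp only [mem_Iio, mem_Ico, mem_empty_iff_false, if_false]
        split_ifs <;> grind
    have q := h.mass_le_six (A' := Iio (a + b + c)) (B' := ∅) (C' := ∅) (A := Iio a)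
      (B := Ico a (a + (b + c))) (C := ∅) fun x hx => by
        simp only [mem_Iio, mem_Ico, mem_empty_iff_false, if_false]
        split_ifs <;> grind
    simp only [mass_empty] at p q
    change _ = _ + mass ![a, b + c, c + a, b] w _
    change _ ≤ _ + mass ![a, b + c, c + a, b] w _ + _ at p
    change _ + mass ![a, b + c, c + a, b] w _ + _ ≤ _ at q
    linarith
  refine ⟨e0, e1, ?_⟩
  rw [← m2, ← e1]
  have p := h.mass_le_six (A := Iio (2 * a + b + 2 * c)) (B := ∅) (C := ∅)
    (A' := Iio (a + b + c)) (B' := Ico (a + (b + c)) (a + (b + c) + (c + a))) (C' := ∅)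
    fun x hx => by
      simp only [mem_Iio, mem_Ico, mem_empty_iff_false, if_false]
      split_ifs <;> grind
  have q := h.mass_le_six (A' := Iio (2 * a + b + 2 * c)) (B' := ∅) (C' := ∅)
    (A := Iio (a + b + c)) (B := Ico (a + (b + c)) (a + (b + c) + (c + a))) (C := ∅)
    fun x hx => by
      simp only [mem_Iio, mem_Ico, mem_empty_iff_false, if_false]
      split_ifs <;> grind
  simp only [mass_empty] at p q
  change _ = _ + mass ![a, b + c, c + a, b] w _
  change _ ≤ _ + mass ![a, b + c, c + a, b] w _ + _ at p
  change _ + mass ![a, b + c, c + a, b] w _ + _ ≤ _ at q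
  linarith

/-- The orbit of `p₁` visits the interval between `y` and `y'` and carries positive atoms. Thus
density of orbits makes the distribution function strictly increasing. -/
theorem mass_Iic_lt (h : Weighted a b c κ w) {y y' : ℝ} (hy : 0 ≤ y) (hyy : y < y')
    (hy' : y' ≤ SwitchedServer.total (lamOf a b c)) :
    mass (lamOf a b c) w (Iic y) < mass (lamOf a b c) w (Iio y') := by
  obtain ⟨k, -, hk⟩ := h.exists_iterate_mem (pt_mem h.toLengths 0) hy hyy hy' 0
  have hsub : ∀ i k, (SwitchedServer.iet (lamOf a b c))^[k] (SwitchedServer.pt (lamOf a b c) i) ∈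
      Iic y → (SwitchedServer.iet (lamOf a b c))^[k] (SwitchedServer.pt (lamOf a b c) i) ∈
      Iio y' := fun i k hx => lt_of_le_of_lt hx hyy
  have k0 := mul_lt_mul_of_pos_left (weight_lt (hsub 0) (not_le.2 hk.1) hk.2) (h.pos 3)
  have k1 := mul_le_mul_of_nonneg_left (weight_mono (hsub 1)) (h.pos 1).le
  have k2 := mul_le_mul_of_nonneg_left (weight_mono (hsub 2)) (h.pos 2).le
  have k3 := mul_le_mul_of_nonneg_left (weight_mono (hsub 3)) (h.pos 0).le
  simp only [mass]
  linarith

theorem tendsto_mass {lam : Fin 4 → ℝ} {l : Filter ℝ} [l.IsCountablyGenerated] {A : ℝ → Set ℝ}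
    {B : Set ℝ} (h : ∀ x, ∀ᶠ y in l, (x ∈ A y ↔ x ∈ B)) :
    Tendsto (fun y => mass lam w (A y)) l (𝓝 (mass lam w B)) := by
  unfold mass
  exact ((((tendsto_weight h).const_mul _).add ((tendsto_weight h).const_mul _)).add
    ((tendsto_weight h).const_mul _)).add ((tendsto_weight h).const_mul _)

/-- The point is the supremum of all `y` with mass at most `t` strictly to the left. Left continuity
gives the first inequality, the limit from the right the second. -/
theorem exists_level (h : Weighted a b c κ w) {t : ℝ} (ht : t ∈ Icc (0 : ℝ) 1) :
    ∃ y ∈ Icc 0 (SwitchedServer.total (lamOf a b c)),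
      mass (lamOf a b c) w (Iio y) ≤ t ∧ t ≤ mass (lamOf a b c) w (Iic y) := by
  obtain ⟨⟨h1, h2⟩, ⟨h3, h4⟩, h5, h6⟩ := h.toLengths.bounds
  set L := SwitchedServer.total (lamOf a b c) with hL
  have hL0 : 0 < L := by rw [hL, Lengths.total_eq]; linarith
  set S := {y | y ∈ Icc 0 L ∧ mass (lamOf a b c) w (Iio y) ≤ t} with hS
  have h0S : (0 : ℝ) ∈ S := by
    refine ⟨⟨le_rfl, hL0.le⟩, ?_⟩
    have := h.mass_mono (A := Iio 0) (B := ∅) fun x hx hx0 => absurd hx0 (not_lt.2 hx.1)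
    rw [mass_empty] at this
    linarith [ht.1]
  have hbdd : BddAbove S := ⟨L, fun y hy => hy.1.2⟩
  have hy0 : 0 ≤ sSup S := le_csSup hbdd h0S
  have hyL : sSup S ≤ L := csSup_le ⟨0, h0S⟩ fun y hy => hy.1.2
  refine ⟨sSup S, ⟨hy0, hyL⟩, ?_, ?_⟩
  · refine le_of_tendsto (tendsto_mass fun x => eventually_lt_iff_left x (sSup S)) ?_
    filter_upwards [self_mem_nhdsWithin] with z hz
    obtain ⟨s, hs, hzs⟩ := exists_lt_of_lt_csSup ⟨0, h0S⟩ hz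
    exact (h.mass_mono fun x _ hx => lt_trans hx hzs).trans hs.2
  · rcases hyL.eq_or_lt with e | e
    · have := h.mass_mono (A := univ) (B := Iic (sSup S)) fun x hx _ => by rw [e]; exact hx.2
      rw [h.mass_univ] at this
      linarith [ht.2]
    · refine ge_of_tendsto (tendsto_mass fun x => eventually_lt_iff_right x (sSup S)) ?_
      filter_upwards [Ioo_mem_nhdsGT e] with z hz
      by_contra hlt
      push Not at hlt
      exact absurd (le_csSup hbdd ⟨⟨hy0.trans hz.1.le, hz.2.le⟩, hlt.le⟩) (not_le.2 hz.1)

theorem level_unique (h : Weighted a b c κ w) {t y y' : ℝ}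
    (hy : y ∈ Icc 0 (SwitchedServer.total (lamOf a b c)))
    (hy' : y' ∈ Icc 0 (SwitchedServer.total (lamOf a b c)))
    (h1 : mass (lamOf a b c) w (Iio y) ≤ t) (h2 : t ≤ mass (lamOf a b c) w (Iic y))
    (h1' : mass (lamOf a b c) w (Iio y') ≤ t) (h2' : t ≤ mass (lamOf a b c) w (Iic y')) :
    y = y' := by
  rcases lt_trichotomy y y' with hlt | he | hlt
  · linarith [h.mass_Iic_lt hy.1 hlt hy'.2]
  · exact he
  · linarith [h.mass_Iic_lt hy'.1 hlt hy.2]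

open scoped Classical in
-- The atoms at time `0` split off, and the remaining weights are half of those of the shifted
-- orbits. The atoms displayed are the lengths of the gaps in the image of `contr w`.
theorem mass_step (A : Set ℝ) (h : Weighted a b c κ w) : mass (lamOf a b c) w A =
    w 3 / 2 * (if 0 ∈ A then 1 else 0) + w 1 / 2 * (if c + a ∈ A then 1 else 0) +
    w 2 / 2 * (if 2 * a + b + c ∈ A then 1 else 0) +
    w 0 / 2 * (if 2 * a + 2 * b + 2 * c ∈ A then 1 else 0) +
    mass (lamOf a b c) w (SwitchedServer.iet (lamOf a b c) ⁻¹' A) / 2 := by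
  simp only [mass]
  rw [weight_step _ _ A, weight_step _ (SwitchedServer.pt _ 1) A,
    weight_step _ (SwitchedServer.pt _ 2) A, weight_step _ (SwitchedServer.pt _ 3) A]
  simp only [pt_eq h.toLengths, Matrix.cons_val]
  ring

/-- The semiconjugacy: the point at which the mass reaches the level `t`. -/
noncomputable def semi (h : Weighted a b c κ w) (t : ℝ) : ℝ :=
  open scoped Classical in
  if ht : t ∈ Icc (0 : ℝ) 1 then (h.exists_level ht).choose else 0

theorem semi_spec (h : Weighted a b c κ w) {t : ℝ} (ht : t ∈ Icc (0 : ℝ) 1) :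
    h.semi t ∈ Icc 0 (SwitchedServer.total (lamOf a b c)) ∧
      mass (lamOf a b c) w (Iio (h.semi t)) ≤ t ∧ t ≤ mass (lamOf a b c) w (Iic (h.semi t)) := by
  unfold semi
  rw [dif_pos ht]
  exact (h.exists_level ht).choose_spec

theorem semi_monotoneOn (h : Weighted a b c κ w) : MonotoneOn h.semi (Icc 0 1) := by
  intro t ht t' ht' htt
  obtain ⟨m, h1, h2⟩ := h.semi_spec ht
  obtain ⟨m', h1', h2'⟩ := h.semi_spec ht'
  by_contra hlt
  push Not at hlt
  linarith [h.mass_Iic_lt m'.1 hlt m.2]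

theorem semi_surjOn (h : Weighted a b c κ w) :
    SurjOn h.semi (Icc 0 1) (Icc 0 (SwitchedServer.total (lamOf a b c))) := by
  intro y hy
  have h0 := h.mass_nonneg (Iio y)
  have h1 : mass (lamOf a b c) w (Iio y) ≤ 1 := by
    rw [← h.mass_univ]; exact h.mass_mono fun _ _ _ => mem_univ _
  obtain ⟨m, h2, h3⟩ := h.semi_spec ⟨h0, h1⟩
  exact ⟨_, ⟨h0, h1⟩, h.level_unique m hy h2 h3 le_rfl
    (h.mass_mono fun x _ hx => (le_of_lt hx : x ≤ y))⟩

theorem semi_image (h : Weighted a b c κ w) :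
    h.semi '' Icc 0 1 = Icc 0 (SwitchedServer.total (lamOf a b c)) :=
  Subset.antisymm (by rintro _ ⟨t, ht, rfl⟩; exact (h.semi_spec ht).1) h.semi_surjOn

/-- A monotone map onto an interval has no jumps. -/
theorem semi_continuousOn (h : Weighted a b c κ w) : ContinuousOn h.semi (Icc 0 1) := by
  rw [continuousOn_iff_continuous_domRestrict]
  let g : Icc (0 : ℝ) 1 → Icc 0 (SwitchedServer.total (lamOf a b c)) :=
    fun t => ⟨h.semi t, (h.semi_spec t.2).1⟩
  have hg : Monotone g := fun t t' htt => h.semi_monotoneOn t.2 t'.2 htt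
  have hs : Function.Surjective g := by
    rintro ⟨y, hy⟩
    obtain ⟨t, ht, e⟩ := h.semi_surjOn hy
    exact ⟨⟨t, ht⟩, Subtype.ext e⟩
  exact continuous_subtype_val.comp (hg.continuous_of_surjective hs)

/-- Applied to the ends of the cells, it matches the pieces of `contr w` with the cells of `T`. -/
theorem lt_iff_semi_lt (h : Weighted a b c κ w) {t β : ℝ} (ht : t ∈ Icc (0 : ℝ) 1)
    (hβ : β ≤ SwitchedServer.total (lamOf a b c)) :
    t < mass (lamOf a b c) w (Iio β) ↔ h.semi t < β := by
  obtain ⟨m, h1, h2⟩ := h.semi_spec ht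
  constructor
  · intro hlt
    by_contra hge
    push Not at hge
    have := h.mass_mono (A := Iio β) (B := Iio (h.semi t)) fun x _ hx => lt_of_lt_of_le hx hge
    linarith
  · intro hlt
    linarith [h.mass_Iic_lt m.1 hlt hβ]

theorem contr_mem (w : Fin 4 → ℝ) {t : ℝ} (ht : t ∈ Icc (0 : ℝ) 1) :
    contr w t ∈ Icc (0 : ℝ) 1 := by
  obtain ⟨h0, h1⟩ := ht
  unfold contr
  split_ifs <;> constructor <;> linarith

theorem iet_cases (x : ℝ) :
    (x < a ∧ SwitchedServer.iet (lamOf a b c) x = -x + 2 * a + c) ∨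
    (a ≤ x ∧ x < a + b + c ∧ SwitchedServer.iet (lamOf a b c) x = -x + 3 * a + 2 * b + 2 * c) ∨
    (a ≤ x ∧ a + b + c ≤ x ∧ x < 2 * a + b + 2 * c ∧
      SwitchedServer.iet (lamOf a b c) x = -x + 2 * a + b + 2 * c) ∨
    (a ≤ x ∧ a + b + c ≤ x ∧ 2 * a + b + 2 * c ≤ x ∧
      SwitchedServer.iet (lamOf a b c) x = -x + 4 * a + 2 * b + 3 * c) := by
  rw [Lengths.iet_eq]
  split_ifs with h1 h2 h3
  · exact Or.inl ⟨h1, by ring⟩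
  · exact Or.inr (Or.inl ⟨not_lt.1 h1, by linarith, by ring⟩)
  · exact Or.inr (Or.inr (Or.inl ⟨not_lt.1 h1, by linarith, by linarith, by ring⟩))
  · exact Or.inr (Or.inr (Or.inr ⟨not_lt.1 h1, by linarith, by linarith, by ring⟩))

set_option maxHeartbeats 400000 in
-- As `T` reverses orientation, the points that it sends to the left of `T y` are those of `I₃` and
-- those of `I₁` to the right of `y`. Written with indicators of half-lines, this bounds the mass of
-- the preimage, and `mass_step` then gives the branch `1/2 - t/2` of `contr`. The other three cells
-- are treated alike.
theorem mass_iet_zero (h : Weighted a b c κ w) {y : ℝ}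
    (hy : y ∈ Icc 0 (2 * a + 2 * b + 2 * c)) (r1 : y < a) :
    mass (lamOf a b c) w (Iio (SwitchedServer.iet (lamOf a b c) y)) ≤
      1 / 2 - mass (lamOf a b c) w (Iic y) / 2 ∧
    1 / 2 - mass (lamOf a b c) w (Iio y) / 2 ≤
      mass (lamOf a b c) w (Iic (SwitchedServer.iet (lamOf a b c) y)) := by
  obtain ⟨ha, hb, hc⟩ := h.toLengths.lengths_pos
  obtain ⟨y0, yL⟩ := hy
  have er : SwitchedServer.iet (lamOf a b c) y = -y + 2 * a + c := by
    rw [Lengths.iet_eq]; split_ifs <;> linarith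
  generalize SwitchedServer.iet (lamOf a b c) y = Ty at er
  have pl := h.mass_le_six (A := SwitchedServer.iet (lamOf a b c) ⁻¹' Iio Ty)
    (B := Iio (a + b + c)) (C := Iic y) (A' := Iio (2 * a + b + 2 * c)) (B' := Iio a)
    (C' := ∅) fun x hx => by
      obtain ⟨x0, xL⟩ := hx
      rw [Lengths.total_eq] at xL
      rcases iet_cases (a := a) (b := b) (c := c) x with ⟨q1, e⟩ | ⟨q1, q2, e⟩ |
      ⟨q1, q2, q3, e⟩ | ⟨q1, q2, q3, e⟩ <;>
      simp only [mem_preimage, mem_Iio, mem_Iic, mem_empty_iff_false, if_false, e] <;>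
      split_ifs <;> linarith
  have pr := h.mass_le_six (A' := SwitchedServer.iet (lamOf a b c) ⁻¹' Iic Ty)
    (B' := Iio (a + b + c)) (C' := Iio y) (A := Iio (2 * a + b + 2 * c)) (B := Iio a)
    (C := ∅) fun x hx => by
      obtain ⟨x0, xL⟩ := hx
      rw [Lengths.total_eq] at xL
      rcases iet_cases (a := a) (b := b) (c := c) x with ⟨q1, e⟩ | ⟨q1, q2, e⟩ |
      ⟨q1, q2, q3, e⟩ | ⟨q1, q2, q3, e⟩ <;>
      simp only [mem_preimage, mem_Iio, mem_Iic, mem_empty_iff_false, if_false, e] <;>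
      split_ifs <;> linarith
  have sl := h.mass_step (Iio Ty)
  have sr := h.mass_step (Iic Ty)
  simp only [mem_Iio, mem_Iic] at sl sr
  -- Of the four first atoms, those at `p₁ = 0` and `p₂ = c + a` lie to the left of `T y`.
  rw [if_pos (by linarith), if_pos (by linarith), if_neg (by linarith), if_neg (by linarith)] at sl
  rw [if_pos (by linarith), if_pos (by linarith)] at sr
  obtain ⟨b0, b1, b2⟩ := h.mass_Iio_bet
  simp only [mass_empty, b0, b1, b2] at pl pr
  have hs := h.sum
  have w0 := h.pos 0
  have w1 := h.pos 1
  have w2 := h.pos 2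
  have w3 := h.pos 3
  constructor
  · linarith
  · split_ifs at sr <;> linarith

set_option maxHeartbeats 400000 in
-- Here the preimage consists of `I₁` and all points to the right of `y`.
theorem mass_iet_one (h : Weighted a b c κ w) {y : ℝ}
    (hy : y ∈ Icc 0 (2 * a + 2 * b + 2 * c)) (r1 : a ≤ y) (r2 : y < a + b + c) :
    mass (lamOf a b c) w (Iio (SwitchedServer.iet (lamOf a b c) y)) ≤
      1 - mass (lamOf a b c) w (Iic y) / 2 ∧
    1 - mass (lamOf a b c) w (Iio y) / 2 ≤
      mass (lamOf a b c) w (Iic (SwitchedServer.iet (lamOf a b c) y)) := by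
  obtain ⟨ha, hb, hc⟩ := h.toLengths.lengths_pos
  obtain ⟨y0, yL⟩ := hy
  have er : SwitchedServer.iet (lamOf a b c) y = -y + 3 * a + 2 * b + 2 * c := by
    rw [Lengths.iet_eq]; split_ifs <;> linarith
  generalize SwitchedServer.iet (lamOf a b c) y = Ty at er
  have pl := h.mass_le_six (A := SwitchedServer.iet (lamOf a b c) ⁻¹' Iio Ty)
    (B := ∅) (C := Iic y) (A' := univ) (B' := Iio a) (C' := ∅) fun x hx => by
      obtain ⟨x0, xL⟩ := hx
      rw [Lengths.total_eq] at xL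
      rcases iet_cases (a := a) (b := b) (c := c) x with ⟨q1, e⟩ | ⟨q1, q2, e⟩ |
      ⟨q1, q2, q3, e⟩ | ⟨q1, q2, q3, e⟩ <;>
      simp only [mem_preimage, mem_Iio, mem_Iic, mem_univ, if_true,
        mem_empty_iff_false, if_false, e] <;>
      split_ifs <;> linarith
  have pr := h.mass_le_six (A' := SwitchedServer.iet (lamOf a b c) ⁻¹' Iic Ty)
    (B' := ∅) (C' := Iio y) (A := univ) (B := Iio a) (C := ∅) fun x hx => by
      obtain ⟨x0, xL⟩ := hx
      rw [Lengths.total_eq] at xL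
      rcases iet_cases (a := a) (b := b) (c := c) x with ⟨q1, e⟩ | ⟨q1, q2, e⟩ |
      ⟨q1, q2, q3, e⟩ | ⟨q1, q2, q3, e⟩ <;>
      simp only [mem_preimage, mem_Iio, mem_Iic, mem_univ, if_true,
        mem_empty_iff_false, if_false, e] <;>
      split_ifs <;> linarith
  have sl := h.mass_step (Iio Ty)
  have sr := h.mass_step (Iic Ty)
  simp only [mem_Iio, mem_Iic] at sl sr
  rw [if_pos (by linarith), if_pos (by linarith), if_pos (by linarith), if_neg (by linarith)] at sl
  rw [if_pos (by linarith), if_pos (by linarith), if_pos (by linarith)] at sr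
  obtain ⟨b0, b1, b2⟩ := h.mass_Iio_bet
  simp only [mass_empty, h.mass_univ, b0] at pl pr
  have hs := h.sum
  have w0 := h.pos 0
  have w1 := h.pos 1
  have w2 := h.pos 2
  have w3 := h.pos 3
  constructor
  · linarith
  · split_ifs at sr <;> linarith

set_option maxHeartbeats 400000 in
theorem mass_iet_two (h : Weighted a b c κ w) {y : ℝ}
    (hy : y ∈ Icc 0 (2 * a + 2 * b + 2 * c)) (r1 : a + b + c ≤ y)
    (r2 : y < 2 * a + b + 2 * c) :
    mass (lamOf a b c) w (Iio (SwitchedServer.iet (lamOf a b c) y)) ≤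
      1 / 2 - mass (lamOf a b c) w (Iic y) / 2 ∧
    1 / 2 - mass (lamOf a b c) w (Iio y) / 2 ≤
      mass (lamOf a b c) w (Iic (SwitchedServer.iet (lamOf a b c) y)) := by
  obtain ⟨ha, hb, hc⟩ := h.toLengths.lengths_pos
  obtain ⟨y0, yL⟩ := hy
  have er : SwitchedServer.iet (lamOf a b c) y = -y + 2 * a + b + 2 * c := by
    rw [Lengths.iet_eq]; split_ifs <;> linarith
  generalize SwitchedServer.iet (lamOf a b c) y = Ty at er
  have pl := h.mass_le_six (A := SwitchedServer.iet (lamOf a b c) ⁻¹' Iio Ty)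
    (B := ∅) (C := Iic y) (A' := Iio (2 * a + b + 2 * c)) (B' := ∅) (C' := ∅) fun x hx => by
      obtain ⟨x0, xL⟩ := hx
      rw [Lengths.total_eq] at xL
      rcases iet_cases (a := a) (b := b) (c := c) x with ⟨q1, e⟩ | ⟨q1, q2, e⟩ |
      ⟨q1, q2, q3, e⟩ | ⟨q1, q2, q3, e⟩ <;>
      simp only [mem_preimage, mem_Iio, mem_Iic, mem_empty_iff_false, if_false, e] <;>
      split_ifs <;> linarith
  have pr := h.mass_le_six (A' := SwitchedServer.iet (lamOf a b c) ⁻¹' Iic Ty)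
    (B' := ∅) (C' := Iio y) (A := Iio (2 * a + b + 2 * c)) (B := ∅) (C := ∅) fun x hx => by
      obtain ⟨x0, xL⟩ := hx
      rw [Lengths.total_eq] at xL
      rcases iet_cases (a := a) (b := b) (c := c) x with ⟨q1, e⟩ | ⟨q1, q2, e⟩ |
      ⟨q1, q2, q3, e⟩ | ⟨q1, q2, q3, e⟩ <;>
      simp only [mem_preimage, mem_Iio, mem_Iic, mem_empty_iff_false, if_false, e] <;>
      split_ifs <;> linarith
  have sl := h.mass_step (Iio Ty)
  have sr := h.mass_step (Iic Ty)
  simp only [mem_Iio, mem_Iic] at sl sr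
  rw [if_pos (by linarith), if_neg (by linarith), if_neg (by linarith), if_neg (by linarith)] at sl
  rw [if_pos (by linarith)] at sr
  obtain ⟨b0, b1, b2⟩ := h.mass_Iio_bet
  simp only [mass_empty, b2] at pl pr
  have hs := h.sum
  have w0 := h.pos 0
  have w1 := h.pos 1
  have w2 := h.pos 2
  have w3 := h.pos 3
  constructor
  · linarith
  · split_ifs at sr <;> linarith

set_option maxHeartbeats 400000 in
-- Here the preimage consists of `I₁`, `I₃` and the part of `I₄` to the right of `y`.
theorem mass_iet_three (h : Weighted a b c κ w) {y : ℝ}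
    (hy : y ∈ Icc 0 (2 * a + 2 * b + 2 * c)) (r1 : 2 * a + b + 2 * c ≤ y) :
    mass (lamOf a b c) w (Iio (SwitchedServer.iet (lamOf a b c) y)) ≤
      1 - mass (lamOf a b c) w (Iic y) / 2 ∧
    1 - mass (lamOf a b c) w (Iio y) / 2 ≤
      mass (lamOf a b c) w (Iic (SwitchedServer.iet (lamOf a b c) y)) := by
  obtain ⟨ha, hb, hc⟩ := h.toLengths.lengths_pos
  obtain ⟨y0, yL⟩ := hy
  have er : SwitchedServer.iet (lamOf a b c) y = -y + 4 * a + 2 * b + 3 * c := by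
    rw [Lengths.iet_eq]; split_ifs <;> linarith
  generalize SwitchedServer.iet (lamOf a b c) y = Ty at er
  have pl := h.mass_le_six (A := SwitchedServer.iet (lamOf a b c) ⁻¹' Iio Ty)
    (B := Iio (a + b + c)) (C := Iic y) (A' := Iio a) (B' := univ)
    (C' := Iio (2 * a + b + 2 * c)) fun x hx => by
      obtain ⟨x0, xL⟩ := hx
      rw [Lengths.total_eq] at xL
      rcases iet_cases (a := a) (b := b) (c := c) x with ⟨q1, e⟩ | ⟨q1, q2, e⟩ |
      ⟨q1, q2, q3, e⟩ | ⟨q1, q2, q3, e⟩ <;>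
      simp only [mem_preimage, mem_Iio, mem_Iic, mem_univ, if_true, e] <;>
      split_ifs <;> linarith
  have pr := h.mass_le_six (A' := SwitchedServer.iet (lamOf a b c) ⁻¹' Iic Ty)
    (B' := Iio (a + b + c)) (C' := Iio y) (A := Iio a) (B := univ)
    (C := Iio (2 * a + b + 2 * c)) fun x hx => by
      obtain ⟨x0, xL⟩ := hx
      rw [Lengths.total_eq] at xL
      rcases iet_cases (a := a) (b := b) (c := c) x with ⟨q1, e⟩ | ⟨q1, q2, e⟩ |
      ⟨q1, q2, q3, e⟩ | ⟨q1, q2, q3, e⟩ <;>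
      simp only [mem_preimage, mem_Iio, mem_Iic, mem_univ, if_true, e] <;>
      split_ifs <;> linarith
  have sl := h.mass_step (Iio Ty)
  have sr := h.mass_step (Iic Ty)
  simp only [mem_Iio, mem_Iic] at sl sr
  rw [if_pos (by linarith), if_pos (by linarith), if_neg (by linarith), if_neg (by linarith)] at sl
  rw [if_pos (by linarith), if_pos (by linarith)] at sr
  obtain ⟨b0, b1, b2⟩ := h.mass_Iio_bet
  simp only [h.mass_univ, b0, b1, b2] at pl pr
  have hs := h.sum
  have w0 := h.pos 0
  have w1 := h.pos 1
  have w2 := h.pos 2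
  have w3 := h.pos 3
  constructor
  · linarith
  · split_ifs at sr <;> linarith

/-- The piecewise contraction moves levels as the exchange of intervals moves points. -/
theorem semi_contr (h : Weighted a b c κ w) {t : ℝ} (ht : t ∈ Icc (0 : ℝ) 1) :
    h.semi (contr w t) = SwitchedServer.iet (lamOf a b c) (h.semi t) := by
  obtain ⟨⟨l1, l2⟩, ⟨l3, l4⟩, l5, l6⟩ := h.toLengths.bounds
  obtain ⟨m, h1, h2⟩ := h.semi_spec ht
  obtain ⟨m', h1', h2'⟩ := h.semi_spec (contr_mem w ht)
  have hT := h.mapsTo_t m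
  obtain ⟨b0, b1, b2⟩ := h.mass_Iio_bet
  have i0 := h.lt_iff_semi_lt ht (β := a) (by rw [Lengths.total_eq]; linarith)
  have i1 := h.lt_iff_semi_lt ht (β := a + b + c) (by rw [Lengths.total_eq]; linarith)
  have i2 := h.lt_iff_semi_lt ht (β := 2 * a + b + 2 * c) (by rw [Lengths.total_eq]; linarith)
  rw [b0] at i0
  rw [b1] at i1
  rw [b2] at i2
  have m₂ := m
  rw [Lengths.total_eq] at m₂
  suffices hk : mass (lamOf a b c) w (Iio (SwitchedServer.iet (lamOf a b c) (h.semi t))) ≤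
      contr w t ∧ contr w t ≤
      mass (lamOf a b c) w (Iic (SwitchedServer.iet (lamOf a b c) (h.semi t))) from
    h.level_unique m' hT h1' h2' hk.1 hk.2
  unfold contr
  split_ifs with c0 c1 c2
  · have := h.mass_iet_zero m₂ (i0.1 c0)
    constructor <;> linarith
  · have := h.mass_iet_one m₂ (not_lt.1 fun q => c0 (i0.2 q)) (i1.1 c1)
    constructor <;> linarith
  · have := h.mass_iet_two m₂ (not_lt.1 fun q => c1 (i1.2 q)) (i2.1 c2)
    constructor <;> linarith
  · have := h.mass_iet_three m₂ (not_lt.1 fun q => c2 (i2.2 q))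
    constructor <;> linarith

end Weighted

open SwitchedServer (param boundary poincareMap serverAt nextTank flow rate)

/-! ### The parametrization of the boundary -/

theorem param_eq {t : ℝ} (ht : t ∈ Icc (0 : ℝ) 1) : param t =
    ![max 0 (min (3 * t - 1) (3 - 3 * t)), max 0 (max (1 - 3 * t) (3 * t - 2)),
      max 0 (min (3 * t) (2 - 3 * t))] := by
  obtain ⟨h0, h1⟩ := ht
  unfold SwitchedServer.param
  funext i
  split_ifs with h2 h3 <;> fin_cases i <;> simp <;> grind

theorem param_continuousOn : ContinuousOn param (Icc 0 1) := by
  refine ContinuousOn.congr (Continuous.continuousOn (continuous_pi fun i => ?_))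
    fun t ht => param_eq ht
  fin_cases i <;> simp <;> fun_prop

theorem param_mem {t : ℝ} (ht : t ∈ Icc (0 : ℝ) 1) : param t ∈ boundary := by
  obtain ⟨h0, h1⟩ := ht
  unfold SwitchedServer.param
  split_ifs with h2 h3
  · refine ⟨⟨fun i => ?_, ?_⟩, 0, rfl⟩
    · fin_cases i <;> simp <;> linarith
    · simp [Fin.sum_univ_three]
  · refine ⟨⟨fun i => ?_, ?_⟩, 1, rfl⟩
    · fin_cases i <;> simp <;> linarith
    · simp [Fin.sum_univ_three]; norm_num
  · refine ⟨⟨fun i => ?_, ?_⟩, 2, rfl⟩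
    · fin_cases i <;> simp <;> linarith
    · simp [Fin.sum_univ_three]; norm_num

theorem exists_param {v : Fin 3 → ℝ} (hv : v ∈ boundary) : ∃ t ∈ Icc (0 : ℝ) 1, param t = v := by
  obtain ⟨⟨h0, hs⟩, i, hi⟩ := hv
  rw [Fin.sum_univ_three] at hs
  have v0 := h0 0
  have v1 := h0 1
  have v2 := h0 2
  fin_cases i <;> simp at hi
  · refine ⟨v 2 / 3, ⟨by linarith, by linarith⟩, ?_⟩
    rw [param_eq ⟨by linarith, by linarith⟩]
    funext j
    fin_cases j <;> simp <;> grind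
  · refine ⟨(1 + v 0) / 3, ⟨by linarith, by linarith⟩, ?_⟩
    rw [param_eq ⟨by linarith, by linarith⟩]
    funext j
    fin_cases j <;> simp <;> grind
  · refine ⟨(2 + v 1) / 3, ⟨by linarith, by linarith⟩, ?_⟩
    rw [param_eq ⟨by linarith, by linarith⟩]
    funext j
    fin_cases j <;> simp <;> grind

theorem param_injective {s t : ℝ} (hs : s ∈ Icc (0 : ℝ) 1) (ht : t ∈ Icc (0 : ℝ) 1)
    (h : param s = param t) : s = t ∨ (s = 0 ∧ t = 1) ∨ (s = 1 ∧ t = 0) := by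
  rw [param_eq hs, param_eq ht] at h
  have h0 := congrFun h 0
  have h1 := congrFun h 1
  have h2 := congrFun h 2
  simp at h0 h1 h2
  obtain ⟨s0, s1⟩ := hs
  obtain ⟨t0, t1⟩ := ht
  grind

/-! ### The Poincaré map in this parametrization -/

/-- The break points of the Poincaré map, in terms of the parameters of the server. -/
structure Breaks (d : Fin 3 → Fin 3 → ℝ) (w : Fin 4 → ℝ) : Prop where
  pos : ∀ i j, i ≠ j → 0 < d i j
  zero_lt : 0 < w 0
  lt_third : w 0 < 1 / 3
  third_lt : 1 / 3 < w 0 + w 1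
  lt_two_thirds : w 0 + w 1 < 2 / 3
  two_thirds_lt : 2 / 3 < w 0 + w 1 + w 2
  lt_one : w 0 + w 1 + w 2 < 1
  eq₁ : d 0 2 / d 0 1 = 1 / (3 * w 0) - 1
  eq₂ : d 1 0 / d 1 2 = (2 - 3 * (w 0 + w 1)) / (3 * (w 0 + w 1) - 1)
  eq₃ : d 2 1 / d 2 0 = (3 - 3 * (w 0 + w 1 + w 2)) / (3 * (w 0 + w 1 + w 2) - 2)

/-- The tank chosen by the server on the four intervals. -/
def tankOf : Fin 4 → Fin 3 := ![1, 2, 0, 1]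

/-- The number of the piece that contains `t`. -/
noncomputable def piece (w : Fin 4 → ℝ) (t : ℝ) : Fin 4 :=
  if t < w 0 then 0 else if t < w 0 + w 1 then 1 else if t < w 0 + w 1 + w 2 then 2 else 3

namespace Breaks

variable {d : Fin 3 → Fin 3 → ℝ} {w : Fin 4 → ℝ} (h : Breaks d w)
include h

/-- On each side of the triangle the preferred tank changes at a single point, `z₁`, `z₂` or `z₃`.
At the corners `1/3` and `2/3` the two adjacent sides prefer the same tank, so four intervals remain
instead of six. The tie rule puts each break point into the interval on its right. -/
theorem serverAt_param {t : ℝ} (ht : t ∈ Icc (0 : ℝ) 1) :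
    serverAt d (param t) = tankOf (piece w t) := by
  obtain ⟨hd, a0, a1, a2, a3, a4, a5, e1, e2, e3⟩ := h
  have hmem := (param_mem ht).1
  obtain ⟨t0, t1⟩ := ht
  have d01 := hd 0 1 (by decide)
  have d02 := hd 0 2 (by decide)
  have d10 := hd 1 0 (by decide)
  have d12 := hd 1 2 (by decide)
  have d20 := hd 2 0 (by decide)
  have d21 := hd 2 1 (by decide)
  rcases lt_or_ge t (1 / 3) with h1 | h1
  · have hp : param t = ![0, 1 - 3 * t, 3 * t] := by unfold SwitchedServer.param; rw [if_pos h1]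
    rw [SwitchedServer.serverAt_eq hd hmem (i := 0) (by rw [hp]; rfl)]
    rw [div_eq_iff d01.ne'] at e1
    -- The difference of the scaled volumes is affine in `t`; the prescribed ratio makes `w 0` its
    -- zero.
    have key : (1 - 3 * t) * d 0 1 - 3 * t * d 0 2 = d 0 1 / w 0 * (w 0 - t) := by
      rw [e1]; field_simp; ring
    have hq : 0 < d 0 1 / w 0 := div_pos d01 a0
    have hc : d 0 1 * param t 1 ≤ d 0 2 * param t 2 ↔ w 0 ≤ t := by
      rw [hp]; simp
      constructor
      · intro hle
        by_contra hlt
        push Not at hlt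
        have := mul_pos hq (sub_pos.2 hlt)
        linarith
      · intro hle
        have := mul_nonneg hq.le (sub_nonneg.2 hle)
        linarith
    simp only [nextTank, piece]
    simp only [zero_add, hc]
    split_ifs <;> first | rfl | (exfalso; linarith)
  rcases lt_or_ge t (2 / 3) with h2 | h2
  · have hp : param t = ![3 * t - 1, 0, 2 - 3 * t] := by
      unfold SwitchedServer.param; rw [if_neg (not_lt.2 h1), if_pos h2]
    rw [SwitchedServer.serverAt_eq hd hmem (i := 1) (by rw [hp]; rfl)]
    rw [div_eq_iff d12.ne'] at e2
    set z := w 0 + w 1 with hz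
    have hz1 : 0 < 3 * z - 1 := by linarith
    have key : (2 - 3 * t) * d 1 2 - (3 * t - 1) * d 1 0 = 3 * d 1 2 / (3 * z - 1) * (z - t) := by
      rw [e2]; field_simp; ring
    have hq : 0 < 3 * d 1 2 / (3 * z - 1) := div_pos (by linarith) hz1
    have hc : d 1 2 * param t 2 ≤ d 1 0 * param t 0 ↔ z ≤ t := by
      rw [hp]; simp
      constructor
      · intro hle
        by_contra hlt
        push Not at hlt
        have := mul_pos hq (sub_pos.2 hlt)
        linarith
      · intro hle
        have := mul_nonneg hq.le (sub_nonneg.2 hle)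
        linarith
    simp only [nextTank, piece, show (1 : Fin 3) + 1 = 2 by decide,
      show (1 : Fin 3) + 2 = 0 by decide, hc]
    split_ifs <;> first | rfl | (exfalso; linarith)
  · have hp : param t = ![3 - 3 * t, 3 * t - 2, 0] := by
      unfold SwitchedServer.param; rw [if_neg (not_lt.2 h1), if_neg (not_lt.2 h2)]
    rw [SwitchedServer.serverAt_eq hd hmem (i := 2) (by rw [hp]; rfl)]
    rw [div_eq_iff d20.ne'] at e3
    set z := w 0 + w 1 + w 2 with hz
    have hz1 : 0 < 3 * z - 2 := by linarith
    have key : (3 - 3 * t) * d 2 0 - (3 * t - 2) * d 2 1 = 3 * d 2 0 / (3 * z - 2) * (z - t) := by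
      rw [e3]; field_simp; ring
    have hq : 0 < 3 * d 2 0 / (3 * z - 2) := div_pos (by linarith) hz1
    have hc : d 2 0 * param t 0 ≤ d 2 1 * param t 1 ↔ z ≤ t := by
      rw [hp]; simp
      constructor
      · intro hle
        by_contra hlt
        push Not at hlt
        have := mul_pos hq (sub_pos.2 hlt)
        linarith
      · intro hle
        have := mul_nonneg hq.le (sub_nonneg.2 hle)
        linarith
    simp only [nextTank, piece, show (2 : Fin 3) + 1 = 0 by decide,
      show (2 : Fin 3) + 2 = 1 by decide, hc]
    split_ifs <;> first | rfl | (exfalso; linarith)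

/-- Draining the chosen tank takes `3/2` of its level in time, during which each other tank gains
half of this level; hence the slope `-1/2`. -/
theorem poincareMap_param {t : ℝ} (ht : t ∈ Icc (0 : ℝ) 1) :
    poincareMap d (param t) = param (contr w t) := by
  unfold SwitchedServer.poincareMap
  rw [h.serverAt_param ht, param_eq ht, param_eq (Weighted.contr_mem w ht)]
  obtain ⟨hd, a0, a1, a2, a3, a4, a5, -, -, -⟩ := h
  obtain ⟨t0, t1⟩ := ht
  unfold piece contr
  funext i
  split_ifs with h1 h2 h3 <;> fin_cases i <;> simp [tankOf, flow, rate] <;> grind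

theorem iterate_param {t : ℝ} (ht : t ∈ Icc (0 : ℝ) 1) (n : ℕ) :
    (contr w)^[n] t ∈ Icc (0 : ℝ) 1 ∧
      (poincareMap d)^[n] (param t) = param ((contr w)^[n] t) := by
  induction n with
  | zero => exact ⟨ht, rfl⟩
  | succ n ih =>
    rw [Function.iterate_succ_apply', Function.iterate_succ_apply', ih.2]
    exact ⟨Weighted.contr_mem w ih.1, h.poincareMap_param ih.1⟩

end Breaks

/-! ### Semiconjugacy, absence of periodic orbits, and frequencies. -/

namespace Weighted

variable {a b c κ : ℝ} {w : Fin 4 → ℝ} {d : Fin 3 → Fin 3 → ℝ}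

theorem boundaryIsSemiconj (h : Weighted a b c κ w) (hd : Breaks d w) :
    SwitchedServer.BoundaryIsSemiconj (poincareMap d) (SwitchedServer.iet (lamOf a b c))
      (SwitchedServer.total (lamOf a b c)) := by
  refine ⟨fun v hv => ?_, contr w, fun t ht => contr_mem w ht,
    fun t ht => (hd.poincareMap_param ht).symm, h.semi, h.semi_continuousOn, h.semi_monotoneOn,
    h.semi_image, fun t ht => h.semi_contr ht⟩
  obtain ⟨t, ht, rfl⟩ := exists_param hv
  rw [hd.poincareMap_param ht]
  exact param_mem (contr_mem w ht)

theorem semi_iterate (h : Weighted a b c κ w) {t : ℝ} (ht : t ∈ Icc (0 : ℝ) 1) (n : ℕ) :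
    (contr w)^[n] t ∈ Icc (0 : ℝ) 1 ∧
      h.semi ((contr w)^[n] t) = (SwitchedServer.iet (lamOf a b c))^[n] (h.semi t) := by
  induction n with
  | zero => exact ⟨ht, rfl⟩
  | succ n ih =>
    rw [Function.iterate_succ_apply', Function.iterate_succ_apply']
    exact ⟨contr_mem w ih.1, by rw [h.semi_contr ih.1, ih.2]⟩

theorem contr_iterate_ne (h : Weighted a b c κ w) {t : ℝ} (ht : t ∈ Icc (0 : ℝ) 1) {m : ℕ}
    (hm : 0 < m) : (contr w)^[m] t ≠ t := fun e =>
  h.iterate_ne (h.semi_spec ht).1 hm (by rw [← (h.semi_iterate ht m).2, e])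

theorem level_switch {d : Fin 3 → Fin 3 → ℝ} (hd : ∀ i j, i ≠ j → 0 < d i j)
    (S : SwitchedServer.Trajectory d) (n : ℕ) :
    S.level (S.switch n) = (poincareMap d)^[n] (S.level (S.switch 0)) := by
  induction n with
  | zero => rfl
  | succ n ih => rw [S.level_switch_succ hd, ih, Function.iterate_succ_apply']

theorem switch_mem {d : Fin 3 → Fin 3 → ℝ} (S : SwitchedServer.Trajectory d) (n : ℕ) :
    0 ≤ S.switch n ∧ ∃ i, S.level (S.switch n) i = 0 := by
  have : S.switch n ∈ range S.switch := ⟨n, rfl⟩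
  rwa [S.range_switch] at this

/-- A period carries switching times to switching times, so a boundary state would recur under the
Poincaré map, and `semi` would produce a periodic point of `T`. -/
theorem not_hasPeriodicOrbit (h : Weighted a b c κ w) (hd : Breaks d w) :
    ¬ SwitchedServer.HasPeriodicOrbit d := by
  rintro ⟨S, τ, hτ, hper⟩
  obtain ⟨h0, i, hi⟩ := switch_mem S 0
  have hmem : S.switch 0 + τ ∈ range S.switch := by
    rw [S.range_switch]
    exact ⟨by linarith, i, by rw [hper _ h0]; exact hi⟩
  obtain ⟨m, hm⟩ := hmem
  have hm0 : 0 < m := by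
    rcases Nat.eq_zero_or_pos m with rfl | hpos
    · linarith
    · exact hpos
  obtain ⟨t, ht, e⟩ := exists_param (v := S.level (S.switch 0)) ⟨S.level_mem _ h0, i, hi⟩
  have e2 : param ((contr w)^[m] t) = param t := by
    rw [← (hd.iterate_param ht m).2, e, ← level_switch hd.pos S m, hm, hper _ h0]
  have hmem := (hd.iterate_param ht m).1
  -- The parameters `0` and `1` denote the same corner, so recurrence on the boundary fixes the
  -- parameter only up to this identification. One more step of `contr w` removes the ambiguity.
  have hc01 : contr w 0 = contr w 1 := by
    have p0 := hd.zero_lt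
    have p1 := hd.third_lt
    have p2 := hd.two_thirds_lt
    have p3 := hd.lt_one
    unfold contr
    rw [if_pos p0, if_neg (by linarith [hd.lt_third]), if_neg (by linarith [hd.lt_two_thirds]),
      if_neg (by linarith)]
    norm_num
  have e3 : contr w ((contr w)^[m] t) = contr w t := by
    rcases param_injective hmem ht e2 with q | ⟨q1, q2⟩ | ⟨q1, q2⟩
    · rw [q]
    · rw [q1, q2, hc01]
    · rw [q1, q2, hc01]
  refine h.contr_iterate_ne (contr_mem w ht) hm0 ?_
  rw [← Function.iterate_succ_apply, Function.iterate_succ_apply', e3]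

theorem piece_eq (h : Weighted a b c κ w) {t : ℝ} (ht : t ∈ Icc (0 : ℝ) 1) :
    piece w t = tIET.letter a b c (h.semi t) := by
  obtain ⟨ha, hb, hc⟩ := h.toLengths.lengths_pos
  obtain ⟨b0, b1, b2⟩ := h.mass_Iio_bet
  have i0 := h.lt_iff_semi_lt ht (β := a) (by rw [Lengths.total_eq]; linarith)
  have i1 := h.lt_iff_semi_lt ht (β := a + b + c) (by rw [Lengths.total_eq]; linarith)
  have i2 := h.lt_iff_semi_lt ht (β := 2 * a + b + 2 * c) (by rw [Lengths.total_eq]; linarith)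
  rw [b0] at i0
  rw [b1] at i1
  rw [b2] at i2
  simp only [piece, IET.letter, i0, i1, i2]
  simp [tIET, ev]

/-- The tank in use at the `n`-th switching time depends only on the cell that contains the `n`-th
iterate under `T`; the frequency is thus a Birkhoff average of an indicator of cells, centred by
subtracting `p`. -/
theorem hasFreq (h : Weighted a b c κ w) (hd : Breaks d w) (S : SwitchedServer.Trajectory d)
    (i : Fin 3) : S.HasFreq i ((∑ j, if tankOf j = i then lamOf a b c j else 0) /
      SwitchedServer.total (lamOf a b c)) := by
  obtain ⟨ha, hb, hc⟩ := h.toLengths.lengths_pos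
  have hL : 0 < SwitchedServer.total (lamOf a b c) := by rw [Lengths.total_eq]; linarith
  obtain ⟨h0, k, hk⟩ := switch_mem S 0
  obtain ⟨t, ht, e⟩ := exists_param (v := S.level (S.switch 0)) ⟨S.level_mem _ h0, k, hk⟩
  have hserver : ∀ n, S.server (S.switch n) = tankOf (tIET.letter a b c
      ((SwitchedServer.iet (lamOf a b c))^[n] (h.semi t))) := by
    intro n
    obtain ⟨hn, m, hm⟩ := switch_mem S n
    rw [S.server_moves _ hn m hm, ← SwitchedServer.serverAt_eq hd.pos (S.level_mem _ hn) hm,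
      level_switch hd.pos S n, ← e, (hd.iterate_param ht n).2,
      hd.serverAt_param (hd.iterate_param ht n).1, h.piece_eq (hd.iterate_param ht n).1,
      (h.semi_iterate ht n).2]
  set p := (∑ j, if tankOf j = i then lamOf a b c j else 0) /
    SwitchedServer.total (lamOf a b c) with hp
  have hsum : (∑ j, if tankOf j = i then lamOf a b c j else 0) =
      p * SwitchedServer.total (lamOf a b c) := by rw [hp, div_mul_cancel₀ _ hL.ne']
  have hlam : ∀ j, 0 ≤ lamOf a b c j := by
    intro j
    fin_cases j <;> simp [lamOf] <;> linarith
  have hp0 : 0 ≤ p := div_nonneg (Finset.sum_nonneg fun j _ => by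
    split_ifs
    · exact hlam j
    · exact le_rfl) hL.le
  have hp1 : p ≤ 1 := by
    rw [hp, div_le_one hL]
    refine Finset.sum_le_sum fun j _ => ?_
    split_ifs
    · exact le_rfl
    · exact hlam j
  have hlim := h.tendsto_birkhoffSum (ψ := fun j => (if tankOf j = i then 1 else 0) - p) (by
      simp only [sub_mul, Finset.sum_sub_distrib, ite_mul, one_mul, zero_mul]
      rw [hsum, ← Finset.mul_sum, SwitchedServer.total, sub_self]) (fun j => by
      rw [abs_le]; split_ifs <;> constructor <;> linarith) (h.semi_spec ht).1
  have hfin := hlim.add_const p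
  rw [zero_add] at hfin
  refine hfin.congr' ?_
  filter_upwards [eventually_gt_atTop 0] with n hn
  have hn0 : (n : ℝ) ≠ 0 := by exact_mod_cast hn.ne'
  simp only [SwitchedServer.Trajectory.proportion, birkhoffSum, Finset.sum_sub_distrib, hserver,
    Finset.card_filter]
  push_cast
  simp only [Finset.sum_const, Finset.card_range, nsmul_eq_mul]
  field_simp
  ring

/-! ### The `ω`-limit sets -/

/-- The points near which the semiconjugacy is not constant. -/
def support (h : Weighted a b c κ w) : Set ℝ :=
  {s | s ∈ Icc (0 : ℝ) 1 ∧ ∀ ε > 0, ∃ s' ∈ Icc (0 : ℝ) 1, |s' - s| < ε ∧ h.semi s' ≠ h.semi s}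

theorem semi_lt (h : Weighted a b c κ w) {s t : ℝ} (hs : s ∈ Icc (0 : ℝ) 1)
    (ht : t ∈ Icc (0 : ℝ) 1) (hlt : h.semi s < h.semi t) : s < t := by
  by_contra hge
  exact absurd (h.semi_monotoneOn ht hs (not_lt.1 hge)) (not_le.2 hlt)

/-- A point of the support is an end point of intervals on which the semiconjugacy increases. -/
theorem exists_interval (h : Weighted a b c κ w) {s : ℝ} (hs : s ∈ h.support) {ε : ℝ}
    (hε : 0 < ε) : ∃ lo hi, lo ∈ Icc (0 : ℝ) 1 ∧ hi ∈ Icc (0 : ℝ) 1 ∧ (s = lo ∨ s = hi) ∧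
      hi - lo < ε ∧ h.semi lo < h.semi hi := by
  obtain ⟨hs1, hs2⟩ := hs
  obtain ⟨s', hs', hd, hne⟩ := hs2 ε hε
  obtain ⟨d1, d2⟩ := abs_lt.1 hd
  rcases lt_or_gt_of_ne hne with hlt | hlt
  · exact ⟨s', s, hs', hs1, Or.inr rfl, by linarith, hlt⟩
  · exact ⟨s, s', hs1, hs', Or.inl rfl, by linarith, hlt⟩

/-- Near a point of the support `semi` increases across a short interval with this point as an end.
The `T`-orbit enters the image of that interval, which forces the orbit of the contraction into the
interval itself. -/
theorem exists_iterate_near (h : Weighted a b c κ w) {t : ℝ} (ht : t ∈ Icc (0 : ℝ) 1) {s : ℝ}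
    (hs : s ∈ h.support) {ε : ℝ} (hε : 0 < ε) (N : ℕ) :
    ∃ k ≥ N, |(contr w)^[k] t - s| < ε := by
  obtain ⟨lo, hi, hlo, hhi, hor, hd, hlt⟩ := h.exists_interval hs hε
  obtain ⟨k, hk, hmem⟩ := h.exists_iterate_mem (h.semi_spec ht).1 (h.semi_spec hlo).1.1 hlt
    (h.semi_spec hhi).1.2 N
  rw [← (h.semi_iterate ht k).2] at hmem
  have hi1 := h.semi_lt hlo (h.semi_iterate ht k).1 hmem.1
  have hi2 := h.semi_lt (h.semi_iterate ht k).1 hhi hmem.2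
  refine ⟨k, hk, abs_lt.2 ?_⟩
  rcases hor with rfl | rfl <;> constructor <;> linarith

/-- Were `semi` constant near the limit, two different iterates would have the same image, a
periodic point of `T`. -/
theorem mem_support_of_tendsto (h : Weighted a b c κ w) {t : ℝ} (ht : t ∈ Icc (0 : ℝ) 1) {s : ℝ}
    (hs : s ∈ Icc (0 : ℝ) 1) {ρ : ℕ → ℕ} (hρ : StrictMono ρ)
    (hlim : Tendsto (fun n => (contr w)^[ρ n] t) atTop (𝓝 s)) : s ∈ h.support := by
  refine ⟨hs, fun ε hε => ?_⟩
  by_contra hne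
  push Not at hne
  obtain ⟨N, hN⟩ := Metric.tendsto_atTop.1 hlim ε hε
  have e1 := hne _ (h.semi_iterate ht (ρ N)).1 (hN N le_rfl)
  have e2 := hne _ (h.semi_iterate ht (ρ (N + 1))).1 (hN (N + 1) (Nat.le_succ N))
  have hlt := hρ (Nat.lt_succ_self N)
  rw [← e2, (h.semi_iterate ht _).2, (h.semi_iterate ht _).2] at e1
  refine h.iterate_ne (h.iterate_mem (h.semi_spec ht).1 (ρ N)) (Nat.sub_pos_of_lt hlt) ?_
  rw [← Function.iterate_add_apply, Nat.sub_add_cancel hlt.le, e1]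

theorem support_subset (h : Weighted a b c κ w) : h.support ⊆ Icc 0 1 := fun _ hs => hs.1

theorem support_nonempty (h : Weighted a b c κ w) : h.support.Nonempty := by
  have h0 : (0 : ℝ) ∈ Icc (0 : ℝ) 1 := ⟨le_rfl, zero_le_one⟩
  obtain ⟨s, hs, ρ, hρ, hlim⟩ := (isCompact_Icc (a := (0 : ℝ)) (b := 1)).tendsto_subseq
    fun n => (h.semi_iterate h0 n).1
  exact ⟨s, h.mem_support_of_tendsto h0 hs hρ hlim⟩

theorem isClosed_support (h : Weighted a b c κ w) : IsClosed h.support := by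
  rw [← closure_subset_iff_isClosed]
  intro s hs
  have hs1 : s ∈ Icc (0 : ℝ) 1 := isClosed_Icc.closure_subset_iff.2 h.support_subset hs
  refine ⟨hs1, fun ε hε => ?_⟩
  obtain ⟨x, hx, hxs⟩ := Metric.mem_closure_iff.1 hs (ε / 2) (by linarith)
  obtain ⟨x', hx', hd, hne⟩ := hx.2 (ε / 2) (by linarith)
  rw [dist_comm, Real.dist_eq] at hxs
  by_cases hxe : h.semi x = h.semi s
  · refine ⟨x', hx', ?_, fun q => hne (by rw [q, hxe])⟩
    calc |x' - s| ≤ |x' - x| + |x - s| := abs_sub_le _ _ _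
      _ < ε := by linarith
  · exact ⟨x, hx.1, by linarith, hxe⟩

theorem isCompact_support (h : Weighted a b c κ w) : IsCompact h.support :=
  isCompact_Icc.of_isClosed_subset h.isClosed_support h.support_subset

theorem exists_mem_support (h : Weighted a b c κ w) {lo hi : ℝ} (hlo : lo ∈ Icc (0 : ℝ) 1)
    (hhi : hi ∈ Icc (0 : ℝ) 1) (hlt : h.semi lo < h.semi hi) :
    ∃ x ∈ h.support, x ∈ Ioo lo hi := by
  have hle := h.semi_lt hlo hhi hlt
  have hsub : Icc lo hi ⊆ Icc (0 : ℝ) 1 := Icc_subset_Icc hlo.1 hhi.2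
  have hcont := h.semi_continuousOn.mono hsub
  obtain ⟨y, hy1, hy2⟩ := exists_between hlt
  obtain ⟨s₁, hs₁, es₁⟩ := intermediate_value_Icc hle.le hcont ⟨hy1.le, hy2.le⟩
  have hclosed : IsClosed (Icc lo hi ∩ h.semi ⁻¹' Ici y) :=
    hcont.preimage_isClosed_of_isClosed isClosed_Icc isClosed_Ici
  have hcomp : IsCompact (Icc lo hi ∩ h.semi ⁻¹' Ici y) :=
    isCompact_Icc.of_isClosed_subset hclosed inter_subset_left
  -- The first point at which `semi` reaches an intermediate value `y` belongs to the support, as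
  -- `semi` is smaller at all points of the interval to its left.
  obtain ⟨x, ⟨hx, hxy⟩, hmin⟩ := hcomp.exists_isLeast ⟨s₁, hs₁, es₁.ge⟩
  have hx₁ : x ≤ s₁ := hmin ⟨hs₁, es₁.ge⟩
  have hxe : h.semi x = y :=
    le_antisymm (es₁ ▸ h.semi_monotoneOn (hsub hx) (hsub hs₁) hx₁) hxy
  have hxlo : lo < x := h.semi_lt hlo (hsub hx) (by rw [hxe]; exact hy1)
  have hxhi : x < hi := h.semi_lt (hsub hx) hhi (by rw [hxe]; exact hy2)
  refine ⟨x, ⟨hsub hx, fun ε hε => ?_⟩, hxlo, hxhi⟩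
  have hm1 : lo ≤ max lo (x - ε / 2) := le_max_left _ _
  have hm2 : x - ε / 2 ≤ max lo (x - ε / 2) := le_max_right _ _
  have hm3 : max lo (x - ε / 2) < x := max_lt hxlo (by linarith)
  have hm4 : max lo (x - ε / 2) ∈ Icc lo hi := ⟨hm1, by linarith⟩
  refine ⟨_, hsub hm4, abs_lt.2 ⟨by linarith, by linarith⟩, fun q => ?_⟩
  have := hmin ⟨hm4, by rw [mem_preimage, q, hxe]; exact self_mem_Ici⟩
  linarith

/-- If `semi` is constant on the interval, its midpoint will do. Otherwise an iterate of `p₁` lies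
strictly inside the image; its atom produces an interval on which `semi` is constant, and the middle
of that interval will do. -/
theorem exists_not_mem_support (h : Weighted a b c κ w) {p q : ℝ} (hp : 0 ≤ p) (hpq : p < q)
    (hq : q ≤ 1) : ∃ s ∈ Ioo p q, s ∉ h.support := by
  have hp1 : p ∈ Icc (0 : ℝ) 1 := ⟨hp, by linarith⟩
  have hq1 : q ∈ Icc (0 : ℝ) 1 := ⟨by linarith, hq⟩
  rcases (h.semi_monotoneOn hp1 hq1 hpq.le).eq_or_lt with e | hlt
  · refine ⟨(p + q) / 2, ⟨by linarith, by linarith⟩, fun hs => ?_⟩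
    obtain ⟨s', hs', hd, hne⟩ := hs.2 ((q - p) / 2) (by linarith)
    obtain ⟨d1, d2⟩ := abs_lt.1 hd
    have key : ∀ x ∈ Icc p q, h.semi x = h.semi p := by
      intro x hx
      have hx1 : x ∈ Icc (0 : ℝ) 1 := ⟨hp.trans hx.1, hx.2.trans hq⟩
      exact le_antisymm (e ▸ h.semi_monotoneOn hx1 hq1 hx.2) (h.semi_monotoneOn hp1 hx1 hx.1)
    exact hne (by rw [key s' ⟨by linarith, by linarith⟩,
      key ((p + q) / 2) ⟨by linarith, by linarith⟩])
  · obtain ⟨k, -, hk⟩ := h.exists_iterate_mem (pt_mem h.toLengths 0) (h.semi_spec hp1).1.1 hlt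
      (h.semi_spec hq1).1.2 0
    have hym := h.iterate_mem (pt_mem h.toLengths 0) k
    set y := (SwitchedServer.iet (lamOf a b c))^[k] (SwitchedServer.pt (lamOf a b c) 0) with hy
    have hgap : mass (lamOf a b c) w (Iio y) < mass (lamOf a b c) w (Iic y) := by
      have hsub : ∀ i k, (SwitchedServer.iet (lamOf a b c))^[k]
          (SwitchedServer.pt (lamOf a b c) i) ∈ Iio y →
          (SwitchedServer.iet (lamOf a b c))^[k] (SwitchedServer.pt (lamOf a b c) i) ∈ Iic y :=
        fun i k hx => le_of_lt (show _ < y from hx)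
      have k0 := mul_lt_mul_of_pos_left (weight_lt (hsub 0) (k := k) (lt_irrefl y)
        (le_refl y)) (h.pos 3)
      have k1 := mul_le_mul_of_nonneg_left (weight_mono (hsub 1)) (h.pos 1).le
      have k2 := mul_le_mul_of_nonneg_left (weight_mono (hsub 2)) (h.pos 2).le
      have k3 := mul_le_mul_of_nonneg_left (weight_mono (hsub 3)) (h.pos 0).le
      simp only [mass]
      linarith
    have hm0 := h.mass_nonneg (Iio y)
    have hm1 : mass (lamOf a b c) w (Iic y) ≤ 1 := by
      rw [← h.mass_univ]; exact h.mass_mono fun _ _ _ => mem_univ _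
    have hconst : ∀ s ∈ Icc (mass (lamOf a b c) w (Iio y)) (mass (lamOf a b c) w (Iic y)),
        h.semi s = y := by
      intro s hs
      obtain ⟨m, m1, m2⟩ := h.semi_spec ⟨hm0.trans hs.1, hs.2.trans hm1⟩
      exact h.level_unique m hym m1 m2 hs.1 hs.2
    set g₀ := mass (lamOf a b c) w (Iio y)
    set g₁ := mass (lamOf a b c) w (Iic y)
    have hmid : (g₀ + g₁) / 2 ∈ Icc g₀ g₁ := ⟨by linarith, by linarith⟩
    have hmid1 : (g₀ + g₁) / 2 ∈ Icc (0 : ℝ) 1 := ⟨by linarith, by linarith⟩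
    refine ⟨(g₀ + g₁) / 2, ⟨h.semi_lt hp1 hmid1 (by rw [hconst _ hmid]; exact hk.1),
      h.semi_lt hmid1 hq1 (by rw [hconst _ hmid]; exact hk.2)⟩, fun hs => ?_⟩
    obtain ⟨s', -, hd, hne⟩ := hs.2 ((g₁ - g₀) / 2) (by linarith)
    obtain ⟨d1, d2⟩ := abs_lt.1 hd
    exact hne (by rw [hconst s' ⟨by linarith, by linarith⟩, hconst _ hmid])

theorem omegaSet_eq (h : Weighted a b c κ w) (hd : Breaks d w) {t : ℝ}
    (ht : t ∈ Icc (0 : ℝ) 1) :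
    SwitchedServer.omegaSet (poincareMap d) (param t) = param '' h.support := by
  ext v
  rw [SwitchedServer.omegaSet, mem_omegaLimit_singleton_iff_mapClusterPt]
  constructor
  · intro hv
    obtain ⟨ρ, hρ, hlim⟩ := MapClusterPt.tendsto_subseq hv
    obtain ⟨s, hs, θ, hθ, hlim'⟩ := (isCompact_Icc (a := (0 : ℝ)) (b := 1)).tendsto_subseq
      fun n => (h.semi_iterate ht (ρ n)).1
    refine ⟨s, h.mem_support_of_tendsto ht hs (hρ.comp hθ) hlim', ?_⟩
    have h1 : Tendsto (fun n => param ((contr w)^[ρ (θ n)] t)) atTop (𝓝 (param s)) := by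
      refine (param_continuousOn s hs).tendsto.comp (tendsto_nhdsWithin_iff.2 ⟨hlim', ?_⟩)
      exact Eventually.of_forall fun n => (h.semi_iterate ht _).1
    refine tendsto_nhds_unique h1 ((hlim.comp hθ.tendsto_atTop).congr fun n => ?_)
    exact (hd.iterate_param ht _).2
  · rintro ⟨s, hs, rfl⟩
    rw [mapClusterPt_iff_frequently]
    intro U hU
    rw [frequently_atTop]
    intro N
    obtain ⟨ε, hε, hball⟩ := Metric.mem_nhdsWithin_iff.1 (param_continuousOn s hs.1 hU)
    obtain ⟨k, hk, hnear⟩ := h.exists_iterate_near ht hs hε N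
    refine ⟨k, hk, ?_⟩
    rw [(hd.iterate_param ht k).2]
    exact hball ⟨hnear, (h.semi_iterate ht k).1⟩

/-- The support accumulates at each of its points by `exists_mem_support`. For disconnectedness the
boundary, being a closed curve, has to be cut at two points off the support. -/
theorem isCantorSet_support (h : Weighted a b c κ w) :
    SwitchedServer.IsCantorSet (param '' h.support) := by
  have hcomp : IsCompact (param '' h.support) :=
    h.isCompact_support.image_of_continuousOn (param_continuousOn.mono h.support_subset)
  refine ⟨h.support_nonempty.image _, hcomp, ⟨hcomp.isClosed, ?_⟩, ?_⟩
  · rintro _ ⟨s, hs, rfl⟩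
    rw [accPt_iff_nhds]
    intro U hU
    obtain ⟨ε, hε, hball⟩ := Metric.mem_nhdsWithin_iff.1 (param_continuousOn s hs.1 hU)
    obtain ⟨lo, hi, hlo, hhi, hor, hdist, hlt⟩ :=
      -- A length below `1/2` prevents the nearby point and `s` from being the parameters `0` and
      -- `1` of the same corner.
      h.exists_interval hs (show 0 < min ε (1 / 2) by positivity)
    obtain ⟨x, hx, hx1, hx2⟩ := h.exists_mem_support hlo hhi hlt
    have hdε := hdist.trans_le (min_le_left _ _)
    have hdh := hdist.trans_le (min_le_right _ _)
    have hxs : |x - s| < ε := by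
      rw [abs_lt]; rcases hor with rfl | rfl <;> constructor <;> linarith
    refine ⟨param x, ⟨hball ⟨hxs, hx.1⟩, mem_image_of_mem _ hx⟩, fun e => ?_⟩
    rcases param_injective hx.1 hs.1 e with q | ⟨q1, q2⟩ | ⟨q1, q2⟩ <;>
      rcases hor with rfl | rfl <;> linarith
  · intro A hA hconn
    by_contra hns
    rw [Set.not_subsingleton_iff] at hns
    obtain ⟨v, hv, v', hv', hne⟩ := hns
    obtain ⟨x, hx, rfl⟩ := hA hv
    obtain ⟨y, hy, rfl⟩ := hA hv'
    -- The closed arcs from `r₁` to `r₂` and from `r₂` around to `r₁` meet only in their ends, which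
    -- are not in the image of the support; so a preconnected part of this image cannot meet both.
    have key : ∀ r₁ r₂ : ℝ, 0 < r₁ → r₁ < r₂ → r₂ < 1 → r₁ ∉ h.support → r₂ ∉ h.support →
        (∃ s ∈ Icc r₁ r₂, param s ∈ A) → (∃ s ∈ Icc 0 r₁ ∪ Icc r₂ 1, param s ∈ A) → False := by
      rintro r₁ r₂ hr0 hr hr1 hn1 hn2 ⟨s, hs, hsA⟩ ⟨s', hs', hsA'⟩
      have sub1 : Icc r₁ r₂ ⊆ Icc (0 : ℝ) 1 := Icc_subset_Icc hr0.le hr1.le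
      have sub2 : Icc 0 r₁ ∪ Icc r₂ 1 ⊆ Icc (0 : ℝ) 1 :=
        union_subset (Icc_subset_Icc le_rfl (by linarith)) (Icc_subset_Icc (by linarith) le_rfl)
      have c1 : IsClosed (param '' Icc r₁ r₂) :=
        (isCompact_Icc.image_of_continuousOn (param_continuousOn.mono sub1)).isClosed
      have c2 : IsClosed (param '' (Icc 0 r₁ ∪ Icc r₂ 1)) :=
        ((isCompact_Icc.union isCompact_Icc).image_of_continuousOn
          (param_continuousOn.mono sub2)).isClosed
      have hcov : A ⊆ param '' Icc r₁ r₂ ∪ param '' (Icc 0 r₁ ∪ Icc r₂ 1) := by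
        rw [← image_union]
        intro z hz
        obtain ⟨r, hr', rfl⟩ := hA hz
        refine mem_image_of_mem _ ?_
        rcases le_total r r₁ with q | q
        · exact Or.inr (Or.inl ⟨hr'.1.1, q⟩)
        rcases le_total r r₂ with q' | q'
        · exact Or.inl ⟨q, q'⟩
        · exact Or.inr (Or.inr ⟨q', hr'.1.2⟩)
      obtain ⟨z, hzA, ⟨p, hp, hpz⟩, ⟨p', hp', hpz'⟩⟩ := isPreconnected_closed_iff.1 hconn _ _ c1 c2
        hcov ⟨_, hsA, mem_image_of_mem _ hs⟩ ⟨_, hsA', mem_image_of_mem _ hs'⟩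
      obtain ⟨r, hrX, hrz⟩ := hA hzA
      obtain ⟨p0, p1⟩ := hp
      have hrp : r = p := by
        rcases param_injective hrX.1 (sub1 ⟨p0, p1⟩) (hrz.trans hpz.symm) with q | ⟨q1, q2⟩ |
          ⟨q1, q2⟩
        · exact q
        · linarith
        · linarith
      have hpp : p' = p := by
        rcases param_injective (sub2 hp') (sub1 ⟨p0, p1⟩) (hpz'.trans hpz.symm) with q | ⟨q1, q2⟩ |
          ⟨q1, q2⟩
        · exact q
        · linarith
        · linarith
      subst hrp
      rw [hpp] at hp'
      rcases hp' with ⟨-, q⟩ | ⟨q, -⟩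
      · exact hn1 ((le_antisymm q p0) ▸ hrX)
      · exact hn2 ((le_antisymm p1 q) ▸ hrX)
    have main : ∀ x ∈ h.support, ∀ y ∈ h.support, param x ∈ A → param y ∈ A → x < y →
        param x ≠ param y → False := by
      intro x hx y hy hxA hyA hxy hne
      -- The cuts enclose `y` if `x = 0`, where no cut to the left of `x` is possible, and enclose
      -- `x` otherwise.
      rcases hx.1.1.eq_or_lt with h0 | h0
      · have hy1 : y < 1 := by
          refine lt_of_le_of_ne hy.1.2 fun q => hne ?_
          rw [← h0, q, param_eq ⟨le_rfl, zero_le_one⟩, param_eq ⟨zero_le_one, le_rfl⟩]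
          norm_num
        obtain ⟨r₁, hr₁, hn₁⟩ := h.exists_not_mem_support hx.1.1 hxy hy.1.2
        obtain ⟨r₂, hr₂, hn₂⟩ := h.exists_not_mem_support hy.1.1 hy1 le_rfl
        exact key r₁ r₂ (by linarith [hr₁.1]) (by linarith [hr₁.2, hr₂.1]) hr₂.2 hn₁ hn₂
          ⟨y, ⟨hr₁.2.le, hr₂.1.le⟩, hyA⟩ ⟨x, Or.inl ⟨hx.1.1, hr₁.1.le⟩, hxA⟩
      · obtain ⟨r₁, hr₁, hn₁⟩ := h.exists_not_mem_support le_rfl h0 hx.1.2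
        obtain ⟨r₂, hr₂, hn₂⟩ := h.exists_not_mem_support hx.1.1 hxy hy.1.2
        exact key r₁ r₂ hr₁.1 (by linarith [hr₁.2, hr₂.1]) (by linarith [hr₂.2, hy.1.2]) hn₁ hn₂
          ⟨x, ⟨hr₁.2.le, hr₂.1.le⟩, hxA⟩ ⟨y, Or.inr ⟨hr₂.2.le, hy.1.2⟩, hyA⟩
    rcases lt_trichotomy x y with q | q | q
    · exact main x hx y hy hv hv' q hne
    · exact hne (by rw [q])
    · exact main y hy x hx hv' hv q hne.symm

theorem isCantorSet_omegaSet (h : Weighted a b c κ w) (hd : Breaks d w) {v : Fin 3 → ℝ}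
    (hv : v ∈ boundary) :
    SwitchedServer.IsCantorSet (SwitchedServer.omegaSet (poincareMap d) v) := by
  obtain ⟨t, ht, rfl⟩ := exists_param hv
  rw [h.omegaSet_eq hd ht]
  exact h.isCantorSet_support

end Weighted

/-! ### Numerical values of the weights -/

open scoped Classical in
theorem weight_succ (F : ℝ → ℝ) (p : ℝ) (A : Set ℝ) :
    weight F p A = (if p ∈ A then 1 else 0) + weight F (F p) A / 2 := by
  rw [weight, (summable_weight F p A).tsum_eq_zero_add, weight, ← tsum_div_const]
  congr 1
  · simp
  · refine tsum_congr fun k => ?_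
    change (if F^[k] (F p) ∈ A then (1 : ℝ) / 2 ^ (k + 1) else 0) =
      (if F^[k] (F p) ∈ A then (1 : ℝ) / 2 ^ k else 0) / 2
    by_cases hk : F^[k] (F p) ∈ A
    · simp only [if_pos hk, pow_succ, div_div]
    · simp only [if_neg hk, zero_div]

theorem weight_le_two (F : ℝ → ℝ) (p : ℝ) (A : Set ℝ) : weight F p A ≤ 2 :=
  (weight_mono fun _ _ => mem_univ _).trans (weight_univ F p).le

/-- The binary number whose digits, from `w.length` down, mark the occurrences of `i` in `w`. -/
def code : List (Fin 4) → Fin 4 → ℕ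
  | [], _ => 0
  | j :: w, i => (if j = i then 2 ^ (w.length + 1) else 0) + code w i

/-- The itinerary gives the leading binary digits of the weight, and the tail of the series
contributes between `0` and `2` after scaling by `2 ^ w.length`. -/
theorem weight_code {F : ℝ → ℝ} {A : Set ℝ} {i : Fin 4} (w : List (Fin 4)) :
    ∀ p, (∀ k (hk : k < w.length), F^[k] p ∈ A ↔ w[k] = i) →
      (code w i : ℝ) ≤ 2 ^ w.length * weight F p A ∧
        2 ^ w.length * weight F p A ≤ code w i + 2 := by
  classical
  induction w with
  | nil =>
    intro p _
    simpa [code] using ⟨weight_nonneg F p A, weight_le_two F p A⟩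
  | cons j w ih =>
    intro p hp
    obtain ⟨h1, h2⟩ := ih (F p) fun k hk => by
      have := hp (k + 1) (by simpa using hk)
      simpa using this
    have h3 : p ∈ A ↔ j = i := hp 0 (by simp)
    have h4 : (2 : ℝ) ^ (j :: w).length * weight F p A =
        (if j = i then 2 ^ (w.length + 1) else 0) + 2 ^ w.length * weight F (F p) A := by
      rw [weight_succ, List.length_cons, pow_succ]
      simp only [h3]
      split_ifs <;> ring
    rw [h4]
    simp only [code]
    push_cast
    constructor <;> linarith

/-- The codes of the itinerary of length `40` of a point under `T`. -/
def codes (v : Vec) : Option (List ℕ) :=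
  (tIET.orbit 40 v).map fun r => [code r.1 0, code r.1 1, code r.1 2]

namespace Lengths

variable {a b c κ : ℝ}

theorem cell_eq : SwitchedServer.cell (lamOf a b c) = ![Ico 0 a, Ico a (a + (b + c)),
    Ico (a + (b + c)) (a + (b + c) + (c + a)),
    Icc (a + (b + c) + (c + a)) (2 * a + 2 * b + 2 * c)] := by
  rw [← total_eq]; rfl

variable (h : Lengths a b c κ)
include h

theorem mem_cell_iff {i j : Fin 4} {x : ℝ} (hx : x ∈ tIET.openCell a b c j) :
    x ∈ SwitchedServer.cell (lamOf a b c) i ↔ j = i := by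
  obtain ⟨h1, h2, h3⟩ := h.lengths_pos
  obtain ⟨h4, h5⟩ := hx
  rw [cell_eq]
  fin_cases j <;> simp [tIET, ev] at h4 h5 <;> fin_cases i <;> simp <;>
    first | (intros; linarith) | (constructor <;> linarith)

theorem weight_of_codes {v : Vec} {m : Fin 3 → ℕ} (hv : codes v = some [m 0, m 1, m 2])
    (i : Fin 3) :
    |weight (SwitchedServer.iet (lamOf a b c)) (ev a b c v)
      (SwitchedServer.cell (lamOf a b c) i.castSucc) - (m i + 1) / 2 ^ 40| ≤ 1 / 2 ^ 40 := by
  simp only [codes, Option.map_eq_some_iff, List.cons.injEq, and_true] at hv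
  obtain ⟨⟨w, v'⟩, ho, hm⟩ := hv
  obtain ⟨h1, h2, -⟩ := IET.orbit_spec h h.realizes_t ho
  have h3 : code w i.castSucc = m i := by
    obtain ⟨e0, e1, e2⟩ := hm
    fin_cases i
    · exact e0
    · exact e1
    · exact e2
  obtain ⟨h4, h5⟩ := weight_code w _ fun k hk => h.mem_cell_iff (i := i.castSucc) (h2 k hk)
  rw [h1, h3] at h4 h5
  rw [abs_le]
  constructor <;> linarith

end Lengths

theorem codes_q : codes (2, 0, 1) = some [588553429570, 293200859408, 1179258537124] := by
  decide +kernel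

theorem codes_p₂ : codes (1, 0, 1) = some [155193581864, 1172812400772, 318979199568] := by
  decide +kernel

theorem codes_p₃ : codes (2, 1, 1) = some [569657925920, 146315217032, 1414195860050] := by
  decide +kernel

theorem abs_mul_sub_le {p r p' r' ε : ℝ} (hp : |p - p'| ≤ ε) (hr : |r - r'| ≤ ε) (hp' : |p'| ≤ 1)
    (hr' : |r'| ≤ 1) (hε : ε ≤ 1) : |p * r - p' * r'| ≤ 3 * ε := by
  have h0 : 0 ≤ ε := (abs_nonneg _).trans hp
  calc |p * r - p' * r'| = |(p - p') * (r - r') + p' * (r - r') + r' * (p - p')| := by ring_nf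
    _ ≤ |p - p'| * |r - r'| + |p'| * |r - r'| + |r'| * |p - p'| := by
        rw [← abs_mul, ← abs_mul, ← abs_mul]; exact abs_add_three _ _ _
    _ ≤ 1 * ε + 1 * ε + 1 * ε := by
        gcongr
        exact hp.trans hε
    _ = 3 * ε := by ring

theorem cramer {α β γ δ e f : ℝ} (hD : α * δ - β * γ ≠ 0) (p q : ℝ) :
    α * p + β * q = e ∧ γ * p + δ * q = f ↔
      p = (e * δ - β * f) / (α * δ - β * γ) ∧ q = (α * f - e * γ) / (α * δ - β * γ) := by
  rw [eq_div_iff hD, eq_div_iff hD]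
  constructor
  · rintro ⟨rfl, rfl⟩
    constructor <;> ring
  · rintro ⟨h1, h2⟩
    constructor <;> refine mul_right_cancel₀ hD ?_
    · linear_combination α * h1 + β * h2
    · linear_combination γ * h1 + δ * h2

/-- The linear system, with the coefficients expressed by three weight vectors. -/
def ReducedSystem (x y z u : Fin 3 → ℝ) : Prop :=
  u 0 = 1 / 2 * (1 - u 0 - u 1 - u 2 + x 0 / 2 * (1 - u 1 - u 2) + y 0 * u 1 + z 0 * u 2) ∧
  u 1 = 1 / 2 * (x 1 / 2 * (1 - u 1 - u 2) + y 1 * u 1 + z 1 * u 2) ∧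
  u 2 = 1 / 2 * (x 2 / 2 * (1 - u 1 - u 2) + y 2 * u 1 + z 2 * u 2)

set_option maxHeartbeats 1000000 in
-- The last two equations involve only `u 1` and `u 2`; Cramer's rule solves this system of size
-- two, and the first equation then gives `u 0`. All bounds propagate the uncertainty `2 ^ (-40)` of
-- the weights.
theorem exists_reducedSystem {x y z : Fin 3 → ℝ}
    (hx : ∀ i, |x i - (![588553429570, 293200859408, 1179258537124] i + 1) / 2 ^ 40| ≤ 1 / 2 ^ 40)
    (hy : ∀ i, |y i - (![155193581864, 1172812400772, 318979199568] i + 1) / 2 ^ 40| ≤ 1 / 2 ^ 40)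
    (hz : ∀ i, |z i - (![569657925920, 146315217032, 1414195860050] i + 1) / 2 ^ 40| ≤ 1 / 2 ^ 40) :
    ∃ u : Fin 3 → ℝ, (∀ w, ReducedSystem x y z w ↔ w = u) ∧ |u 0 - 0.2746103297845| ≤ 1e-9 ∧
      |u 1 - 0.1249008197340| ≤ 1e-9 ∧ |u 2 - 0.4043960552680| ≤ 1e-9 := by
  simp only [Fin.forall_fin_succ, abs_le] at hx hy hz
  simp at hx hy hz
  obtain ⟨hx0, hx1, hx2⟩ := hx
  obtain ⟨hy0, hy1, hy2⟩ := hy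
  obtain ⟨hz0, hz1, hz2⟩ := hz
  obtain ⟨α, hα⟩ : ∃ α, α = 1 - y 1 / 2 + x 1 / 4 := ⟨_, rfl⟩
  obtain ⟨β, hβ⟩ : ∃ β, β = x 1 / 4 - z 1 / 2 := ⟨_, rfl⟩
  obtain ⟨γ, hγ⟩ : ∃ γ, γ = x 2 / 4 - y 2 / 2 := ⟨_, rfl⟩
  obtain ⟨δ, hδ⟩ : ∃ δ, δ = 1 - z 2 / 2 + x 2 / 4 := ⟨_, rfl⟩
  obtain ⟨e, he⟩ : ∃ e, e = x 1 / 4 := ⟨_, rfl⟩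
  obtain ⟨f, hf⟩ : ∃ f, f = x 2 / 4 := ⟨_, rfl⟩
  have α' : |α - 0.5333328247086| ≤ 3e-12 := by
    rw [abs_le, hα]; constructor <;> linarith
  have β' : |β - 0.0001296997068| ≤ 3e-12 := by
    rw [abs_le, hβ]; constructor <;> linarith
  have γ' : |γ - 0.1230774018920| ≤ 3e-12 := by
    rw [abs_le, hγ]; constructor <;> linarith
  have δ' : |δ - 0.6250305268911| ≤ 3e-12 := by
    rw [abs_le, hδ]; constructor <;> linarith
  have e' : |e - 0.0666661570469| ≤ 3e-12 := by
    rw [abs_le, he]; constructor <;> linarith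
  have f' : |f - 0.2681323478839| ≤ 3e-12 := by
    rw [abs_le, hf]; constructor <;> linarith
  have αδ := abs_mul_sub_le α' δ' (by norm_num) (by norm_num) (by norm_num)
  have βγ := abs_mul_sub_le β' γ' (by norm_num) (by norm_num) (by norm_num)
  have eδ := abs_mul_sub_le e' δ' (by norm_num) (by norm_num) (by norm_num)
  have βf := abs_mul_sub_le β' f' (by norm_num) (by norm_num) (by norm_num)
  have αf := abs_mul_sub_le α' f' (by norm_num) (by norm_num) (by norm_num)
  have eγ := abs_mul_sub_le e' γ' (by norm_num) (by norm_num) (by norm_num)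
  rw [abs_le] at αδ βγ eδ βf αf eγ
  obtain ⟨D, hD⟩ : ∃ D, D = α * δ - β * γ := ⟨_, rfl⟩
  have hD0 : 1 / 4 < D := by rw [hD]; linarith
  -- Since `D > 1/4`, division enlarges the error at most fourfold. Comparing `N` with `v * D`
  -- avoids a separate estimate of the quotient.
  have quot : ∀ N v : ℝ, |N - v * D| ≤ 5e-11 → |N / D - v| ≤ 2e-10 := by
    intro N v hN
    rw [div_sub' (by linarith), abs_div, abs_of_pos (show 0 < D by linarith),
      div_le_iff₀ (by linarith), mul_comm D]
    linarith
  obtain ⟨u₁, hu₁⟩ : ∃ u, u = (e * δ - β * f) / D := ⟨_, rfl⟩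
  obtain ⟨u₂, hu₂⟩ : ∃ u, u = (α * f - e * γ) / D := ⟨_, rfl⟩
  have u₁' : |u₁ - 0.1249008197340| ≤ 2e-10 := by
    rw [hu₁]
    refine quot _ _ ?_
    rw [hD, abs_le]; constructor <;> linarith
  have u₂' : |u₂ - 0.4043960552680| ≤ 2e-10 := by
    rw [hu₂]
    refine quot _ _ ?_
    rw [hD, abs_le]; constructor <;> linarith
  have sol := cramer (e := e) (f := f) (hD ▸ (show D ≠ 0 by linarith))
  rw [← hD, ← hu₁, ← hu₂] at sol
  -- The factor `1/3` results from moving the term `-u 0 / 2` of the first equation to the left.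
  refine ⟨![1 / 3 * (1 - u₁ - u₂ + x 0 / 2 * (1 - u₁ - u₂) + y 0 * u₁ + z 0 * u₂), u₁, u₂],
    fun w => ⟨fun ⟨h0, h1, h2⟩ => ?_, ?_⟩, ?_, ?_, ?_⟩
  · have k1 : α * w 1 + β * w 2 = e := by rw [hα, hβ, he]; linarith
    have k2 : γ * w 1 + δ * w 2 = f := by rw [hγ, hδ, hf]; linarith
    obtain ⟨w1, w2⟩ := (sol _ _).1 ⟨k1, k2⟩
    rw [w1, w2] at h0
    funext i
    fin_cases i
    · simp; linarith
    · exact w1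
    · exact w2
  · rintro rfl
    obtain ⟨eq₁, eq₂⟩ := (sol _ _).2 ⟨rfl, rfl⟩
    rw [hα, hβ, he] at eq₁
    rw [hγ, hδ, hf] at eq₂
    refine ⟨?_, ?_, ?_⟩ <;> simp only [cons_val_zero, cons_val_one, cons_val_two, tail_cons,
      head_cons] <;> linarith
  · have a1 : |x 0 / 2 - 0.26764311295| ≤ 2e-10 := by rw [abs_le]; constructor <;> linarith
    have a2 : |y 0 - 0.14114774046| ≤ 2e-10 := by rw [abs_le]; constructor <;> linarith
    have a3 : |z 0 - 0.51810086545| ≤ 2e-10 := by rw [abs_le]; constructor <;> linarith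
    have m1 := abs_mul_sub_le a1 u₁' (by norm_num) (by norm_num) (by norm_num)
    have m2 := abs_mul_sub_le a1 u₂' (by norm_num) (by norm_num) (by norm_num)
    have m3 := abs_mul_sub_le a2 u₁' (by norm_num) (by norm_num) (by norm_num)
    have m4 := abs_mul_sub_le a3 u₂' (by norm_num) (by norm_num) (by norm_num)
    rw [abs_le] at a1 a2 a3 m1 m2 m3 m4 u₁' u₂'
    simp only [cons_val_zero]
    rw [abs_le]
    constructor <;> linarith
  · refine u₁'.trans (by norm_num)
  · refine u₂'.trans (by norm_num)

namespace Lengths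

variable {a b c κ : ℝ} (h : Lengths a b c κ)
include h

/-- The orbits of `p₁ = 0` and `p₄ = |λ|` coincide after one step, so three weight vectors suffice
and the first column of `M` is `(1, 0, 0)`. The initial visit of `p₄` to `I₄` does not count for the
first three cells. -/
theorem coef_eq (i : Fin 3) :
    SwitchedServer.coef (lamOf a b c) i.castSucc 0 = (if i = 0 then 1 else 0) +
      weight (SwitchedServer.iet (lamOf a b c)) (ev a b c (2, 0, 1))
        (SwitchedServer.cell (lamOf a b c) i.castSucc) / 2 ∧
    SwitchedServer.coef (lamOf a b c) i.castSucc 1 =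
      weight (SwitchedServer.iet (lamOf a b c)) (ev a b c (1, 0, 1))
        (SwitchedServer.cell (lamOf a b c) i.castSucc) ∧
    SwitchedServer.coef (lamOf a b c) i.castSucc 2 =
      weight (SwitchedServer.iet (lamOf a b c)) (ev a b c (2, 1, 1))
        (SwitchedServer.cell (lamOf a b c) i.castSucc) ∧
    SwitchedServer.coef (lamOf a b c) i.castSucc 3 =
      weight (SwitchedServer.iet (lamOf a b c)) (ev a b c (2, 0, 1))
        (SwitchedServer.cell (lamOf a b c) i.castSucc) / 2 := by
  obtain ⟨h1, h2, h3⟩ := h.lengths_pos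
  have hc : ∀ j, SwitchedServer.coef (lamOf a b c) i.castSucc j =
      weight (SwitchedServer.iet (lamOf a b c)) (SwitchedServer.pt (lamOf a b c) j)
        (SwitchedServer.cell (lamOf a b c) i.castSucc) := fun _ => rfl
  have e0 : SwitchedServer.iet (lamOf a b c) 0 = ev a b c (2, 0, 1) := by
    rw [iet_eq, if_pos h1]; simp [ev]; ring
  have e3 : SwitchedServer.iet (lamOf a b c) (2 * a + 2 * b + 2 * c) = ev a b c (2, 0, 1) := by
    rw [iet_eq, if_neg (by linarith), if_neg (by linarith), if_neg (by linarith)]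
    simp [ev]; ring
  simp only [hc, Weighted.pt_eq h]
  refine ⟨?_, ?_, ?_, ?_⟩
  · rw [cons_val_zero, weight_succ, e0, cell_eq]
    congr 1
    fin_cases i <;> simp [h1]; intros; linarith
  · congr 1
    simp [ev]; ring
  · congr 1
    simp [ev]
  · change weight _ (2 * a + 2 * b + 2 * c) _ = _
    rw [weight_succ, e3, if_neg, zero_add]
    rw [cell_eq]
    fin_cases i <;> simp <;> intros <;> linarith

theorem solvesSystem_iff (u : Fin 3 → ℝ) : SwitchedServer.SolvesSystem (lamOf a b c) u ↔
    ReducedSystem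
      (fun i => weight (SwitchedServer.iet (lamOf a b c)) (ev a b c (2, 0, 1))
        (SwitchedServer.cell (lamOf a b c) i.castSucc))
      (fun i => weight (SwitchedServer.iet (lamOf a b c)) (ev a b c (1, 0, 1))
        (SwitchedServer.cell (lamOf a b c) i.castSucc))
      (fun i => weight (SwitchedServer.iet (lamOf a b c)) (ev a b c (2, 1, 1))
        (SwitchedServer.cell (lamOf a b c) i.castSucc)) u := by
  obtain ⟨a0, a1, a2, a3⟩ := h.coef_eq 0
  obtain ⟨b0, b1, b2, b3⟩ := h.coef_eq 1
  obtain ⟨c0, c1, c2, c3⟩ := h.coef_eq 2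
  simp only [Fin.isValue, Fin.castSucc_zero, Fin.castSucc_one, ↓reduceIte,
    show (2 : Fin 3).castSucc = 2 from rfl, show (1 : Fin 3) ≠ 0 by decide,
    show (2 : Fin 3) ≠ 0 by decide] at a0 a1 a2 a3 b0 b1 b2 b3 c0 c1 c2 c3
  simp only [SwitchedServer.SolvesSystem, ReducedSystem, funext_iff, Fin.forall_fin_succ]
  simp [SwitchedServer.M, mulVec, dotProduct, Fin.sum_univ_three, Matrix.mul_apply, vecHead,
    a0, a1, a2, a3, b0, b1, b2, b3, c0, c1, c2, c3]
  refine and_congr ?_ (and_congr ?_ ?_) <;> constructor <;> intro hu <;> linarith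

theorem sum_weight {p : ℝ} (hp : p ∈ Icc 0 (SwitchedServer.total (lamOf a b c))) :
    ∑ i, weight (SwitchedServer.iet (lamOf a b c)) p (SwitchedServer.cell (lamOf a b c) i) = 2 := by
  obtain ⟨h1, h2, h3⟩ := h.lengths_pos
  rw [← weight_univ (SwitchedServer.iet (lamOf a b c)) p]
  simp only [weight]
  rw [← Summable.tsum_finsetSum fun i _ => summable_weight _ _ _]
  refine tsum_congr fun k => ?_
  have hk := h.iterate_mem hp k
  rw [total_eq] at hk
  obtain ⟨h4, h5⟩ := hk
  generalize (SwitchedServer.iet (lamOf a b c))^[k] p = x at h4 h5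
  rw [cell_eq, Fin.sum_univ_four, if_pos (mem_univ x)]
  simp only [cons_val_zero, cons_val_one, cons_val_two, cons_val_three, tail_cons, head_cons,
    mem_Ico, mem_Icc]
  rcases lt_or_ge x a with h6 | h6
  · rw [if_pos ⟨h4, h6⟩, if_neg (by rintro ⟨_, _⟩; linarith), if_neg (by rintro ⟨_, _⟩; linarith),
      if_neg (by rintro ⟨_, _⟩; linarith)]
    ring
  rcases lt_or_ge x (a + (b + c)) with h7 | h7
  · rw [if_neg (by rintro ⟨_, _⟩; linarith), if_pos ⟨h6, h7⟩, if_neg (by rintro ⟨_, _⟩; linarith),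
      if_neg (by rintro ⟨_, _⟩; linarith)]
    ring
  rcases lt_or_ge x (a + (b + c) + (c + a)) with h8 | h8
  · rw [if_neg (by rintro ⟨_, _⟩; linarith), if_neg (by rintro ⟨_, _⟩; linarith), if_pos ⟨h7, h8⟩,
      if_neg (by rintro ⟨_, _⟩; linarith)]
    ring
  · rw [if_neg (by rintro ⟨_, _⟩; linarith), if_neg (by rintro ⟨_, _⟩; linarith),
      if_neg (by rintro ⟨_, _⟩; linarith), if_pos ⟨h8, h5⟩]
    ring

/-- The three rows of the linear system say that the first three cells carry the masses `u i`; the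
fourth mass follows because the total is `1`. -/
theorem weighted {u : Fin 3 → ℝ} (hu : SwitchedServer.SolvesSystem (lamOf a b c) u)
    (hpos : ∀ i, 0 < u i) (hlt : 0 < 1 - u 0 - u 1 - u 2) :
    Weighted a b c κ ![u 0, u 1, u 2, 1 - u 0 - u 1 - u 2] where
  toLengths := h
  pos i := by
    have h0 := hpos 0
    have h1 := hpos 1
    have h2 := hpos 2
    fin_cases i <;> assumption
  sum := by simp
  mass_cell := by
    have hs : ∀ i : Fin 3, mass (lamOf a b c) ![u 0, u 1, u 2, 1 - u 0 - u 1 - u 2]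
        (SwitchedServer.cell (lamOf a b c) i.castSucc) = u i := by
      obtain ⟨s0, s1, s2⟩ := (h.solvesSystem_iff u).1 hu
      intro i
      obtain ⟨k0, k1, k2, k3⟩ := h.coef_eq i
      have hm : mass (lamOf a b c) ![u 0, u 1, u 2, 1 - u 0 - u 1 - u 2]
          (SwitchedServer.cell (lamOf a b c) i.castSucc) =
          (1 - u 0 - u 1 - u 2) / 2 * SwitchedServer.coef (lamOf a b c) i.castSucc 0 +
          u 1 / 2 * SwitchedServer.coef (lamOf a b c) i.castSucc 1 +
          u 2 / 2 * SwitchedServer.coef (lamOf a b c) i.castSucc 2 +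
          u 0 / 2 * SwitchedServer.coef (lamOf a b c) i.castSucc 3 := rfl
      rw [hm, k0, k1, k2, k3]
      fin_cases i
      · simp at s0 ⊢; linarith
      · simp at s1 ⊢; linarith
      · simp at s2 ⊢; linarith
    have hall : ∑ i, mass (lamOf a b c) ![u 0, u 1, u 2, 1 - u 0 - u 1 - u 2]
        (SwitchedServer.cell (lamOf a b c) i) = 1 := by
      have e := fun j => h.sum_weight (Weighted.pt_mem h j)
      simp only [Fin.sum_univ_four] at e
      have e0 := e 0
      have e1 := e 1
      have e2 := e 2
      have e3 := e 3
      simp [Fin.sum_univ_four, mass]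
      linear_combination (1 - u 0 - u 1 - u 2) / 2 * e0 + u 1 / 2 * e1 + u 2 / 2 * e2 +
        u 0 / 2 * e3
    rw [Fin.sum_univ_castSucc, Fin.sum_univ_three, hs, hs, hs] at hall
    refine Fin.lastCases ?_ fun i => ?_
    · change _ = 1 - u 0 - u 1 - u 2
      linarith
    · rw [hs]
      fin_cases i <;> rfl

theorem numeric : |lamOf a b c 2 / SwitchedServer.total (lamOf a b c) - 0.3444| < 1e-4 ∧
    |(lamOf a b c 0 + lamOf a b c 3) / SwitchedServer.total (lamOf a b c) - 0.4182| < 1e-4 ∧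
    |lamOf a b c 1 / SwitchedServer.total (lamOf a b c) - 0.2372| < 1e-4 := by
  obtain ⟨h1, h2, h3, h4, h5, h6, -, -, -⟩ := h
  have hpos : 0 < 2 * a + 2 * b + 2 * c := by linarith
  rw [total_eq]
  simp only [lamOf]
  refine ⟨?_, ?_, ?_⟩ <;> rw [div_sub' hpos.ne', abs_div, abs_of_pos hpos, div_lt_iff₀ hpos,
    abs_lt] <;> simp <;> constructor <;> linarith

/-- The linear system has a unique solution, known to nine decimal places. -/
theorem exists_solution : ∃ u : Fin 3 → ℝ,
    (∀ w, SwitchedServer.SolvesSystem (lamOf a b c) w ↔ w = u) ∧ |u 0 - 0.2746103297845| ≤ 1e-9 ∧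
      |u 1 - 0.1249008197340| ≤ 1e-9 ∧ |u 2 - 0.4043960552680| ≤ 1e-9 := by
  have hx := h.weight_of_codes (m := ![588553429570, 293200859408, 1179258537124]) codes_q
  have hy := h.weight_of_codes (m := ![155193581864, 1172812400772, 318979199568]) codes_p₂
  have hz := h.weight_of_codes (m := ![569657925920, 146315217032, 1414195860050]) codes_p₃
  simp only [Fin.forall_fin_succ, Fin.isValue, cons_val_zero, cons_val_succ] at hx hy hz
  obtain ⟨u, hu, hb⟩ := exists_reducedSystem
    (x := fun i => weight _ _ (SwitchedServer.cell (lamOf a b c) i.castSucc))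
    (y := fun i => weight _ _ (SwitchedServer.cell (lamOf a b c) i.castSucc))
    (z := fun i => weight _ _ (SwitchedServer.cell (lamOf a b c) i.castSucc))
    (by simpa [Fin.forall_fin_succ] using hx) (by simpa [Fin.forall_fin_succ] using hy)
    (by simpa [Fin.forall_fin_succ] using hz)
  exact ⟨u, fun w => (h.solvesSystem_iff w).trans (hu w), hb⟩

end Lengths

theorem parameter_bounds {u : Fin 3 → ℝ} (h0 : |u 0 - 0.2746103297845| ≤ 1e-9)
    (h1 : |u 1 - 0.1249008197340| ≤ 1e-9) (h2 : |u 2 - 0.4043960552680| ≤ 1e-9) :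
    |SwitchedServer.d₁ u - 0.213841| < 1e-6 ∧ |SwitchedServer.d₂ u - 4.036935| < 1e-6 ∧
      |SwitchedServer.d₃ u - 1.428826| < 1e-6 := by
  rw [abs_le] at h0 h1 h2
  unfold SwitchedServer.d₁ SwitchedServer.d₂ SwitchedServer.d₃
  have p0 : 0 < 3 * u 0 := by linarith
  have p1 : 0 < 3 * (u 0 + u 1) - 1 := by linarith
  have p2 : 0 < 3 * (u 0 + u 1 + u 2) - 2 := by linarith
  refine ⟨?_, ?_, ?_⟩
  · rw [sub_sub, div_sub' p0.ne', abs_div, abs_of_pos p0, div_lt_iff₀ p0, abs_lt]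
    constructor <;> linarith
  · rw [div_sub' p1.ne', abs_div, abs_of_pos p1, div_lt_iff₀ p1, abs_lt]
    constructor <;> linarith
  · rw [div_sub' p2.ne', abs_div, abs_of_pos p2, div_lt_iff₀ p2, abs_lt]
    constructor <;> linarith

end FlipIET

theorem theorem2 (η : ℝ) (ν lam : Fin 4 → ℝ)
    (hν : SwitchedServer.IsPerronPair η ν) (hlam : lam = SwitchedServer.Q *ᵥ ν) :
    ∃ u : Fin 3 → ℝ,
      -- `u` is the unique solution of the linear system
      (∀ w, SwitchedServer.SolvesSystem lam w ↔ w = u) ∧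
      (∀ i, 0 < u i) ∧ 0 < 1 - u 0 - u 1 - u 2 ∧
      -- the parameters are positive, with the stated numerical values
      0 < SwitchedServer.d₁ u ∧ 0 < SwitchedServer.d₂ u ∧ 0 < SwitchedServer.d₃ u ∧
      |SwitchedServer.d₁ u - 0.213841| < 1e-6 ∧
      |SwitchedServer.d₂ u - 4.036935| < 1e-6 ∧
      |SwitchedServer.d₃ u - 1.428826| < 1e-6 ∧
      ∀ d : Fin 3 → Fin 3 → ℝ, (∀ i j, i ≠ j → 0 < d i j) →
        d 0 2 / d 0 1 = SwitchedServer.d₁ u →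
        d 1 0 / d 1 2 = SwitchedServer.d₂ u →
        d 2 1 / d 2 0 = SwitchedServer.d₃ u →
        -- (a)
        ¬ SwitchedServer.HasPeriodicOrbit d ∧
        -- (b)
        SwitchedServer.BoundaryIsSemiconj (SwitchedServer.poincareMap d)
          (SwitchedServer.iet lam) (SwitchedServer.total lam) ∧
        -- (c)
        (∀ v ∈ SwitchedServer.boundary,
          SwitchedServer.IsCantorSet
            (SwitchedServer.omegaSet (SwitchedServer.poincareMap d) v)) ∧
        -- (d)
        (∀ S : SwitchedServer.Trajectory d,
          S.HasFreq 0 (lam 2 / SwitchedServer.total lam) ∧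
          S.HasFreq 1 ((lam 0 + lam 3) / SwitchedServer.total lam) ∧
          S.HasFreq 2 (lam 1 / SwitchedServer.total lam)) ∧
        |lam 2 / SwitchedServer.total lam - 0.3444| < 1e-4 ∧
        |(lam 0 + lam 3) / SwitchedServer.total lam - 0.4182| < 1e-4 ∧
        |lam 1 / SwitchedServer.total lam - 0.2372| < 1e-4 := by 
  obtain ⟨a, b, c, κ, h, rfl, -⟩ := FlipIET.exists_lengths hν hlam
  obtain ⟨u, hu, h0, h1, h2⟩ := h.exists_solution
  obtain ⟨e₁, e₂, e₃⟩ := FlipIET.parameter_bounds h0 h1 h2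
  rw [abs_le] at h0 h1 h2
  have hpos : ∀ i, 0 < u i := by
    intro i
    fin_cases i
    · change 0 < u 0; linarith
    · change 0 < u 1; linarith
    · change 0 < u 2; linarith
  have hlt : 0 < 1 - u 0 - u 1 - u 2 := by linarith
  have hw := h.weighted ((hu u).2 rfl) hpos hlt
  refine ⟨u, hu, hpos, hlt, by linarith [(abs_lt.1 e₁).1], by linarith [(abs_lt.1 e₂).1],
    by linarith [(abs_lt.1 e₃).1], e₁, e₂, e₃, fun d hd k₁ k₂ k₃ => ?_⟩
  have hb : FlipIET.Breaks d ![u 0, u 1, u 2, 1 - u 0 - u 1 - u 2] := by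
    constructor
    · exact hd
    · exact hpos 0
    · change u 0 < 1 / 3; linarith
    · change 1 / 3 < u 0 + u 1; linarith
    · change u 0 + u 1 < 2 / 3; linarith
    · change 2 / 3 < u 0 + u 1 + u 2; linarith
    · change u 0 + u 1 + u 2 < 1; linarith
    · exact k₁
    · exact k₂
    · exact k₃
  refine ⟨hw.not_hasPeriodicOrbit hb, hw.boundaryIsSemiconj hb,
    fun v hv => hw.isCantorSet_omegaSet hb hv, fun S => ⟨?_, ?_, ?_⟩, h.numeric⟩
  · simpa [FlipIET.tankOf, Fin.sum_univ_four] using hw.hasFreq hb S 0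
  · simpa [FlipIET.tankOf, Fin.sum_univ_four] using hw.hasFreq hb S 1
  · simpa [FlipIET.tankOf, Fin.sum_univ_four] using hw.hasFreq hb S 2
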